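/- Let $\theta\in\{-1,0,1\}$ (fermions, classical particles, bosons) and $\varrho>1$. For $v\in\mathbb{R}^3$ put $$\mu(v)=\frac{1}{\varrho e^{|v|^2}-\theta},\qquad \mathcal M=\mu(1+\theta\mu).$$ For $u,v\in\mathbb{R}^3$, $\omega\in\mathbb{S}^2$ put $u'=u+\omega(\omega\cdot(v-u))$, $v'=v-\omega(\omega\cdot(v-u))$, $q=|\omega\cdot(v-u)|$, and define $$\mathcal Q[F,G](v)=\tfrac12\int_{\mathbb{R}^3}\int_{\mathbb{S}^2}q\,\big[F(u')G(v')+G(u')F(v')-F(u)G(v)-G(u)F(v)\big]\,d\omega\,du,$$ $$\mathscr Q[F,G;H](v)=\tfrac12\int_{\mathbb{R}^3}\int_{\mathbb{S}^2}q\,\big[\big(F(u')G(v')+G(u')F(v')\big)\big(H(u)+H(v)\big)-\big(F(u)G(v)+G(u)F(v)\big)\big(H(u')+H(v')\big)\big]\,d\omega\,du.$$ The linearized quantum Boltzmann operator is $$L[f]=-2\mathcal M^{-1/2}\mathcal Q[\mu,\mathcal M^{1/2}f]-2\theta\mathcal M^{-1/2}\mathscr Q[\mu,\mathcal M^{1/2}f;\mu]-\theta\mathcal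 M^{-1/2}\mathscr Q[\mu,\mu;\mathcal M^{1/2}f].$$ Put $$\nu(v)=\int_{\mathbb{R}^3}\int_{\mathbb{S}^2}q\,\mu(u)\mu(v)\mu(u')\mu(v')\,\varrho^2e^{|u|^2+|v|^2}\mathcal M^{-1}(v)\,d\omega\,du,\qquad \|f\|_\nu=\Big(\int_{\mathbb{R}^3}\nu|f|^2\,dv\Big)^{1/2},\qquad \langle f,g\rangle=\int_{\mathbb{R}^3}fg\,dv.$$ All functions are real-valued. Then: (a) For every $f\in L^2(\mathbb{R}^3)$ the integrals defining $L[f](v)$ converge absolutely for almost every $v$. The null space $N(L)=\{f\in L^2(\mathbb{R}^3): L[f]=0 \text{ a.e.}\}$ is the five-dimensional space of functions $\mathcal M^{1/2}(a+b\cdot v+c|v|^2)$ with $a,c\in\mathbb{R}$, $b\in\mathbb{R}^3$. (b) Let $P$ be the orthogonal projection of $L^2(\mathbb{R}^3)$ onto $N(L)$. There is $\delta>0$ (depending only on $\theta$ and $\varrho$) such that for every measurable $g$ with $\|g\|_\nu<\infty$ one has $g\in L^2(\mathbb{R}^3)$, $\|(I-P)g\|_\nu<\infty$, the function $L[g]\,g$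 is integrable, and $$\langle L[g],g\rangle\ \ge\ \delta\,\|(I-P)g\|_\nu^2 .$$ -/

import Mathlib

open MeasureTheory

noncomputable section

namespace QBoltzmann

/-- The velocity space `ℝ³` with its Euclidean norm. -/
abbrev V : Type := EuclideanSpace ℝ (Fin 3)

/-- The unit sphere `𝕊²`. -/
abbrev S2 : Type := Metric.sphere (0 : V) 1

/-- The surface measure `dω` on `𝕊²` (total mass `4π`). -/
abbrev surf : Measure S2 := (volume : Measure V).toSphere

/-- Hard-sphere kernel `q(ω, |v - u|) = |ω · (v - u)|`. -/
def q (ω : S2) (u v : V) : ℝ := |inner ℝ (ω : V) (v - u)|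

/-- `u' = u + ω (ω · (v - u))`. -/
def uPost (u v : V) (ω : S2) : V := u + (inner ℝ (ω : V) (v - u)) • (ω : V)

/-- `v' = v - ω (ω · (v - u))`. -/
def vPost (u v : V) (ω : S2) : V := v - (inner ℝ (ω : V) (v - u)) • (ω : V)

/-- Integrand, at `(u, ω)`, of (twice) the symmetrized quadratic collision operator. -/
def quadIntegrand (F G : V → ℝ) (v : V) (p : V × S2) : ℝ :=
  q p.2 p.1 v *
    (F (uPost p.1 v p.2) * G (vPost p.1 v p.2) + G (uPost p.1 v p.2) * F (vPost p.1 v p.2)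
      - F p.1 * G v - G p.1 * F v)

/-- The symmetrized quadratic collision operator `𝒬[F, G]`. -/
def quadQ (F G : V → ℝ) (v : V) : ℝ :=
  1 / 2 * ∫ u : V, ∫ ω : S2, quadIntegrand F G v (u, ω) ∂surf

/-- Integrand, at `(u, ω)`, of (twice) the symmetrized cubic collision operator. -/
def cubIntegrand (F G H : V → ℝ) (v : V) (p : V × S2) : ℝ :=
  q p.2 p.1 v *
    (F (uPost p.1 v p.2) * G (vPost p.1 v p.2) * (H p.1 + H v)
      + G (uPost p.1 v p.2) * F (vPost p.1 v p.2) * (H p.1 + H v)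
      - F p.1 * G v * (H (uPost p.1 v p.2) + H (vPost p.1 v p.2))
      - G p.1 * F v * (H (uPost p.1 v p.2) + H (vPost p.1 v p.2)))

/-- The symmetrized cubic collision operator `𝒬[F, G; H]`. -/
def cubQ (F G H : V → ℝ) (v : V) : ℝ :=
  1 / 2 * ∫ u : V, ∫ ω : S2, cubIntegrand F G H v (u, ω) ∂surf

/-- The quantum Maxwellian `μ(v) = 1 / (ρ exp(|v|²) - θ)`. -/
def mu (θ ρ : ℝ) (v : V) : ℝ := 1 / (ρ * Real.exp (‖v‖ ^ 2) - θ)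

/-- The weight `M = μ (1 + θ μ)`. -/
def M (θ ρ : ℝ) (v : V) : ℝ := mu θ ρ v * (1 + θ * mu θ ρ v)

/-- `M^{1/2} f`. -/
def sqrtMul (θ ρ : ℝ) (f : V → ℝ) (v : V) : ℝ := Real.sqrt (M θ ρ v) * f v

/-- The linearized operator
`L[f] = - 2 M^{-1/2} 𝒬[μ, M^{1/2} f] - 2 θ M^{-1/2} 𝒬[μ, M^{1/2} f; μ]
  - θ M^{-1/2} 𝒬[μ, μ; M^{1/2} f]`. -/
def L (θ ρ : ℝ) (f : V → ℝ) (v : V) : ℝ :=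
  - 2 * (Real.sqrt (M θ ρ v))⁻¹ * quadQ (mu θ ρ) (sqrtMul θ ρ f) v
    - 2 * θ * (Real.sqrt (M θ ρ v))⁻¹ * cubQ (mu θ ρ) (sqrtMul θ ρ f) (mu θ ρ) v
    - θ * (Real.sqrt (M θ ρ v))⁻¹ * cubQ (mu θ ρ) (mu θ ρ) (sqrtMul θ ρ f) v

/-- The three collision integrals that define `L[f](v)` converge absolutely. -/
def LConverges (θ ρ : ℝ) (f : V → ℝ) (v : V) : Prop :=
  Integrable (quadIntegrand (mu θ ρ) (sqrtMul θ ρ f) v) (volume.prod surf) ∧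
  Integrable (cubIntegrand (mu θ ρ) (sqrtMul θ ρ f) (mu θ ρ) v) (volume.prod surf) ∧
  Integrable (cubIntegrand (mu θ ρ) (mu θ ρ) (sqrtMul θ ρ f) v) (volume.prod surf)

/-- The `L²(ℝ³)` pairing of two functions. -/
def pairing (f g : V → ℝ) : ℝ := ∫ v : V, f v * g v

/-- The collision frequency `ν(v)`. -/
def nu (θ ρ : ℝ) (v : V) : ℝ :=
  ∫ u : V, ∫ ω : S2,
    q ω u v * mu θ ρ u * mu θ ρ v * mu θ ρ (uPost u v ω) * mu θ ρ (vPost u v ω)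
      * ρ ^ 2 * Real.exp (‖u‖ ^ 2 + ‖v‖ ^ 2) * (M θ ρ v)⁻¹ ∂surf

/-- `f` is measurable and `∫ ν |f|² < ∞`. -/
def MemNu (θ ρ : ℝ) (f : V → ℝ) : Prop :=
  AEStronglyMeasurable f volume ∧ Integrable (fun v => nu θ ρ v * f v ^ 2) volume

/-- `‖f‖_ν = (∫ ν |f|²)^{1/2}`. -/
def nuNorm (θ ρ : ℝ) (f : V → ℝ) : ℝ := Real.sqrt (∫ v : V, nu θ ρ v * f v ^ 2)

/-- The function `M^{1/2} (a + b · v + c |v|²)`. -/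
def invariantFun (θ ρ a : ℝ) (b : V) (c : ℝ) (v : V) : ℝ :=
  Real.sqrt (M θ ρ v) * (a + inner ℝ b v + c * ‖v‖ ^ 2)

/-- The span of `M^{1/2}`, `v_i M^{1/2}` (`i = 1, 2, 3`), `|v|² M^{1/2}` in `L²(ℝ³)`:
all classes of the functions `M^{1/2} (a + b · v + c |v|²)`. -/
def nullSpace (θ ρ : ℝ) : Submodule ℝ (Lp ℝ 2 (volume : Measure V)) where
  carrier := {p | ∃ (a : ℝ) (b : V) (c : ℝ), p =ᵐ[volume] invariantFun θ ρ a b c}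
  zero_mem' := by
    refine ⟨0, 0, 0, ?_⟩
    filter_upwards [Lp.coeFn_zero ℝ 2 (volume : Measure V)] with v hv
    rw [hv]
    simp [invariantFun]
  add_mem' := by
    rintro p p' ⟨a, b, c, h⟩ ⟨a', b', c', h'⟩
    refine ⟨a + a', b + b', c + c', ?_⟩
    filter_upwards [Lp.coeFn_add p p', h, h'] with v hv h1 h2
    simp only [hv, Pi.add_apply, h1, h2, invariantFun, inner_add_left]
    ring
  smul_mem' := by
    rintro r p ⟨a, b, c, h⟩
    refine ⟨r * a, r • b, r * c, ?_⟩
    filter_upwards [Lp.coeFn_smul r p, h] with v hv h1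
    simp only [hv, Pi.smul_apply, h1, invariantFun, real_inner_smul_left, smul_eq_mul]
    ring

lemma measurable_invariantFun (θ ρ a : ℝ) (b : V) (c : ℝ) :
    Measurable (invariantFun θ ρ a b c) := by
  unfold invariantFun M mu
  fun_prop

/-- Coefficients `(a, b, c)` to the class of `M^{1/2} (a + b · v + c |v|²)`. -/
def invariantClass (θ ρ : ℝ) : (ℝ × V × ℝ) →ₗ[ℝ] (V →ₘ[volume] ℝ) where
  toFun x := AEEqFun.mk (invariantFun θ ρ x.1 x.2.1 x.2.2)
    (measurable_invariantFun θ ρ x.1 x.2.1 x.2.2).aestronglyMeasurable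
  map_add' x y := by
    rw [AEEqFun.mk_add_mk, AEEqFun.mk_eq_mk]
    refine Filter.Eventually.of_forall fun v => ?_
    simp only [Pi.add_apply, invariantFun, Prod.fst_add, Prod.snd_add, inner_add_left]
    ring
  map_smul' r x := by
    rw [RingHom.id_apply]
    refine Eq.trans (AEEqFun.mk_eq_mk.2 ?_) (AEEqFun.smul_mk r (invariantFun θ ρ x.1 x.2.1 x.2.2)
      (measurable_invariantFun θ ρ x.1 x.2.1 x.2.2).aestronglyMeasurable)
    refine Filter.Eventually.of_forall fun v => ?_
    simp only [Function.comp_apply, invariantFun, Prod.smul_fst, Prod.smul_snd, real_inner_smul_left,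
      smul_eq_mul]
    ring

instance finiteDimensional_nullSpace (θ ρ : ℝ) : FiniteDimensional ℝ (nullSpace θ ρ) := by
  let ψ : nullSpace θ ρ →ₗ[ℝ] LinearMap.range (invariantClass θ ρ) :=
    { toFun := fun p => ⟨p.1.1, by
        obtain ⟨a, b, c, h⟩ := p.2
        refine ⟨(a, b, c), ?_⟩
        refine AEEqFun.ext ?_
        exact (AEEqFun.coeFn_mk _ _).trans h.symm⟩
      map_add' := fun _ _ => rfl
      map_smul' := fun _ _ => rfl }
  refine FiniteDimensional.of_injective ψ fun p p' h => ?_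
  have h1 : (ψ p).1 = (ψ p').1 := congrArg Subtype.val h
  exact Subtype.ext (Subtype.ext h1)

open Classical in
/-- The orthogonal projection `P` of `L²(ℝ³)` onto `nullSpace`, read as a map on functions
(with the value `0` off `L²`). -/
def P (θ ρ : ℝ) (g : V → ℝ) : V → ℝ :=
  if hg : MemLp g 2 (volume : Measure V) then
    ((nullSpace θ ρ).starProjection (hg.toLp g) : Lp ℝ 2 (volume : Measure V))
  else 0

end QBoltzmann

end

noncomputable section

namespace QBoltzmann

/-! ### Geometry of collisions -/

/-! Write h = M^{-1/2} f. The identity 1 + θμ = ρ e^{|v|²} μ and conservation of energy (detailed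
balance) collapse the three collision integrals into one (`integrand_eq`): M^{1/2} L f is minus the
integral of `kern` times the defect h(v') + h(u') - h(v) - h(u). Since `kern` is invariant under the
exchange of pre- and post-collisional velocities and under the exchange of the two particles, ⟨L g,
g⟩ is a quarter of the integral of `kern` times the squared defect (`pairing_L_self`). The collision
invariants 1, v, |v|² have zero defect; the work lies in a quantitative converse.

`kern` is bounded below and above by multiples of q e^{-|u|²-|v|²}, so θ disappears from the
estimate and a spectral gap for classical hard spheres in L²(γ), γ Gaussian, suffices. The factor q
is dropped at first. The conditional expectation of f(v') + f(u') given v is then a bounded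
symmetric operator `gainOp`. On generating functions F(ξ) = ⟨f, e^{2ξ·v-|ξ|²}⟩ it acts by averaging
F(ξ_⊥) + F(ξ_∥) over ω, where ξ_∥ and ξ_⊥ are the components along and across ω (`gen_gainOp`). If f
is orthogonal to the invariants, F starts with a traceless quadratic form, which each step
multiplies by 3/5, while a remainder O(|ξ|³) shrinks by 13/15. So the matrix elements of the
iterates against exponentials decay like (13/15)^k. Exponentials are total, and log-convexity of k ↦
‖Gᵏf‖ turns this decay into ‖Gf‖ ≤ (13/15)‖f‖ (`norm_gainOp_le`), hence a gap 8/15 for the squared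
defect (`defect_sq_gap`). Grazing collisions q < ε carry only O(ε)‖f‖² of it, and elsewhere q ≥ ε,
which gives the hard-sphere gap (`exists_hardSphere_gap`).

To pass from L² to the ν-norm, split the form as ‖·‖_ν² minus a part bounded on L² by a Schur test
(`gainLoss_bound`, `exists_coercive`). The same boundedness shows that an L² solution of L f = 0 has
finite ν-norm, so coercivity applies to it and puts it in the null space. Finally the invariants
span a finite-dimensional space, so P is bounded from L² to the ν-norm and the approximating
invariant may be replaced by P g (`exists_coercive_sub_P`). -/

lemma norm_sphere (ω : S2) : ‖(ω : V)‖ = 1 := by simp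

lemma inner_sphere_self (ω : S2) : inner ℝ (ω : V) (ω : V) = 1 := by
  rw [real_inner_self_eq_norm_sq, norm_sphere, one_pow]

lemma inner_post_sub (u v : V) (ω : S2) :
    inner ℝ (ω : V) (vPost u v ω - uPost u v ω) = - inner ℝ (ω : V) (v - u) := by
  simp only [vPost, uPost, inner_sub_right, inner_add_right, inner_smul_right, inner_sphere_self]
  ring

lemma uPost_post (u v : V) (ω : S2) : uPost (uPost u v ω) (vPost u v ω) ω = u := by
  rw [uPost, inner_post_sub, uPost, neg_smul]; abel

lemma vPost_post (u v : V) (ω : S2) : vPost (uPost u v ω) (vPost u v ω) ω = v := by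
  rw [vPost, inner_post_sub, vPost, neg_smul]; abel

lemma uPost_swap (u v : V) (ω : S2) : uPost v u ω = vPost u v ω := by
  rw [uPost, vPost, ← neg_sub v u, inner_neg_right, neg_smul]; abel

lemma vPost_swap (u v : V) (ω : S2) : vPost v u ω = uPost u v ω := by
  rw [uPost, vPost, ← neg_sub v u, inner_neg_right, neg_smul]; abel

lemma q_swap (u v : V) (ω : S2) : q ω v u = q ω u v := by
  rw [q, q, ← neg_sub v u, inner_neg_right, abs_neg]

lemma q_post (u v : V) (ω : S2) : q ω (uPost u v ω) (vPost u v ω) = q ω u v := by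
  rw [q, inner_post_sub, abs_neg, q]

lemma post_add (u v : V) (ω : S2) : uPost u v ω + vPost u v ω = u + v := by
  simp only [uPost, vPost]; abel

lemma norm_sq_vPost (u v : V) (ω : S2) :
    ‖vPost u v ω‖ ^ 2 = ‖v‖ ^ 2 - inner ℝ (ω : V) v ^ 2 + inner ℝ (ω : V) u ^ 2 := by
  rw [vPost, norm_sub_sq_real, norm_smul, norm_sphere, inner_smul_right, inner_sub_right,
    real_inner_comm, mul_one, Real.norm_eq_abs, sq_abs]
  ring

lemma norm_sq_uPost (u v : V) (ω : S2) :
    ‖uPost u v ω‖ ^ 2 = ‖u‖ ^ 2 - inner ℝ (ω : V) u ^ 2 + inner ℝ (ω : V) v ^ 2 := by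
  rw [← vPost_swap, norm_sq_vPost]

lemma norm_sq_post (u v : V) (ω : S2) :
    ‖uPost u v ω‖ ^ 2 + ‖vPost u v ω‖ ^ 2 = ‖u‖ ^ 2 + ‖v‖ ^ 2 := by
  rw [norm_sq_uPost, norm_sq_vPost]; ring

lemma q_nonneg (ω : S2) (u v : V) : 0 ≤ q ω u v := abs_nonneg _

lemma abs_inner_sphere_le (ω : S2) (x : V) : |inner ℝ (ω : V) x| ≤ ‖x‖ := by
  simpa [norm_sphere] using abs_real_inner_le_norm (ω : V) x

lemma inner_sphere_sq_le (ω : S2) (x : V) : inner ℝ (ω : V) x ^ 2 ≤ ‖x‖ ^ 2 :=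
  sq_le_sq' (neg_le_of_abs_le (abs_inner_sphere_le ω x)) (le_of_abs_le (abs_inner_sphere_le ω x))

lemma q_le (ω : S2) (u v : V) : q ω u v ≤ ‖u‖ + ‖v‖ :=
  (abs_inner_sphere_le ω _).trans ((norm_sub_le v u).trans_eq (add_comm _ _))

/-! ### Phase space of collisions and its measure-preserving symmetries. -/

instance sFinite_volume_prod_surf : SFinite ((volume : Measure V).prod surf) :=
  Measure.prod.instSFinite

/-- The space of the variables `(v, (u, ω))`. -/
abbrev X : Type := V × (V × S2)

/-- The measure `dv du dω`. -/
abbrev volX : Measure X := (volume : Measure V).prod ((volume : Measure V).prod surf)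

/-- `(v, u, ω) ↦ (v', u', ω)`. -/
def collide (p : X) : X := (vPost p.2.1 p.1 p.2.2, (uPost p.2.1 p.1 p.2.2, p.2.2))

/-- `(v, u, ω) ↦ (u, v, ω)`. -/
def exch (p : X) : X := (p.2.1, (p.1, p.2.2))

lemma continuous_uPost : Continuous fun p : X => uPost p.2.1 p.1 p.2.2 := by
  unfold uPost; fun_prop

lemma continuous_vPost : Continuous fun p : X => vPost p.2.1 p.1 p.2.2 := by
  unfold vPost; fun_prop

lemma continuous_q : Continuous fun p : X => q p.2.2 p.2.1 p.1 := by
  unfold q; fun_prop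

lemma continuous_collide : Continuous collide :=
  continuous_vPost.prodMk (continuous_uPost.prodMk (by fun_prop))

lemma continuous_exch : Continuous exch := by
  unfold exch; fun_prop

lemma collide_collide (p : X) : collide (collide p) = p := by
  simp only [collide, uPost_post, vPost_post]

lemma exch_exch (p : X) : exch (exch p) = p := rfl

lemma collide_exch (p : X) : collide (exch p) = exch (collide p) := by
  simp only [collide, exch]
  rw [uPost_swap, vPost_swap]

/-- The collision with fixed direction `ω`, as a linear map of the pair `(v, u)`. -/
def collideLin (ω : S2) : (V × V) →ₗ[ℝ] (V × V) where
  toFun z := (vPost z.2 z.1 ω, uPost z.2 z.1 ω)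
  map_add' x y := by
    ext1 <;>
    · simp only [vPost, uPost, Prod.fst_add, Prod.snd_add, inner_sub_right, inner_add_right]
      module
  map_smul' r x := by
    ext1 <;>
    · simp only [vPost, uPost, Prod.smul_fst, Prod.smul_snd, inner_sub_right, inner_smul_right,
        RingHom.id_apply]
      module

/-- For fixed ω the collision is a linear involution, so its determinant squares to 1 and Lebesgue
measure is preserved. -/
lemma measurePreserving_collideLin (ω : S2) :
    MeasurePreserving (collideLin ω) ((volume : Measure V).prod (volume : Measure V))
      ((volume : Measure V).prod (volume : Measure V)) := by
  have hsq : collideLin ω ∘ₗ collideLin ω = LinearMap.id := by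
    ext1 <;> ext1 z <;> simp [collideLin, uPost_post, vPost_post]
  have hdet : LinearMap.det (collideLin ω) * LinearMap.det (collideLin ω) = 1 := by
    rw [← LinearMap.det_comp, hsq, LinearMap.det_id]
  have h0 : LinearMap.det (collideLin ω) ≠ 0 := fun h => by simp [h] at hdet
  have habs : |(LinearMap.det (collideLin ω))⁻¹| = 1 := by
    rcases mul_self_eq_one_iff.1 hdet with h | h <;> simp [h]
  refine ⟨(LinearMap.continuous_of_finiteDimensional _).measurable, ?_⟩
  rw [Measure.map_linearMap_addHaar_eq_smul_addHaar _ h0, habs, ENNReal.ofReal_one, one_smul]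

lemma measurePreserving_withDensity {α : Type*} [MeasurableSpace α] {κ : Measure α} {f : α → α}
    (hf : MeasurePreserving f κ κ) {d : α → ENNReal} (hd : Measurable d) (h : ∀ x, d (f x) = d x) :
    MeasurePreserving f (κ.withDensity d) (κ.withDensity d) := by
  refine ⟨hf.measurable, ?_⟩
  ext s hs
  rw [Measure.map_apply hf.measurable hs, withDensity_apply _ (hf.measurable hs),
    withDensity_apply _ hs, ← hf.setLIntegral_comp_preimage hs hd]
  simp only [h]

/-- Kept general in `κ` because it serves twice: for Lebesgue measure and for the Gaussian. -/
lemma measurePreserving_collide_of {κ : Measure V} [SFinite κ] {s : Measure S2} [SFinite s]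
    (h : ∀ ω, MeasurePreserving (collideLin ω) (κ.prod κ) (κ.prod κ)) :
    MeasurePreserving collide (κ.prod (κ.prod s)) (κ.prod (κ.prod s)) := by
  have h1 : MeasurePreserving (fun p : S2 × (V × V) => (p.1, collideLin p.1 p.2))
      (s.prod (κ.prod κ)) (s.prod (κ.prod κ)) := by
    refine MeasurePreserving.skew_product (MeasurePreserving.id s) ?_
      (Filter.Eventually.of_forall fun ω => (h ω).map_eq)
    change Measurable fun p : S2 × (V × V) => (vPost p.2.2 p.2.1 p.1, uPost p.2.2 p.2.1 p.1)
    unfold vPost uPost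
    fun_prop
  have e1 : MeasurePreserving (MeasurableEquiv.prodAssoc : (V × V) × S2 ≃ᵐ X)
      ((κ.prod κ).prod s) (κ.prod (κ.prod s)) := measurePreserving_prodAssoc κ κ s
  have e2 := Measure.measurePreserving_swap (μ := s) (ν := κ.prod κ)
  have e3 := Measure.measurePreserving_swap (μ := κ.prod κ) (ν := s)
  exact ((e1.comp e2).comp h1).comp (e3.comp (e1.symm _))

lemma measurePreserving_exch_of {κ : Measure V} [SFinite κ] {s : Measure S2} [SFinite s] :
    MeasurePreserving exch (κ.prod (κ.prod s)) (κ.prod (κ.prod s)) := by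
  have e1 : MeasurePreserving (MeasurableEquiv.prodAssoc : (V × V) × S2 ≃ᵐ X)
      ((κ.prod κ).prod s) (κ.prod (κ.prod s)) := measurePreserving_prodAssoc κ κ s
  have e2 := (Measure.measurePreserving_swap (μ := κ) (ν := κ)).prod (MeasurePreserving.id s)
  exact (e1.comp e2).comp (e1.symm _)

lemma measurePreserving_collide : MeasurePreserving collide volX volX :=
  measurePreserving_collide_of measurePreserving_collideLin

lemma measurePreserving_exch : MeasurePreserving exch volX volX := measurePreserving_exch_of

/-- A measurable involution is a measurable equivalence, so no measurability or integrability of `φ`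
is required. -/
lemma involutive_integral_comp {α : Type*} [MeasurableSpace α] {κ : Measure α} {T : α → α}
    (hT : MeasurePreserving T κ κ) (h2 : ∀ x, T (T x) = x) (φ : α → ℝ) :
    ∫ x, φ (T x) ∂κ = ∫ x, φ x ∂κ :=
  hT.integral_comp (MeasurableEquiv.measurableEmbedding
    ⟨⟨T, T, h2, h2⟩, hT.measurable, hT.measurable⟩) φ

lemma integral_collide (φ : X → ℝ) : ∫ p, φ (collide p) ∂volX = ∫ p, φ p ∂volX :=
  involutive_integral_comp measurePreserving_collide collide_collide φ

lemma integral_exch (φ : X → ℝ) : ∫ p, φ (exch p) ∂volX = ∫ p, φ p ∂volX :=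
  involutive_integral_comp measurePreserving_exch exch_exch φ

/-! ### Maxwellians -/

/-- The (unnormalized) classical Maxwellian. -/
def maxw (v : V) : ℝ := Real.exp (-‖v‖ ^ 2)

lemma maxw_pos (v : V) : 0 < maxw v := Real.exp_pos _

lemma maxw_le_one (v : V) : maxw v ≤ 1 := Real.exp_le_one_iff.2 (by simp)

lemma continuous_maxw : Continuous maxw := by unfold maxw; fun_prop

lemma maxw_post (u v : V) (ω : S2) :
    maxw (uPost u v ω) * maxw (vPost u v ω) = maxw u * maxw v := by
  simp only [maxw, ← Real.exp_add]
  congr 1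
  linarith [norm_sq_post u v ω]

section bounds

variable {θ ρ : ℝ}

/-- From θ ≤ 1 ≤ e^{|v|²}. This bound makes μ, and then M and the collision weight, comparable with
Gaussians, including θ = 1, where ρ > 1 keeps the denominator away from zero. -/
lemma den_ge (hθ : |θ| ≤ 1) (v : V) :
    (ρ - 1) * Real.exp (‖v‖ ^ 2) ≤ ρ * Real.exp (‖v‖ ^ 2) - θ := by
  have h1 : 1 ≤ Real.exp (‖v‖ ^ 2) := Real.one_le_exp (sq_nonneg _)
  linarith [le_of_abs_le hθ]

lemma den_pos (hθ : |θ| ≤ 1) (hρ : 1 < ρ) (v : V) : 0 < ρ * Real.exp (‖v‖ ^ 2) - θ :=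
  (mul_pos (sub_pos.2 hρ) (Real.exp_pos _)).trans_le (den_ge hθ v)

lemma mu_pos (hθ : |θ| ≤ 1) (hρ : 1 < ρ) (v : V) : 0 < mu θ ρ v :=
  one_div_pos.2 (den_pos hθ hρ v)

lemma mu_le (hθ : |θ| ≤ 1) (hρ : 1 < ρ) (v : V) : mu θ ρ v ≤ (ρ - 1)⁻¹ * maxw v := by
  have h := one_div_le_one_div_of_le (mul_pos (sub_pos.2 hρ) (Real.exp_pos _)) (den_ge hθ v)
  rwa [one_div ((ρ - 1) * _), mul_inv, ← Real.exp_neg] at h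

lemma mu_ge (hθ : |θ| ≤ 1) (hρ : 1 < ρ) (v : V) : (ρ + 1)⁻¹ * maxw v ≤ mu θ ρ v := by
  have h1 : 1 ≤ Real.exp (‖v‖ ^ 2) := Real.one_le_exp (sq_nonneg _)
  have h := one_div_le_one_div_of_le (den_pos hθ hρ v)
    (show ρ * Real.exp (‖v‖ ^ 2) - θ ≤ (ρ + 1) * Real.exp (‖v‖ ^ 2) by
      linarith [neg_le_of_abs_le hθ])
  rwa [one_div ((ρ + 1) * _), mul_inv, ← Real.exp_neg] at h

/-- The equilibrium identity: with energy conservation it yields detailed balance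
μ(u)μ(v)(1+θμ(u'))(1+θμ(v')) = μ(u')μ(v')(1+θμ(u))(1+θμ(v)). -/
lemma one_add_mul_mu (hθ : |θ| ≤ 1) (hρ : 1 < ρ) (v : V) :
    1 + θ * mu θ ρ v = ρ * Real.exp (‖v‖ ^ 2) * mu θ ρ v := by
  have := (den_pos hθ hρ v).ne'
  rw [mu]; field_simp; ring

lemma M_eq (hθ : |θ| ≤ 1) (hρ : 1 < ρ) (v : V) :
    M θ ρ v = ρ * Real.exp (‖v‖ ^ 2) * mu θ ρ v ^ 2 := by
  rw [M, one_add_mul_mu hθ hρ]; ring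

lemma M_pos (hθ : |θ| ≤ 1) (hρ : 1 < ρ) (v : V) : 0 < M θ ρ v := by
  rw [M_eq hθ hρ]
  have := mu_pos hθ hρ v
  have : 0 < ρ := by linarith
  positivity

lemma M_le (hθ : |θ| ≤ 1) (hρ : 1 < ρ) (v : V) : M θ ρ v ≤ ρ * (ρ - 1)⁻¹ ^ 2 * maxw v := by
  have h0 : 0 < ρ := by linarith
  have h1 : (mu θ ρ v) ^ 2 ≤ ((ρ - 1)⁻¹ * maxw v) ^ 2 :=
    pow_le_pow_left₀ (mu_pos hθ hρ v).le (mu_le hθ hρ v) 2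
  have h2 : Real.exp (‖v‖ ^ 2) * maxw v = 1 := by rw [maxw, ← Real.exp_add]; simp
  calc M θ ρ v = ρ * Real.exp (‖v‖ ^ 2) * mu θ ρ v ^ 2 := M_eq hθ hρ v
    _ ≤ ρ * Real.exp (‖v‖ ^ 2) * ((ρ - 1)⁻¹ * maxw v) ^ 2 := by gcongr
    _ = ρ * (ρ - 1)⁻¹ ^ 2 * maxw v * (Real.exp (‖v‖ ^ 2) * maxw v) := by ring
    _ = _ := by rw [h2, mul_one]

lemma M_ge (hθ : |θ| ≤ 1) (hρ : 1 < ρ) (v : V) : ρ * (ρ + 1)⁻¹ ^ 2 * maxw v ≤ M θ ρ v := by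
  have h0 : 0 < ρ := by linarith
  have h1 : ((ρ + 1)⁻¹ * maxw v) ^ 2 ≤ (mu θ ρ v) ^ 2 :=
    pow_le_pow_left₀ (by have := maxw_pos v; positivity) (mu_ge hθ hρ v) 2
  have h2 : Real.exp (‖v‖ ^ 2) * maxw v = 1 := by rw [maxw, ← Real.exp_add]; simp
  calc ρ * (ρ + 1)⁻¹ ^ 2 * maxw v
      = ρ * (ρ + 1)⁻¹ ^ 2 * maxw v * (Real.exp (‖v‖ ^ 2) * maxw v) := by rw [h2, mul_one]
    _ = ρ * Real.exp (‖v‖ ^ 2) * ((ρ + 1)⁻¹ * maxw v) ^ 2 := by ring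
    _ ≤ ρ * Real.exp (‖v‖ ^ 2) * mu θ ρ v ^ 2 := by gcongr
    _ = _ := (M_eq hθ hρ v).symm

lemma continuous_mu (hθ : |θ| ≤ 1) (hρ : 1 < ρ) : Continuous (mu θ ρ) := by
  unfold mu
  exact continuous_const.div (by fun_prop) fun v => (den_pos hθ hρ v).ne'

lemma continuous_M (hθ : |θ| ≤ 1) (hρ : 1 < ρ) : Continuous (M θ ρ) := by
  have := continuous_mu hθ hρ
  unfold M; fun_prop

/-- The symmetric collision weight `μ(u) μ(v) μ(u') μ(v') ρ² exp(|u|² + |v|²)`. -/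
def wgt (θ ρ : ℝ) (p : X) : ℝ :=
  mu θ ρ p.2.1 * mu θ ρ p.1 * mu θ ρ (uPost p.2.1 p.1 p.2.2) * mu θ ρ (vPost p.2.1 p.1 p.2.2)
    * ρ ^ 2 * Real.exp (‖p.2.1‖ ^ 2 + ‖p.1‖ ^ 2)

lemma wgt_pos (hθ : |θ| ≤ 1) (hρ : 1 < ρ) (p : X) : 0 < wgt θ ρ p := by
  have h := mu_pos hθ hρ
  have h0 : 0 < ρ := by linarith
  have h1 := h p.1
  have h2 := h p.2.1
  have h3 := h (uPost p.2.1 p.1 p.2.2)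
  have h4 := h (vPost p.2.1 p.1 p.2.2)
  unfold wgt; positivity

lemma continuous_wgt (hθ : |θ| ≤ 1) (hρ : 1 < ρ) : Continuous (wgt θ ρ) := by
  have h := continuous_mu hθ hρ
  have h1 := h.comp continuous_uPost
  have h2 := h.comp continuous_vPost
  simp only [Function.comp_def] at h1 h2
  unfold wgt
  fun_prop

lemma wgt_collide (p : X) : wgt θ ρ (collide p) = wgt θ ρ p := by
  simp only [wgt, collide, uPost_post, vPost_post, norm_sq_post]; ring

lemma wgt_exch (p : X) : wgt θ ρ (exch p) = wgt θ ρ p := by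
  simp only [wgt, exch]
  rw [uPost_swap p.2.1, vPost_swap p.2.1, add_comm (‖p.1‖ ^ 2)]; ring

/-- Energy conservation lets the exponential cancel the two post-collisional Gaussians; what remains
depends on u and v alone, which makes `wgt` comparable with a product Gaussian. -/
lemma exp_mul_maxw4 (u v : V) (ω : S2) :
    maxw u * maxw v * maxw (uPost u v ω) * maxw (vPost u v ω) * Real.exp (‖u‖ ^ 2 + ‖v‖ ^ 2)
      = maxw u * maxw v := by
  rw [mul_assoc (maxw u * maxw v), maxw_post, mul_assoc]
  have : maxw u * maxw v * Real.exp (‖u‖ ^ 2 + ‖v‖ ^ 2) = 1 := by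
    rw [maxw, maxw, ← Real.exp_add, ← Real.exp_add, ← Real.exp_zero]; congr 1; ring
  rw [this, mul_one]

lemma mul4_le_mul4 {a b c d a' b' c' d' : ℝ} (ha : 0 ≤ a) (hb : 0 ≤ b) (hc : 0 ≤ c) (hd : 0 ≤ d)
    (haa : a ≤ a') (hbb : b ≤ b') (hcc : c ≤ c') (hdd : d ≤ d') :
    a * b * c * d ≤ a' * b' * c' * d' := by
  have h1 := mul_le_mul haa hbb hb (ha.trans haa)
  have h2 := mul_le_mul h1 hcc hc (mul_nonneg (ha.trans haa) (hb.trans hbb))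
  exact mul_le_mul h2 hdd hd
    (mul_nonneg (mul_nonneg (ha.trans haa) (hb.trans hbb)) (hc.trans hcc))

lemma wgt_le (hθ : |θ| ≤ 1) (hρ : 1 < ρ) (p : X) :
    wgt θ ρ p ≤ (ρ - 1)⁻¹ ^ 4 * ρ ^ 2 * (maxw p.2.1 * maxw p.1) := by
  have h := mu_le hθ hρ
  have h0 := fun v => (mu_pos hθ hρ v).le
  have hm := fun v => (maxw_pos v).le
  have hc : 0 ≤ (ρ - 1)⁻¹ := inv_nonneg.2 (sub_pos.2 hρ).le
  rw [← exp_mul_maxw4 p.2.1 p.1 p.2.2]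
  calc wgt θ ρ p ≤ ((ρ - 1)⁻¹ * maxw p.2.1) * ((ρ - 1)⁻¹ * maxw p.1) *
        ((ρ - 1)⁻¹ * maxw (uPost p.2.1 p.1 p.2.2)) * ((ρ - 1)⁻¹ * maxw (vPost p.2.1 p.1 p.2.2))
        * ρ ^ 2 * Real.exp (‖p.2.1‖ ^ 2 + ‖p.1‖ ^ 2) := by
        unfold wgt
        have h4 := mul4_le_mul4 (h0 p.2.1) (h0 p.1) (h0 (uPost p.2.1 p.1 p.2.2))
          (h0 (vPost p.2.1 p.1 p.2.2)) (h _) (h _) (h _) (h _)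
        gcongr
    _ = _ := by ring

lemma wgt_ge (hθ : |θ| ≤ 1) (hρ : 1 < ρ) (p : X) :
    (ρ + 1)⁻¹ ^ 4 * ρ ^ 2 * (maxw p.2.1 * maxw p.1) ≤ wgt θ ρ p := by
  have h := mu_ge hθ hρ
  have h0 := fun v => (mu_pos hθ hρ v).le
  have hm := fun v => (maxw_pos v).le
  have hc : 0 ≤ (ρ + 1)⁻¹ := inv_nonneg.2 (by linarith)
  rw [← exp_mul_maxw4 p.2.1 p.1 p.2.2]
  calc _ = ((ρ + 1)⁻¹ * maxw p.2.1) * ((ρ + 1)⁻¹ * maxw p.1) *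
        ((ρ + 1)⁻¹ * maxw (uPost p.2.1 p.1 p.2.2)) * ((ρ + 1)⁻¹ * maxw (vPost p.2.1 p.1 p.2.2))
        * ρ ^ 2 * Real.exp (‖p.2.1‖ ^ 2 + ‖p.1‖ ^ 2) := by ring
    _ ≤ wgt θ ρ p := by
        unfold wgt
        have h4 := mul4_le_mul4 (mul_nonneg hc (hm p.2.1)) (mul_nonneg hc (hm p.1))
          (mul_nonneg hc (hm (uPost p.2.1 p.1 p.2.2))) (mul_nonneg hc (hm (vPost p.2.1 p.1 p.2.2)))
          (h _) (h _) (h _) (h _)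
        gcongr

/-! ### The linearized integrand as a single symmetric kernel. -/

/-- Adding and subtracting θ²abc turns the bracket into c(1+θa)(1+θb) - θab(1+θc), that is abc(xy -
θz) = abcz(w - θ); then d(w - θ) = 1 finishes. It computes the coefficient of h(v') in the
linearized operator, and by relabelling those of h(u'), h(v) and h(u). -/
lemma linearized_coeff {x y z w a b c d : ℝ} (ha : 1 + θ * a = x * a) (hb : 1 + θ * b = y * b)
    (hc : 1 + θ * c = z * c) (hd : 1 + θ * d = w * d) (h : x * y = z * w) :
    w * d ^ 2 * (c * (1 + θ * (a + b)) - θ * (a * b)) = a * b * c * d * (x * y) := by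
  linear_combination (w * d ^ 2) * (c * (1 + θ * b) * ha + c * x * a * hb - θ * a * b * hc
    + c * a * b * h) - w * d * a * b * c * z * hd - a * b * c * d * h

/-- The integrand of the linearized collision operator, in terms of `h = M^{-1/2} f`. -/
def linIntegrand (θ ρ : ℝ) (h : V → ℝ) (p : X) : ℝ :=
  q p.2.2 p.2.1 p.1 * wgt θ ρ p *
    (h (vPost p.2.1 p.1 p.2.2) + h (uPost p.2.1 p.1 p.2.2) - h p.1 - h p.2.1)

lemma sqrtMul_eq (hθ : |θ| ≤ 1) (hρ : 1 < ρ) (f : V → ℝ) (v : V) :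
    sqrtMul θ ρ f v = ρ * Real.exp (‖v‖ ^ 2) * mu θ ρ v ^ 2 * (f v / √(M θ ρ v)) := by
  have h := M_pos hθ hρ v
  rw [← M_eq hθ hρ, sqrtMul]
  have h2 := Real.sqrt_pos.2 h
  field_simp
  rw [Real.sq_sqrt h.le, mul_comm]

/-- M^{1/2} f equals M h, so each of the four values of h carries a coefficient of the form treated
in `linearized_coeff`, and all four reduce to the same symmetric weight. -/
lemma integrand_eq (hθ : |θ| ≤ 1) (hρ : 1 < ρ) (f : V → ℝ) (p : X) :
    quadIntegrand (mu θ ρ) (sqrtMul θ ρ f) p.1 p.2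
      + θ * cubIntegrand (mu θ ρ) (sqrtMul θ ρ f) (mu θ ρ) p.1 p.2
      + θ * (1 / 2 * cubIntegrand (mu θ ρ) (mu θ ρ) (sqrtMul θ ρ f) p.1 p.2)
    = linIntegrand θ ρ (fun v => f v / √(M θ ρ v)) p := by
  obtain ⟨v, u, ω⟩ := p
  have hx : (ρ * Real.exp (‖u‖ ^ 2)) * (ρ * Real.exp (‖v‖ ^ 2)) =
      (ρ * Real.exp (‖uPost u v ω‖ ^ 2)) * (ρ * Real.exp (‖vPost u v ω‖ ^ 2)) := by
    rw [mul_mul_mul_comm, mul_mul_mul_comm ρ _ ρ, ← Real.exp_add, ← Real.exp_add, norm_sq_post]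
  have ha := one_add_mul_mu hθ hρ u
  have hb := one_add_mul_mu hθ hρ v
  have hc := one_add_mul_mu hθ hρ (uPost u v ω)
  have hd := one_add_mul_mu hθ hρ (vPost u v ω)
  have hxx : ρ ^ 2 * Real.exp (‖u‖ ^ 2 + ‖v‖ ^ 2) =
      (ρ * Real.exp (‖u‖ ^ 2)) * (ρ * Real.exp (‖v‖ ^ 2)) := by rw [Real.exp_add]; ring
  simp only [quadIntegrand, cubIntegrand, linIntegrand, wgt, sqrtMul_eq hθ hρ]
  rw [mul_assoc _ (ρ ^ 2), hxx]
  generalize ρ * Real.exp (‖u‖ ^ 2) = x at *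
  generalize ρ * Real.exp (‖v‖ ^ 2) = y at *
  generalize ρ * Real.exp (‖uPost u v ω‖ ^ 2) = z at *
  generalize ρ * Real.exp (‖vPost u v ω‖ ^ 2) = w at *
  generalize mu θ ρ u = a at *
  generalize mu θ ρ v = b at *
  generalize mu θ ρ (uPost u v ω) = c at *
  generalize mu θ ρ (vPost u v ω) = d at *
  have e1 := linearized_coeff ha hb hc hd hx
  have e2 := linearized_coeff ha hb hd hc (hx.trans (mul_comm _ _))
  have e3 := linearized_coeff hc hd ha hb hx.symm
  have e4 := linearized_coeff hc hd hb ha (hx.symm.trans (mul_comm _ _))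
  -- The relabelled identities `e3`, `e4` produce z * w in place of x * y; the terms with `hx`
  -- convert it back.
  linear_combination (q ω u v) * ((f (vPost u v ω) / √(M θ ρ (vPost u v ω))) * e1
    + (f (uPost u v ω) / √(M θ ρ (uPost u v ω))) * e2 - (f v / √(M θ ρ v)) * (e3 - a * b * c * d * hx)
    - (f u / √(M θ ρ u)) * (e4 - a * b * c * d * hx))

end bounds

/-! ### Integrability of the collision integrands -/

lemma one_add_pow_le_exp (k : ℕ) {b : ℝ} (hb : 0 < b) :
    ∃ C, 0 ≤ C ∧ ∀ r : ℝ, 0 ≤ r → (1 + r) ^ k ≤ C * Real.exp (b * r ^ 2) := by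
  refine ⟨k.factorial * Real.exp (1 + 1 / (4 * b)), by positivity, fun r hr => ?_⟩
  have h1 := Real.pow_div_factorial_le_exp (1 + r) (by positivity) k
  rw [div_le_iff₀ (by positivity)] at h1
  -- Completing the square: b (r - 1/(2b))² ≥ 0.
  have h2 : 1 + r ≤ (1 + 1 / (4 * b)) + b * r ^ 2 := by
    have : 0 ≤ b * (r - 1 / (2 * b)) ^ 2 := by positivity
    have e : b * (r - 1 / (2 * b)) ^ 2 = b * r ^ 2 - r + 1 / (4 * b) := by field_simp; ring
    linarith
  calc (1 + r) ^ k ≤ Real.exp (1 + r) * k.factorial := h1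
    _ ≤ Real.exp ((1 + 1 / (4 * b)) + b * r ^ 2) * k.factorial := by gcongr
    _ = _ := by rw [Real.exp_add]; ring

lemma integrable_gauss {b : ℝ} (hb : 0 < b) :
    Integrable (fun v : V => Real.exp (-b * ‖v‖ ^ 2)) := by
  have h := (GaussianFourier.integrable_cexp_neg_mul_sq_norm_add (V := V) (b := (b : ℂ))
    (by simpa using hb) 0 0).norm
  refine h.congr (Filter.Eventually.of_forall fun v => ?_)
  simp only [Complex.norm_exp]
  congr 1
  simp [← Complex.ofReal_pow, ← Complex.ofReal_mul]

lemma integrable_pow_mul_gauss (k : ℕ) {b : ℝ} (hb : 0 < b) :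
    Integrable (fun v : V => (1 + ‖v‖) ^ k * Real.exp (-b * ‖v‖ ^ 2)) := by
  obtain ⟨C, -, hC⟩ := one_add_pow_le_exp k (half_pos hb)
  refine ((integrable_gauss (half_pos hb)).const_mul C).mono'
    (by fun_prop) (Filter.Eventually.of_forall fun v => ?_)
  rw [Real.norm_of_nonneg (by positivity)]
  calc (1 + ‖v‖) ^ k * Real.exp (-b * ‖v‖ ^ 2)
      ≤ (C * Real.exp (b / 2 * ‖v‖ ^ 2)) * Real.exp (-b * ‖v‖ ^ 2) := by
        gcongr; exact hC _ (norm_nonneg _)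
    _ = C * Real.exp (-(b / 2) * ‖v‖ ^ 2) := by
        rw [mul_assoc, ← Real.exp_add]; congr 2; ring

lemma integrable_pow_mul_maxw (k : ℕ) : Integrable (fun v : V => (1 + ‖v‖) ^ k * maxw v) := by
  simpa [maxw] using integrable_pow_mul_gauss k one_pos

lemma sqrt_maxw (v : V) : √(maxw v) = Real.exp (-(1 / 2) * ‖v‖ ^ 2) := by
  rw [maxw, Real.sqrt_eq_rpow, ← Real.exp_mul]; congr 1; ring

lemma memLp_pow_mul_sqrt_maxw (k : ℕ) :
    MemLp (fun v : V => (1 + ‖v‖) ^ k * √(maxw v)) 2 volume := by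
  have hc := continuous_maxw
  rw [memLp_two_iff_integrable_sq (by fun_prop)]
  refine (integrable_pow_mul_maxw (2 * k)).congr (Filter.Eventually.of_forall fun v => ?_)
  simp only [mul_pow, Real.sq_sqrt (maxw_pos v).le]
  ring

/-- The kernel q is at most (1+|u|)(1+|v|), so one moment of each factor is enough. -/
lemma integrable_flux {w F : V → ℝ} (hw : Integrable (fun v => (1 + ‖v‖) * w v))
    (hF : Integrable (fun v => (1 + ‖v‖) * F v)) :
    Integrable (fun p : X => q p.2.2 p.2.1 p.1 * (w p.2.1 * F p.1)) volX := by
  have hG := hF.mul_prod (hw.comp_fst surf)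
  have hq := continuous_q
  have hpos : ∀ p : X, 0 < (1 + ‖p.1‖) * (1 + ‖p.2.1‖) := fun p => by positivity
  have := hG.bdd_mul (c := 1)
    (f := fun p : X => q p.2.2 p.2.1 p.1 / ((1 + ‖p.1‖) * (1 + ‖p.2.1‖)))
    (hq.div (by fun_prop) fun p => (hpos p).ne').aestronglyMeasurable
    (Filter.Eventually.of_forall fun p => by
      rw [Real.norm_of_nonneg (div_nonneg (q_nonneg _ _ _) (hpos p).le), div_le_one (hpos p)]
      nlinarith [q_le p.2.2 p.2.1 p.1, norm_nonneg p.1, norm_nonneg p.2.1])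
  refine this.congr (Filter.Eventually.of_forall fun p => ?_)
  have := hpos p
  have h1 : 0 < 1 + ‖p.1‖ := by positivity
  have h2 : 0 < 1 + ‖p.2.1‖ := by positivity
  field_simp

lemma integrable_comp_collide {φ : X → ℝ} (h : Integrable φ volX) :
    Integrable (fun p => φ (collide p)) volX :=
  measurePreserving_collide.integrable_comp_of_integrable h

lemma integrable_comp_exch {φ : X → ℝ} (h : Integrable φ volX) :
    Integrable (fun p => φ (exch p)) volX :=
  measurePreserving_exch.integrable_comp_of_integrable h

section

variable {θ ρ : ℝ}

lemma integrable_one_add_mul_mu (hθ : |θ| ≤ 1) (hρ : 1 < ρ) :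
    Integrable (fun v => (1 + ‖v‖) * mu θ ρ v) := by
  have hc := continuous_mu hθ hρ
  refine ((integrable_pow_mul_maxw 1).const_mul (ρ - 1)⁻¹).mono' (by fun_prop)
    (Filter.Eventually.of_forall fun v => ?_)
  have := mu_pos hθ hρ v
  rw [Real.norm_of_nonneg (by positivity)]
  calc (1 + ‖v‖) * mu θ ρ v ≤ (1 + ‖v‖) * ((ρ - 1)⁻¹ * maxw v) := by
        gcongr; exact mu_le hθ hρ v
    _ = _ := by ring

lemma mu_le_const (hθ : |θ| ≤ 1) (hρ : 1 < ρ) (v : V) : mu θ ρ v ≤ (ρ - 1)⁻¹ :=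
  (mu_le hθ hρ v).trans (mul_le_of_le_one_right (inv_nonneg.2 (sub_pos.2 hρ).le) (maxw_le_one v))

lemma memLp_one_add_mul_sqrt_M (hθ : |θ| ≤ 1) (hρ : 1 < ρ) (k : ℕ) :
    MemLp (fun v => (1 + ‖v‖) ^ k * √(M θ ρ v)) 2 volume := by
  have hc := continuous_M hθ hρ
  have h0 : 0 ≤ ρ * (ρ - 1)⁻¹ ^ 2 := by have : 0 < ρ := by linarith
                                        positivity
  refine ((memLp_pow_mul_sqrt_maxw k).const_mul (√(ρ * (ρ - 1)⁻¹ ^ 2))).of_le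
    (by fun_prop) (Filter.Eventually.of_forall fun v => ?_)
  rw [Real.norm_of_nonneg (by positivity), Real.norm_of_nonneg (by positivity)]
  calc (1 + ‖v‖) ^ k * √(M θ ρ v) ≤ (1 + ‖v‖) ^ k * √(ρ * (ρ - 1)⁻¹ ^ 2 * maxw v) := by
        gcongr; exact M_le hθ hρ v
    _ = _ := by rw [Real.sqrt_mul h0]; ring

lemma integrable_one_add_mul_sqrtMul (hθ : |θ| ≤ 1) (hρ : 1 < ρ) {f : V → ℝ}
    (hf : MemLp f 2 volume) : Integrable (fun v => (1 + ‖v‖) * sqrtMul θ ρ f v) := by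
  refine ((memLp_one_add_mul_sqrt_M hθ hρ 1).integrable_mul hf).congr
    (Filter.Eventually.of_forall fun v => ?_)
  simp [sqrtMul, mul_assoc]

/-- Every term is a bounded multiple of q μ(u) F(v), F = M^{1/2} f, or of its image under a
collision symmetry. -/
lemma integrable_collision_integrands (hθ : |θ| ≤ 1) (hρ : 1 < ρ) {f : V → ℝ}
    (hf : MemLp f 2 volume) :
    Integrable (fun p : X => quadIntegrand (mu θ ρ) (sqrtMul θ ρ f) p.1 p.2) volX ∧
    Integrable (fun p : X => cubIntegrand (mu θ ρ) (sqrtMul θ ρ f) (mu θ ρ) p.1 p.2) volX ∧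
    Integrable (fun p : X => cubIntegrand (mu θ ρ) (mu θ ρ) (sqrtMul θ ρ f) p.1 p.2) volX := by
  have hc := continuous_mu hθ hρ
  have hcu := hc.comp continuous_uPost
  have hcv := hc.comp continuous_vPost
  simp only [Function.comp_def] at hcu hcv
  have hpos := mu_pos hθ hρ
  have hle := mu_le_const hθ hρ
  set F := sqrtMul θ ρ f with hF
  set m := mu θ ρ with hm
  set c := (ρ - 1)⁻¹ with hcdef
  have hc0 : 0 ≤ c := (hpos 0).le.trans (hle 0)
  have b1 := integrable_flux (integrable_one_add_mul_mu hθ hρ)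
    (integrable_one_add_mul_sqrtMul hθ hρ hf)
  rw [← hF, ← hm] at b1
  have b2 := integrable_comp_exch b1
  have b3 := integrable_comp_collide b1
  have b4 := integrable_comp_collide b2
  have hb2 : ∀ {a b : ℝ}, 0 < a → a ≤ c → 0 < b → b ≤ c → ‖a + b‖ ≤ 2 * c := by
    intro a b ha hac hb hbc
    rw [Real.norm_of_nonneg (by positivity)]; linarith
  have g1 : Continuous fun p : X => m p.2.1 + m p.1 := by fun_prop
  have g2 : Continuous fun p : X => m (uPost p.2.1 p.1 p.2.2) + m (vPost p.2.1 p.1 p.2.2) :=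
    hcu.add hcv
  have g1b : ∀ p : X, ‖m p.2.1 + m p.1‖ ≤ 2 * c := fun p => hb2 (hpos _) (hle _) (hpos _) (hle _)
  have g2b : ∀ p : X, ‖m (uPost p.2.1 p.1 p.2.2) + m (vPost p.2.1 p.1 p.2.2)‖ ≤ 2 * c :=
    fun p => hb2 (hpos _) (hle _) (hpos _) (hle _)
  have kb : ∀ p : X, m (uPost p.2.1 p.1 p.2.2) * m (vPost p.2.1 p.1 p.2.2) ≤
      c ^ 2 * (maxw p.2.1 * maxw p.1) := by
    intro p
    calc _ ≤ (c * maxw (uPost p.2.1 p.1 p.2.2)) * (c * maxw (vPost p.2.1 p.1 p.2.2)) := by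
          exact mul_le_mul (mu_le hθ hρ _) (mu_le hθ hρ _) (hpos _).le
            (mul_nonneg hc0 (maxw_pos _).le)
      _ = c ^ 2 * (maxw (uPost p.2.1 p.1 p.2.2) * maxw (vPost p.2.1 p.1 p.2.2)) := by ring
      _ = _ := by rw [maxw_post]
  have k1 : Continuous fun p : X =>
      m (uPost p.2.1 p.1 p.2.2) * m (vPost p.2.1 p.1 p.2.2) / m p.2.1 :=
    (hcu.mul hcv).div (by fun_prop) fun p => (hpos _).ne'
  -- The loss term μ(u')μ(v')F(v) of the last operator has no factor μ(u). One is recovered from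
  -- energy conservation: μ(u')μ(v') is dominated by a multiple of the product Gaussian, hence by a
  -- multiple of μ(u).
  have k1b : ∀ p : X, ‖m (uPost p.2.1 p.1 p.2.2) * m (vPost p.2.1 p.1 p.2.2) / m p.2.1‖
      ≤ c ^ 2 * (ρ + 1) := by
    intro p
    have h1 := hpos (uPost p.2.1 p.1 p.2.2)
    have h2 := hpos (vPost p.2.1 p.1 p.2.2)
    have h3 := hpos p.2.1
    have h4 := mu_ge hθ hρ p.2.1
    rw [inv_mul_le_iff₀ (by linarith)] at h4
    rw [Real.norm_of_nonneg (by positivity), div_le_iff₀ h3]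
    calc _ ≤ c ^ 2 * (maxw p.2.1 * maxw p.1) := kb p
      _ ≤ c ^ 2 * (((ρ + 1) * m p.2.1) * 1) := by
          gcongr
          · exact (maxw_pos _).le
          · exact maxw_le_one _
      _ = _ := by ring
  have d1 := b1.bdd_mul k1.aestronglyMeasurable (Filter.Eventually.of_forall k1b)
  have d2 := integrable_comp_exch d1
  have d3 := integrable_comp_collide d1
  have d4 := integrable_comp_collide d2
  refine ⟨?_, ?_, ?_⟩
  · refine (((b3.add b4).sub b1).sub b2).congr (Filter.Eventually.of_forall fun p => ?_)
    simp only [quadIntegrand, Pi.add_apply, Pi.sub_apply, collide, exch, q_post]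
    rw [q_swap (uPost p.2.1 p.1 p.2.2), q_post, q_swap p.2.1 p.1]
    ring
  · have e1 := (b3.add b4).bdd_mul g1.aestronglyMeasurable (Filter.Eventually.of_forall g1b)
    have e2 := (b1.add b2).bdd_mul g2.aestronglyMeasurable (Filter.Eventually.of_forall g2b)
    refine (e1.sub e2).congr (Filter.Eventually.of_forall fun p => ?_)
    simp only [cubIntegrand, Pi.add_apply, Pi.sub_apply, collide, exch, q_post]
    rw [q_swap (uPost p.2.1 p.1 p.2.2), q_post, q_swap p.2.1 p.1]
    ring
  · refine (((d1.add d2).sub (d3.add d4)).const_mul 2).congr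
      (Filter.Eventually.of_forall fun p => ?_)
    have h1 := (hpos p.1).ne'
    have h2 := (hpos p.2.1).ne'
    have h3 := (hpos (uPost p.2.1 p.1 p.2.2)).ne'
    have h4 := (hpos (vPost p.2.1 p.1 p.2.2)).ne'
    simp only [cubIntegrand, Pi.add_apply, Pi.sub_apply, collide, exch, q_post]
    rw [q_swap (uPost p.2.1 p.1 p.2.2), q_post, q_swap p.2.1 p.1, uPost_swap (uPost _ _ _),
      vPost_swap (uPost _ _ _), uPost_swap p.2.1, vPost_swap p.2.1, uPost_post, vPost_post]
    field_simp
    ring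

theorem ae_LConverges (hθ : |θ| ≤ 1) (hρ : 1 < ρ) {f : V → ℝ} (hf : MemLp f 2 volume) :
    ∀ᵐ v : V, LConverges θ ρ f v := by
  obtain ⟨h1, h2, h3⟩ := integrable_collision_integrands hθ hρ hf
  filter_upwards [h1.prod_right_ae, h2.prod_right_ae, h3.prod_right_ae] with v a b c
  exact ⟨a, b, c⟩

/-- `M^{-1/2} f`. -/
def red (θ ρ : ℝ) (f : V → ℝ) (v : V) : ℝ := f v / √(M θ ρ v)

lemma L_eq_of_converges (hθ : |θ| ≤ 1) (hρ : 1 < ρ) {f : V → ℝ} {v : V}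
    (hv : LConverges θ ρ f v) :
    L θ ρ f v = -(√(M θ ρ v))⁻¹ *
      ∫ y, linIntegrand θ ρ (red θ ρ f) (v, y) ∂((volume : Measure V).prod surf) := by
  obtain ⟨h1, h2, h3⟩ := hv
  have e : ∫ y, linIntegrand θ ρ (red θ ρ f) (v, y) ∂((volume : Measure V).prod surf) =
      ∫ y, quadIntegrand (mu θ ρ) (sqrtMul θ ρ f) v y ∂((volume : Measure V).prod surf)
      + θ * ∫ y, cubIntegrand (mu θ ρ) (sqrtMul θ ρ f) (mu θ ρ) v y
        ∂((volume : Measure V).prod surf)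
      + θ * (1 / 2 * ∫ y, cubIntegrand (mu θ ρ) (mu θ ρ) (sqrtMul θ ρ f) v y
        ∂((volume : Measure V).prod surf)) := by
    rw [← integral_const_mul, ← integral_const_mul, ← integral_const_mul,
      ← integral_add h1 (h2.const_mul θ)]
    refine Eq.trans ?_ (integral_add (h1.add (h2.const_mul θ)) ((h3.const_mul (1 / 2)).const_mul θ))
    exact integral_congr_ae (Filter.Eventually.of_forall fun y => (integrand_eq hθ hρ f (v, y)).symm)
  rw [e, integral_prod _ h1, integral_prod _ h2, integral_prod _ h3]
  simp only [L, quadQ, cubQ]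
  ring

end

/-! ### The collision frequency and the Dirichlet form -/

section

variable {θ ρ : ℝ}

/-- The symmetric collision kernel `q μ(u) μ(v) μ(u') μ(v') ρ² exp(|u|² + |v|²)`. -/
def kern (θ ρ : ℝ) (p : X) : ℝ := q p.2.2 p.2.1 p.1 * wgt θ ρ p

lemma kern_nonneg (hθ : |θ| ≤ 1) (hρ : 1 < ρ) (p : X) : 0 ≤ kern θ ρ p :=
  mul_nonneg (q_nonneg _ _ _) (wgt_pos hθ hρ p).le

lemma continuous_kern (hθ : |θ| ≤ 1) (hρ : 1 < ρ) : Continuous (kern θ ρ) :=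
  continuous_q.mul (continuous_wgt hθ hρ)

lemma kern_collide (p : X) : kern θ ρ (collide p) = kern θ ρ p := by
  rw [kern, wgt_collide]; simp only [collide, q_post, kern]

lemma kern_exch (p : X) : kern θ ρ (exch p) = kern θ ρ p := by
  rw [kern, wgt_exch]; simp only [exch, kern]; rw [q_swap]

lemma kern_le (hθ : |θ| ≤ 1) (hρ : 1 < ρ) (p : X) :
    kern θ ρ p ≤ (ρ - 1)⁻¹ ^ 4 * ρ ^ 2 * (q p.2.2 p.2.1 p.1 * (maxw p.2.1 * maxw p.1)) := by
  calc kern θ ρ p ≤ q p.2.2 p.2.1 p.1 * ((ρ - 1)⁻¹ ^ 4 * ρ ^ 2 * (maxw p.2.1 * maxw p.1)) :=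
        mul_le_mul_of_nonneg_left (wgt_le hθ hρ p) (q_nonneg _ _ _)
    _ = _ := by ring

lemma kern_ge (hθ : |θ| ≤ 1) (hρ : 1 < ρ) (p : X) :
    (ρ + 1)⁻¹ ^ 4 * ρ ^ 2 * (q p.2.2 p.2.1 p.1 * (maxw p.2.1 * maxw p.1)) ≤ kern θ ρ p := by
  calc _ = q p.2.2 p.2.1 p.1 * ((ρ + 1)⁻¹ ^ 4 * ρ ^ 2 * (maxw p.2.1 * maxw p.1)) := by ring
    _ ≤ _ := mul_le_mul_of_nonneg_left (wgt_ge hθ hρ p) (q_nonneg _ _ _)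

lemma q_le_mul (ω : S2) (u v : V) : q ω u v ≤ (1 + ‖v‖) * (1 + ‖u‖) := by
  nlinarith [q_le ω u v, norm_nonneg u, norm_nonneg v]

lemma integrable_one_add_mul_maxw_fst :
    Integrable (fun y : V × S2 => (1 + ‖y.1‖) * maxw y.1) ((volume : Measure V).prod surf) := by
  have := (integrable_pow_mul_maxw 1).comp_fst surf
  simpa using this

lemma integrable_q_mul_maxw (v : V) :
    Integrable (fun y : V × S2 => q y.2 y.1 v * maxw y.1) ((volume : Measure V).prod surf) := by
  have hm := continuous_maxw
  have hq : Continuous fun y : V × S2 => q y.2 y.1 v :=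
    continuous_q.comp (f := fun y : V × S2 => ((v, y) : X)) (by fun_prop)
  refine (integrable_one_add_mul_maxw_fst.const_mul (1 + ‖v‖)).mono' (by fun_prop)
    (Filter.Eventually.of_forall fun y => ?_)
  have := maxw_pos y.1
  rw [Real.norm_of_nonneg (mul_nonneg (q_nonneg _ _ _) this.le), ← mul_assoc]
  exact mul_le_mul_of_nonneg_right (q_le_mul _ _ _) this.le

lemma integrable_kern_section (hθ : |θ| ≤ 1) (hρ : 1 < ρ) (v : V) :
    Integrable (fun y : V × S2 => kern θ ρ (v, y)) ((volume : Measure V).prod surf) := by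
  refine ((integrable_q_mul_maxw v).const_mul ((ρ - 1)⁻¹ ^ 4 * ρ ^ 2 * maxw v)).mono'
    (((continuous_kern hθ hρ).comp (by fun_prop)).aestronglyMeasurable)
    (Filter.Eventually.of_forall fun y => ?_)
  rw [Real.norm_of_nonneg (kern_nonneg hθ hρ _)]
  exact (kern_le hθ hρ (v, y)).trans_eq (by simp only; ring)

lemma nu_eq (hθ : |θ| ≤ 1) (hρ : 1 < ρ) (v : V) :
    nu θ ρ v = (M θ ρ v)⁻¹ * ∫ y, kern θ ρ (v, y) ∂((volume : Measure V).prod surf) := by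
  rw [integral_prod _ (integrable_kern_section hθ hρ v), nu, ← integral_const_mul]
  refine integral_congr_ae (Filter.Eventually.of_forall fun u => ?_)
  simp only
  rw [← integral_const_mul]
  refine integral_congr_ae (Filter.Eventually.of_forall fun ω => ?_)
  simp only [kern, wgt]
  ring

lemma nu_nonneg (hθ : |θ| ≤ 1) (hρ : 1 < ρ) (v : V) : 0 ≤ nu θ ρ v := by
  rw [nu_eq hθ hρ]
  exact mul_nonneg (inv_nonneg.2 (M_pos hθ hρ v).le) (integral_nonneg fun y => kern_nonneg hθ hρ _)

lemma measurable_nu (hθ : |θ| ≤ 1) (hρ : 1 < ρ) : Measurable (nu θ ρ) := by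
  have h1 : StronglyMeasurable fun v =>
      ∫ y, kern θ ρ (v, y) ∂((volume : Measure V).prod surf) :=
    (continuous_kern hθ hρ).stronglyMeasurable.integral_prod_right'
  have h2 := (continuous_M hθ hρ).measurable.inv.mul h1.measurable
  rwa [show nu θ ρ = _ from funext (nu_eq hθ hρ)]

lemma nu_le (hθ : |θ| ≤ 1) (hρ : 1 < ρ) : ∃ C, 0 ≤ C ∧ ∀ v, nu θ ρ v ≤ C * (1 + ‖v‖) := by
  set a := (ρ - 1)⁻¹ ^ 4 * ρ ^ 2 with ha
  set b := ρ * (ρ + 1)⁻¹ ^ 2 with hb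
  set I := ∫ y : V × S2, (1 + ‖y.1‖) * maxw y.1 ∂((volume : Measure V).prod surf) with hI
  have hρ0 : 0 < ρ := by linarith
  have hb0 : 0 < b := by positivity
  have ha0 : 0 ≤ a := by positivity
  have hI0 : 0 ≤ I := integral_nonneg fun y => by have := maxw_pos y.1; positivity
  refine ⟨b⁻¹ * a * I, by positivity, fun v => ?_⟩
  have h1 : ∫ y, kern θ ρ (v, y) ∂((volume : Measure V).prod surf) ≤ a * maxw v * (1 + ‖v‖) * I := by
    rw [hI, ← integral_const_mul]
    refine integral_mono (integrable_kern_section hθ hρ v)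
      (integrable_one_add_mul_maxw_fst.const_mul _) fun y => (kern_le hθ hρ (v, y)).trans ?_
    have h1 := q_le_mul y.2 y.1 v
    have := maxw_pos y.1
    have := maxw_pos v
    calc _ ≤ a * ((1 + ‖v‖) * (1 + ‖y.1‖) * (maxw y.1 * maxw v)) := by gcongr
      _ = _ := by ring
  have h2 := M_ge hθ hρ v
  have hm := maxw_pos v
  rw [nu_eq hθ hρ]
  have h3 : 0 ≤ ∫ y, kern θ ρ (v, y) ∂((volume : Measure V).prod surf) :=
    integral_nonneg fun y => kern_nonneg hθ hρ _
  calc _ ≤ (b * maxw v)⁻¹ * (a * maxw v * (1 + ‖v‖) * I) := by gcongr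
    _ = _ := by field_simp

/-- Average over u and -u: |a - b| + |a + b| ≥ 2|b| with a = ω·v, b = ω·u. Hence the Gaussian
collision frequency is smallest at v = 0, which bounds ν away from zero. -/
lemma integral_q_mul_maxw_ge (v : V) :
    ∫ y : V × S2, q y.2 y.1 0 * maxw y.1 ∂((volume : Measure V).prod surf) ≤
      ∫ y : V × S2, q y.2 y.1 v * maxw y.1 ∂((volume : Measure V).prod surf) := by
  have hT : MeasurePreserving (fun y : V × S2 => (-y.1, y.2)) ((volume : Measure V).prod surf)
      ((volume : Measure V).prod surf) :=
    (Measure.measurePreserving_neg (volume : Measure V)).prod (MeasurePreserving.id surf)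
  have hi := integrable_q_mul_maxw v
  have hin : Integrable (fun y : V × S2 => q y.2 (-y.1) v * maxw (-y.1))
    ((volume : Measure V).prod surf) := hT.integrable_comp_of_integrable hi
  have e := involutive_integral_comp hT (fun y => by simp)
    (fun y : V × S2 => q y.2 y.1 v * maxw y.1)
  have h2 : 2 * ∫ y : V × S2, q y.2 y.1 0 * maxw y.1 ∂((volume : Measure V).prod surf) ≤
      ∫ y : V × S2, q y.2 y.1 v * maxw y.1 ∂((volume : Measure V).prod surf) +
      ∫ y : V × S2, q y.2 (-y.1) v * maxw (-y.1) ∂((volume : Measure V).prod surf) := by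
    rw [← integral_const_mul, ← integral_add hi hin]
    refine integral_mono ((integrable_q_mul_maxw 0).const_mul 2) (hi.add hin) fun y => ?_
    have hm : maxw (-y.1) = maxw y.1 := by simp [maxw]
    simp only [hm, ← add_mul, ← mul_assoc]
    refine mul_le_mul_of_nonneg_right ?_ (maxw_pos _).le
    simp only [q, inner_sub_right, inner_neg_right, inner_zero_right]
    set a := inner ℝ (y.2 : V) v
    set b := inner ℝ (y.2 : V) y.1
    have := abs_sub (a - b) (a - -b)
    rw [show a - b - (a - -b) = -(2 * b) by ring, abs_neg, abs_mul, abs_two] at this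
    simpa using this
  simp only at e
  linarith

lemma integral_q_mul_maxw_pos :
    0 < ∫ y : V × S2, q y.2 y.1 0 * maxw y.1 ∂((volume : Measure V).prod surf) := by
  rw [integral_pos_iff_support_of_nonneg
    (fun y => mul_nonneg (q_nonneg _ _ _) (maxw_pos _).le) (integrable_q_mul_maxw 0)]
  have hm := continuous_maxw
  have hq : Continuous fun y : V × S2 => q y.2 y.1 0 :=
    continuous_q.comp (f := fun y : V × S2 => ((0, y) : X)) (by fun_prop)
  have hc : Continuous fun y : V × S2 => q y.2 y.1 0 * maxw y.1 := by fun_prop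
  refine (hc.isOpen_support).measure_pos _ ?_
  obtain ⟨ω⟩ : Nonempty S2 := (NormedSpace.sphere_nonempty.2 zero_le_one).to_subtype
  refine ⟨((ω : V), ω), ?_⟩
  have := (maxw_pos (ω : V)).ne'
  simp [q, this]

lemma nu_ge (hθ : |θ| ≤ 1) (hρ : 1 < ρ) : ∃ c, 0 < c ∧ ∀ v, c ≤ nu θ ρ v := by
  set a := (ρ + 1)⁻¹ ^ 4 * ρ ^ 2 with ha
  set b := ρ * (ρ - 1)⁻¹ ^ 2 with hb
  set I := ∫ y : V × S2, q y.2 y.1 0 * maxw y.1 ∂((volume : Measure V).prod surf) with hI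
  have hρ0 : 0 < ρ := by linarith
  have hρ1 : 0 < ρ - 1 := by linarith
  have hb0 : 0 < b := by positivity
  have ha0 : 0 < a := by positivity
  have hI0 : 0 < I := integral_q_mul_maxw_pos
  refine ⟨b⁻¹ * a * I, by positivity, fun v => ?_⟩
  have hm := maxw_pos v
  have h1 : a * maxw v * I ≤ ∫ y, kern θ ρ (v, y) ∂((volume : Measure V).prod surf) := by
    refine (mul_le_mul_of_nonneg_left (integral_q_mul_maxw_ge v) (by positivity)).trans ?_
    rw [← integral_const_mul]
    refine integral_mono ((integrable_q_mul_maxw v).const_mul _) (integrable_kern_section hθ hρ v)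
      fun y => le_trans (le_of_eq ?_) (kern_ge hθ hρ (v, y))
    simp only; ring
  have h2 := M_le hθ hρ v
  have h3 := M_pos hθ hρ v
  rw [nu_eq hθ hρ]
  calc b⁻¹ * a * I = (b * maxw v)⁻¹ * (a * maxw v * I) := by field_simp
    _ ≤ _ := by gcongr

lemma MemNu.memLp (hθ : |θ| ≤ 1) (hρ : 1 < ρ) {g : V → ℝ} (hg : MemNu θ ρ g) :
    MemLp g 2 volume := by
  obtain ⟨c, hc, h⟩ := nu_ge hθ hρ
  rw [memLp_two_iff_integrable_sq hg.1]
  refine (hg.2.const_mul c⁻¹).mono' (hg.1.pow 2) (Filter.Eventually.of_forall fun v => ?_)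
  rw [Real.norm_of_nonneg (sq_nonneg _), ← mul_assoc]
  refine le_mul_of_one_le_left (sq_nonneg _) ?_
  rw [inv_mul_eq_div, one_le_div hc]
  exact h v

/-- `h(v') + h(u') - h(v) - h(u)`. -/
def defect (h : V → ℝ) (p : X) : ℝ :=
  h (vPost p.2.1 p.1 p.2.2) + h (uPost p.2.1 p.1 p.2.2) - h p.1 - h p.2.1

lemma linIntegrand_eq (h : V → ℝ) (p : X) :
    linIntegrand θ ρ h p = kern θ ρ p * defect h p := rfl

lemma defect_collide (h : V → ℝ) (p : X) : defect h (collide p) = -defect h p := by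
  simp only [defect, collide, uPost_post, vPost_post]; ring

lemma defect_exch (h : V → ℝ) (p : X) : defect h (exch p) = defect h p := by
  simp only [defect, exch]
  rw [uPost_swap p.2.1, vPost_swap p.2.1]; ring

lemma red_sq_mul_M (hθ : |θ| ≤ 1) (hρ : 1 < ρ) (g : V → ℝ) (v : V) :
    red θ ρ g v ^ 2 * M θ ρ v = g v ^ 2 := by
  have h := M_pos hθ hρ v
  rw [red, div_pow, Real.sq_sqrt h.le]
  field_simp

lemma aestronglyMeasurable_red (hθ : |θ| ≤ 1) (hρ : 1 < ρ) {g : V → ℝ}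
    (hg : AEStronglyMeasurable g volume) : AEStronglyMeasurable (red θ ρ g) volume :=
  (hg.aemeasurable.div (continuous_M hθ hρ).sqrt.aemeasurable).aestronglyMeasurable

lemma integral_kern_mul_red_sq (hθ : |θ| ≤ 1) (hρ : 1 < ρ) (g : V → ℝ) (v : V) :
    ∫ y, kern θ ρ (v, y) * red θ ρ g v ^ 2 ∂((volume : Measure V).prod surf) =
      nu θ ρ v * g v ^ 2 := by
  have h := (M_pos hθ hρ v).ne'
  rw [integral_mul_const, nu_eq hθ hρ, ← red_sq_mul_M hθ hρ g v]
  field_simp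

lemma integrable_kern_mul_sq (hθ : |θ| ≤ 1) (hρ : 1 < ρ) {g : V → ℝ} (hg : MemNu θ ρ g) :
    Integrable (fun p : X => kern θ ρ p * red θ ρ g p.1 ^ 2) volX := by
  have hm := (aestronglyMeasurable_red hθ hρ hg.1).comp_fst (ν := (volume : Measure V).prod surf)
  have hmeas : AEStronglyMeasurable (fun p : X => kern θ ρ p * red θ ρ g p.1 ^ 2) volX :=
    (continuous_kern hθ hρ).aestronglyMeasurable.mul (hm.pow 2)
  refine (integrable_prod_iff hmeas).2 ⟨Filter.Eventually.of_forall fun v => (integrable_kern_section hθ hρ v).mul_const (red θ ρ g v ^ 2),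
    hg.2.congr (Filter.Eventually.of_forall fun v => ?_)⟩
  simp only
  rw [← integral_kern_mul_red_sq hθ hρ g v]
  refine integral_congr_ae (Filter.Eventually.of_forall fun y => ?_)
  simp only
  rw [Real.norm_of_nonneg (mul_nonneg (kern_nonneg hθ hρ _) (sq_nonneg _))]

lemma memLp_sqrt_kern_mul (hθ : |θ| ≤ 1) (hρ : 1 < ρ) {g : V → ℝ} (hg : MemNu θ ρ g) :
    MemLp (fun p : X => √(kern θ ρ p) * red θ ρ g p.1) 2 volX := by
  have hm := (aestronglyMeasurable_red hθ hρ hg.1).comp_fst (ν := (volume : Measure V).prod surf)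
  have hmeas : AEStronglyMeasurable (fun p : X => √(kern θ ρ p) * red θ ρ g p.1) volX :=
    (continuous_kern hθ hρ).sqrt.aestronglyMeasurable.mul hm
  refine (memLp_two_iff_integrable_sq hmeas).2 ?_
  refine (integrable_kern_mul_sq hθ hρ hg).congr (Filter.Eventually.of_forall fun p => ?_)
  simp only [mul_pow, Real.sq_sqrt (kern_nonneg hθ hρ p)]

/-- Invariance of `kern` makes each of the four terms of the defect an image of the first under a
symmetry, so finite ν-norm controls all of them in the weighted L². -/
lemma memLp_sqrt_kern_mul_defect (hθ : |θ| ≤ 1) (hρ : 1 < ρ) {g : V → ℝ} (hg : MemNu θ ρ g) :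
    MemLp (fun p : X => √(kern θ ρ p) * defect (red θ ρ g) p) 2 volX := by
  have h1 := memLp_sqrt_kern_mul hθ hρ hg
  have h2 := h1.comp_measurePreserving measurePreserving_exch
  have h3 := h1.comp_measurePreserving measurePreserving_collide
  have h4 := h2.comp_measurePreserving measurePreserving_collide
  refine ((h3.add h4).sub (h1.add h2)).ae_eq (Filter.Eventually.of_forall fun p => ?_)
  simp only [Pi.add_apply, Pi.sub_apply, Function.comp_apply, kern_exch, kern_collide]
  simp only [exch, collide, defect]
  ring

lemma integrable_kern_mul_defect_sq (hθ : |θ| ≤ 1) (hρ : 1 < ρ) {g : V → ℝ}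
    (hg : MemNu θ ρ g) :
    Integrable (fun p : X => kern θ ρ p * defect (red θ ρ g) p ^ 2) volX := by
  refine (memLp_sqrt_kern_mul_defect hθ hρ hg).integrable_sq.congr
    (Filter.Eventually.of_forall fun p => ?_)
  simp only [mul_pow, Real.sq_sqrt (kern_nonneg hθ hρ p)]

lemma integrable_kern_mul_defect_mul (hθ : |θ| ≤ 1) (hρ : 1 < ρ) {g : V → ℝ}
    (hg : MemNu θ ρ g) :
    Integrable (fun p : X => kern θ ρ p * defect (red θ ρ g) p * red θ ρ g p.1) volX := by
  refine ((memLp_sqrt_kern_mul_defect hθ hρ hg).integrable_mul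
    (memLp_sqrt_kern_mul hθ hρ hg)).congr (Filter.Eventually.of_forall fun p => ?_)
  simp only [Pi.mul_apply]
  rw [mul_mul_mul_comm, Real.mul_self_sqrt (kern_nonneg hθ hρ p)]
  ring

/-- The defect is odd under `collide` and even under `exch`, so the four images of `φ` add up
pointwise to minus the left integrand, while all have the same integral. -/
lemma integral_kern_mul_defect_sq (hθ : |θ| ≤ 1) (hρ : 1 < ρ) {g : V → ℝ}
    (hg : MemNu θ ρ g) :
    ∫ p, kern θ ρ p * defect (red θ ρ g) p ^ 2 ∂volX =
      -4 * ∫ p, kern θ ρ p * defect (red θ ρ g) p * red θ ρ g p.1 ∂volX := by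
  set φ : X → ℝ := fun p => kern θ ρ p * defect (red θ ρ g) p * red θ ρ g p.1 with hφ
  have h1 : Integrable φ volX := integrable_kern_mul_defect_mul hθ hρ hg
  have h2 := integrable_comp_exch h1
  have h3 := integrable_comp_collide h1
  have h4 := integrable_comp_collide h2
  have e2 := integral_exch φ
  have e3 := integral_collide φ
  have e4 := integral_collide fun p => φ (exch p)
  calc _ = ∫ p, -((φ p + φ (exch p)) + (φ (collide p) + φ (exch (collide p)))) ∂volX := by
        refine integral_congr_ae (Filter.Eventually.of_forall fun p => ?_)
        simp only [hφ, kern_exch, kern_collide, defect_exch, defect_collide]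
        simp only [exch, collide, defect]
        ring
    _ = -((∫ p, φ p ∂volX + ∫ p, φ (exch p) ∂volX) + (∫ p, φ (collide p) ∂volX
          + ∫ p, φ (exch (collide p)) ∂volX)) := by
        rw [integral_neg]
        congr 1
        rw [← integral_add h1 h2, ← integral_add h3 h4]
        exact integral_add (h1.add h2) (h3.add h4)
    _ = _ := by rw [e2, e3, e4, e2]; ring

lemma L_mul_self_ae_eq (hθ : |θ| ≤ 1) (hρ : 1 < ρ) {g : V → ℝ} (hg : MemLp g 2 volume) :
    (fun v => L θ ρ g v * g v) =ᵐ[volume] fun v =>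
      -∫ y, kern θ ρ (v, y) * defect (red θ ρ g) (v, y) * red θ ρ g v
        ∂((volume : Measure V).prod surf) := by
  filter_upwards [ae_LConverges hθ hρ hg] with v hv
  rw [L_eq_of_converges hθ hρ hv, integral_mul_const]
  simp only [linIntegrand_eq, red]
  ring

lemma integrable_L_mul_self (hθ : |θ| ≤ 1) (hρ : 1 < ρ) {g : V → ℝ} (hg : MemNu θ ρ g) :
    Integrable (fun v => L θ ρ g v * g v) volume :=
  (integrable_kern_mul_defect_mul hθ hρ hg).integral_prod_left.neg.congr
    (L_mul_self_ae_eq hθ hρ (hg.memLp hθ hρ)).symm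

lemma pairing_L_self (hθ : |θ| ≤ 1) (hρ : 1 < ρ) {g : V → ℝ} (hg : MemNu θ ρ g) :
    pairing (L θ ρ g) g = 1 / 4 * ∫ p, kern θ ρ p * defect (red θ ρ g) p ^ 2 ∂volX := by
  rw [pairing, integral_congr_ae (L_mul_self_ae_eq hθ hρ (hg.memLp hθ hρ)), integral_neg,
    integral_kern_mul_defect_sq hθ hρ hg,
    integral_prod _ (integrable_kern_mul_defect_mul hθ hρ hg)]
  ring

/-- `h(v') + h(u') - h(u)`. -/
def gainLoss (h : V → ℝ) (p : X) : ℝ :=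
  h (vPost p.2.1 p.1 p.2.2) + h (uPost p.2.1 p.1 p.2.2) - h p.2.1

/-- Splitting off the -h(v) term of the defect isolates ‖g‖_ν²; what is left is the part shown below
to be bounded on L². -/
lemma integral_kern_mul_defect_sq_eq (hθ : |θ| ≤ 1) (hρ : 1 < ρ) {g : V → ℝ}
    (hg : MemNu θ ρ g) :
    ∫ p, kern θ ρ p * defect (red θ ρ g) p ^ 2 ∂volX =
      4 * (∫ v, nu θ ρ v * g v ^ 2) -
      4 * ∫ p, kern θ ρ p * (gainLoss (red θ ρ g) p * red θ ρ g p.1) ∂volX := by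
  have h1 := integrable_kern_mul_defect_mul hθ hρ hg
  have h2 := integrable_kern_mul_sq hθ hρ hg
  have e1 : ∫ p, kern θ ρ p * red θ ρ g p.1 ^ 2 ∂volX = ∫ v, nu θ ρ v * g v ^ 2 := by
    rw [integral_prod _ h2]
    exact integral_congr_ae (Filter.Eventually.of_forall fun v => integral_kern_mul_red_sq hθ hρ g v)
  have e2 : ∫ p, kern θ ρ p * (gainLoss (red θ ρ g) p * red θ ρ g p.1) ∂volX =
      ∫ p, kern θ ρ p * defect (red θ ρ g) p * red θ ρ g p.1 ∂volX
      + ∫ p, kern θ ρ p * red θ ρ g p.1 ^ 2 ∂volX := by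
    rw [← integral_add h1 h2]
    refine integral_congr_ae (Filter.Eventually.of_forall fun p => ?_)
    simp only [gainLoss, defect]
    ring
  rw [integral_kern_mul_defect_sq hθ hρ hg, e2, e1]
  ring

/-- A function in the kernel of `L` has finite `ν`-norm as soon as the gain part of the form
is integrable against it. -/
lemma memNu_of_L_eq_zero (hθ : |θ| ≤ 1) (hρ : 1 < ρ) {f : V → ℝ} (hf : MemLp f 2 volume)
    (hL : L θ ρ f =ᵐ[volume] 0)
    (hK : Integrable (fun p : X => kern θ ρ p * (gainLoss (red θ ρ f) p * red θ ρ f p.1)) volX) :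
    MemNu θ ρ f := by
  refine ⟨hf.1, hK.integral_prod_left.congr ?_⟩
  filter_upwards [ae_LConverges hθ hρ hf, hL, hK.prod_right_ae] with v hv hLv hKv
  have hM := Real.sqrt_pos.2 (M_pos hθ hρ v)
  have h0 : ∫ y, kern θ ρ (v, y) * defect (red θ ρ f) (v, y) ∂((volume : Measure V).prod surf)
      = 0 := by
    rw [L_eq_of_converges hθ hρ hv] at hLv
    simpa [hM.ne', linIntegrand_eq] using hLv
  -- Since the defect integrates to zero against `kern` at v, the density ν f² coincides almost
  -- everywhere with a marginal of the integrable function in `hK`.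
  rw [← integral_kern_mul_red_sq hθ hρ f v, ← sub_eq_zero, ← integral_sub hKv
    ((integrable_kern_section hθ hρ v).mul_const _)]
  calc _ = ∫ y, kern θ ρ (v, y) * defect (red θ ρ f) (v, y) * red θ ρ f v
          ∂((volume : Measure V).prod surf) := by
        refine integral_congr_ae (Filter.Eventually.of_forall fun y => ?_)
        simp only [gainLoss, defect]; ring
    _ = 0 := by rw [integral_mul_const, h0, zero_mul]

end

/-! ### Integrals over the sphere -/

lemma volumeIoiPow_two_real :
    (Measure.volumeIoiPow 2).real (Set.Iio ⟨1, Set.mem_Ioi.2 one_pos⟩) = 1 / 3 := by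
  rw [measureReal_def, Measure.volumeIoiPow_apply_Iio, ENNReal.toReal_ofReal (by positivity)]
  norm_num

/-- Polar coordinates over the unit ball: the radial integral of r² on (0,1) is 1/3, whence the
factor 3. Spherical integrals thus become Lebesgue integrals, where coordinates and isometries are
available. -/
lemma integral_surf_eq (φ : V → ℝ) :
    ∫ ω, φ (ω : V) ∂surf =
      3 * ∫ x : V, φ (‖x‖⁻¹ • x) * (Set.Iio (1 : ℝ)).indicator 1 ‖x‖ := by
  have h1 : ∫ x : V, φ (‖x‖⁻¹ • x) * (Set.Iio (1 : ℝ)).indicator 1 ‖x‖ =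
      ∫ x : ({(0 : V)}ᶜ : Set V), φ (‖x.1‖⁻¹ • x.1) * (Set.Iio (1 : ℝ)).indicator 1 ‖x.1‖
        ∂((volume : Measure V).comap (↑)) := by
    rw [integral_subtype_comap (measurableSet_singleton _).compl
      fun x : V => φ (‖x‖⁻¹ • x) * (Set.Iio (1 : ℝ)).indicator 1 ‖x‖,
      restrict_compl_singleton]
  have h2 := (volume : Measure V).measurePreserving_homeomorphUnitSphereProd.integral_comp
    (Homeomorph.measurableEmbedding _)
    (fun z : S2 × Set.Ioi (0 : ℝ) => φ z.1 * (Set.Iio (1 : ℝ)).indicator 1 (z.2 : ℝ))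
  simp only [homeomorphUnitSphereProd_apply_snd_coe, homeomorphUnitSphereProd_apply_fst_coe] at h2
  rw [h1, h2, finrank_euclideanSpace_fin,
    integral_prod_mul (fun z : S2 => φ z)
      (fun r : Set.Ioi (0 : ℝ) => (Set.Iio (1 : ℝ)).indicator 1 (r : ℝ))]
  have h3 : ∫ r : Set.Ioi (0 : ℝ), (Set.Iio (1 : ℝ)).indicator (1 : ℝ → ℝ) (r : ℝ)
      ∂(Measure.volumeIoiPow 2) = 1 / 3 := by
    rw [← volumeIoiPow_two_real, ← integral_indicator_one measurableSet_Iio]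
    refine integral_congr_ae (Filter.Eventually.of_forall fun r => ?_)
    simp only [Set.indicator_apply, Set.mem_Iio, Pi.one_apply, ← Subtype.coe_lt_coe]
  have e : (3 - 1 : ℕ) = 2 := rfl
  rw [e, h3]
  ring

lemma integral_surf_comp_isometry (R : V ≃ₗᵢ[ℝ] V) (φ : V → ℝ) :
    ∫ ω, φ (R (ω : V)) ∂surf = ∫ ω, φ (ω : V) ∂surf := by
  rw [integral_surf_eq fun x => φ (R x), integral_surf_eq φ,
    ← R.measurePreserving.integral_comp R.toHomeomorph.measurableEmbedding
      (fun x : V => φ (‖x‖⁻¹ • x) * (Set.Iio (1 : ℝ)).indicator 1 ‖x‖)]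
  simp

lemma exists_isometry_map {x y : V} (h : ‖x‖ = ‖y‖) : ∃ R : V ≃ₗᵢ[ℝ] V, R x = y :=
  ⟨_, Submodule.reflection_sub h⟩

/-- The first coordinate vector. -/
def e0 : V := EuclideanSpace.single 0 1

lemma norm_e0 : ‖e0‖ = 1 := by simp [e0]

lemma exists_isometry_inner (v : V) :
    ∃ R : V ≃ₗᵢ[ℝ] V, ∀ x, inner ℝ v x = ‖v‖ * (R x) 0 := by
  obtain ⟨R, hR⟩ := exists_isometry_map (x := v) (y := ‖v‖ • e0) (by simp [norm_smul, norm_e0])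
  refine ⟨R, fun x => ?_⟩
  rw [← R.inner_map_map, hR, real_inner_smul_left]
  simp [e0, EuclideanSpace.inner_single_left]

lemma integral_prod_coord (f : Fin 3 → ℝ → ℝ) :
    ∫ x : V, ∏ i, f i (x i) = ∏ i, ∫ t, f i t := by
  rw [← integral_fintype_prod_volume_eq_prod,
    ← (EuclideanSpace.volume_preserving_symm_measurableEquiv_toLp (Fin 3)).integral_comp
      (MeasurableEquiv.measurableEmbedding _) (fun x : Fin 3 → ℝ => ∏ i, f i (x i))]
  rfl

lemma integral_gauss_one {b : ℝ} : ∫ t : ℝ, Real.exp (-b * t ^ 2) = √(Real.pi / b) :=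
  integral_gaussian b

lemma norm_sq_eq (x : V) : ‖x‖ ^ 2 = x 0 ^ 2 + (x 1 ^ 2 + x 2 ^ 2) := by
  rw [EuclideanSpace.real_norm_sq_eq, Fin.sum_univ_three, add_assoc]

lemma integral_sphere_bound {t : ℝ} (ht : 0 < t) :
    ∫ x : V, (Set.Ioo (-1 : ℝ) 1).indicator 1 (x 0) *
      (Real.exp (-(t ^ 2 / 2) * x 1 ^ 2) * Real.exp (-(t ^ 2 / 2) * x 2 ^ 2)) =
      4 * Real.pi / t ^ 2 := by
  have h := integral_prod_coord ![(Set.Ioo (-1 : ℝ) 1).indicator 1,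
    fun s => Real.exp (-(t ^ 2 / 2) * s ^ 2), fun s => Real.exp (-(t ^ 2 / 2) * s ^ 2)]
  simp only [Fin.prod_univ_three, Matrix.cons_val_zero, Matrix.cons_val_one, Matrix.cons_val,
    integral_gauss_one, mul_assoc] at h
  rw [h, integral_indicator_one measurableSet_Ioo, Real.mul_self_sqrt (by positivity)]
  simp only [measureReal_def, Real.volume_Ioo]
  rw [ENNReal.toReal_ofReal (by norm_num)]
  field_simp
  norm_num

/-- The weight `|ω·v| exp(-(|v|² - (ω·v)²)/2)`. -/
def sphW (v : V) (x : V) : ℝ :=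
  |inner ℝ x v| * Real.exp (-(‖v‖ ^ 2 - inner ℝ x v ^ 2) / 2)

lemma continuous_sphW (v : V) : Continuous (sphW v) := by unfold sphW; fun_prop

lemma sphW_nonneg (v x : V) : 0 ≤ sphW v x := by unfold sphW; positivity

lemma integrable_surf_of_continuous {φ : S2 → ℝ} (h : Continuous φ) : Integrable φ surf :=
  h.integrable_of_hasCompactSupport (HasCompactSupport.of_compactSpace φ)

/-- For large |v| the weight concentrates near the two poles ±v/|v|, on caps of area of order
|v|^{-2}, while |ω·v| ≤ |v|. In polar form the unit ball is enlarged to the cylinder |x₀| < 1 with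
Gaussian decay in the other coordinates, giving 3 · |v| · 4π/|v|². -/
lemma integral_sphW_le_of_one_le {v : V} (hv : 1 ≤ ‖v‖) :
    ∫ ω, sphW v (ω : V) ∂surf ≤ 12 * Real.pi := by
  obtain ⟨R, hR⟩ := exists_isometry_inner v
  set t := ‖v‖ with ht
  have ht0 : 0 < t := by linarith
  set G : V → ℝ := fun x => (Set.Ioo (-1 : ℝ) 1).indicator 1 (x 0) *
      (Real.exp (-(t ^ 2 / 2) * x 1 ^ 2) * Real.exp (-(t ^ 2 / 2) * x 2 ^ 2)) with hG
  have hGi : ∫ x, G x = 4 * Real.pi / t ^ 2 := integral_sphere_bound ht0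
  -- The Bochner integral of a non-integrable function is 0, so the positive value just computed
  -- forces integrability.
  have hGint : Integrable G := by
    by_contra h
    rw [integral_undef h] at hGi
    have : 0 < 4 * Real.pi / t ^ 2 := by positivity
    linarith
  have hRG : Integrable fun x => t * G (R x) :=
    (R.measurePreserving.integrable_comp_of_integrable hGint).const_mul t
  have hRGi : ∫ x, t * G (R x) = 4 * Real.pi / t := by
    rw [integral_const_mul,
      R.measurePreserving.integral_comp R.toHomeomorph.measurableEmbedding, hGi]
    field_simp
  rw [integral_surf_eq]
  have hmono : ∫ x : V, sphW v (‖x‖⁻¹ • x) * (Set.Iio (1 : ℝ)).indicator 1 ‖x‖ ≤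
      ∫ x, t * G (R x) := by
    refine integral_mono_of_nonneg (Filter.Eventually.of_forall fun x => ?_) hRG
      (Filter.Eventually.of_forall fun x => ?_)
    · exact mul_nonneg (sphW_nonneg _ _) (Set.indicator_nonneg (fun _ _ => zero_le_one) _)
    · simp only
      by_cases hx : ‖x‖ < 1
      swap
      · rw [Set.indicator_of_notMem (by simpa using hx), mul_zero, hG]
        exact mul_nonneg ht0.le (mul_nonneg (Set.indicator_nonneg (fun _ _ => zero_le_one) _)
          (by positivity))
      rw [Set.indicator_of_mem (by simpa using hx), Pi.one_apply, mul_one]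
      have hRx : ‖R x‖ = ‖x‖ := R.norm_map x
      have h0 : |(R x) 0| ≤ ‖x‖ := by
        rw [← hRx]; simpa using PiLp.norm_apply_le (R x) 0
      have hmem : (R x) 0 ∈ Set.Ioo (-1 : ℝ) 1 := abs_lt.1 (h0.trans_lt hx)
      simp only [hG]
      rw [Set.indicator_of_mem hmem, Pi.one_apply, one_mul, ← Real.exp_add, sphW]
      have hinner : inner ℝ (‖x‖⁻¹ • x) v = ‖x‖⁻¹ * (t * (R x) 0) := by
        rw [real_inner_smul_left, real_inner_comm, hR]
      rcases eq_or_ne x 0 with rfl | hx0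
      · simp [ht0.le]
      have hxp : 0 < ‖x‖ := norm_pos_iff.2 hx0
      gcongr
      · rw [hinner, abs_mul, abs_mul, abs_inv, abs_norm, abs_of_pos ht0, inv_mul_le_iff₀ hxp,
          mul_comm]
        exact mul_le_mul_of_nonneg_right h0 ht0.le
      · rw [hinner]
        have hn := norm_sq_eq (R x)
        rw [hRx] at hn
        -- Normalizing x only enlarges its transverse part, because ‖x‖ < 1.
        have key : (R x) 1 ^ 2 + (R x) 2 ^ 2 ≤ 1 - (‖x‖⁻¹ * (R x) 0) ^ 2 := by
          have : (‖x‖⁻¹ * (R x) 0) ^ 2 = ((R x) 0) ^ 2 / ‖x‖ ^ 2 := by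
            rw [mul_pow, inv_pow, inv_mul_eq_div]
          rw [this, le_sub_iff_add_le, ← le_sub_iff_add_le', div_le_iff₀ (by positivity)]
          have hx2 : ‖x‖ ^ 2 ≤ 1 := by nlinarith
          nlinarith [sq_nonneg ((R x) 1), sq_nonneg ((R x) 2), sq_nonneg ((R x) 0)]
        nlinarith [mul_le_mul_of_nonneg_left key (sq_nonneg t)]
  rw [hRGi] at hmono
  have : 4 * Real.pi / t ≤ 4 * Real.pi := div_le_self (by positivity) hv
  linarith

lemma exists_integral_sphW_le : ∃ B, 0 ≤ B ∧ ∀ v : V, ∫ ω, sphW v (ω : V) ∂surf ≤ B := by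
  refine ⟨12 * Real.pi + surf.real Set.univ, by positivity, fun v => ?_⟩
  rcases le_total 1 ‖v‖ with hv | hv
  · have : 0 ≤ surf.real Set.univ := measureReal_nonneg
    linarith [integral_sphW_le_of_one_le hv]
  · have h1 : ∫ ω, sphW v (ω : V) ∂surf ≤ ∫ ω : S2, (1 : ℝ) ∂surf := by
      refine integral_mono (integrable_surf_of_continuous
        ((continuous_sphW v).comp continuous_subtype_val)) (integrable_const _) fun ω => ?_
      have h1 := inner_sphere_sq_le ω v
      refine mul_le_one₀ ((abs_inner_sphere_le ω v).trans hv) (Real.exp_pos _).le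
        (Real.exp_le_one_iff.2 (by linarith))
    rw [integral_const, smul_eq_mul, mul_one] at h1
    linarith [Real.pi_pos]

/-- The set q < ε is a slab of width 2ε orthogonal to ω. The Gaussian integrates to at most 2ε
across it and to π along it, uniformly in v and ω. -/
lemma integral_slab_le (ω : S2) (v : V) {ε : ℝ} (hε : 0 ≤ ε) :
    ∫ u : V, (Set.Iio ε).indicator 1 (q ω u v) * maxw u ≤ 2 * Real.pi * ε ∧
    Integrable (fun u : V => (Set.Iio ε).indicator 1 (q ω u v) * maxw u) := by
  obtain ⟨R, hR⟩ := exists_isometry_inner (ω : V)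
  simp only [norm_sphere, one_mul] at hR
  set a := (R v) 0 with ha
  set G : V → ℝ := fun x =>
    (Set.Ioo (a - ε) (a + ε)).indicator (fun t => Real.exp (-1 * t ^ 2)) (x 0) *
      (Real.exp (-1 * x 1 ^ 2) * Real.exp (-1 * x 2 ^ 2)) with hG
  have hc : ∀ u, (Set.Iio ε).indicator 1 (q ω u v) * maxw u = G (R u) := by
    intro u
    rw [hG]
    have hq : q ω u v ∈ Set.Iio ε ↔ (R u) 0 ∈ Set.Ioo (a - ε) (a + ε) := by
      rw [q, hR, map_sub, PiLp.sub_apply, Set.mem_Iio, abs_sub_lt_iff, Set.mem_Ioo]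
      constructor <;> rintro ⟨h1, h2⟩ <;> constructor <;> linarith
    simp only [Set.indicator_apply, hq]
    split_ifs
    · rw [Pi.one_apply, one_mul, ← Real.exp_add, ← Real.exp_add, maxw, ← R.norm_map u, norm_sq_eq]
      congr 1; ring
    · simp
  have h := integral_prod_coord ![(Set.Ioo (a - ε) (a + ε)).indicator
      (fun t => Real.exp (-1 * t ^ 2)),
    fun s => Real.exp (-1 * s ^ 2), fun s => Real.exp (-1 * s ^ 2)]
  simp only [Fin.prod_univ_three, Matrix.cons_val_zero, Matrix.cons_val_one, Matrix.cons_val,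
    integral_gauss_one, mul_assoc] at h
  have hb : ∫ t, (Set.Ioo (a - ε) (a + ε)).indicator (fun t => Real.exp (-1 * t ^ 2)) t ≤ 2 * ε := by
    rw [integral_indicator measurableSet_Ioo]
    calc _ ≤ ∫ t in Set.Ioo (a - ε) (a + ε), (1 : ℝ) := by
          refine setIntegral_mono_on ((integrable_exp_neg_mul_sq one_pos).integrableOn)
            (by simp) measurableSet_Ioo fun t _ => Real.exp_le_one_iff.2 (by nlinarith [sq_nonneg t])
      _ = 2 * ε := by
          rw [setIntegral_const, measureReal_def, Real.volume_Ioo, ENNReal.toReal_ofReal (by linarith)]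
          simp; ring
  simp only [hc]
  constructor
  · rw [R.measurePreserving.integral_comp R.toHomeomorph.measurableEmbedding, h,
      Real.mul_self_sqrt (by positivity), div_one]
    nlinarith [Real.pi_pos]
  · simp only [← hc]
    have hq : Measurable fun u => q ω u v := by unfold q; fun_prop
    refine (integrable_gauss one_pos).mono'
      (((measurable_one.indicator measurableSet_Iio).comp hq).mul
        continuous_maxw.measurable).aestronglyMeasurable (Filter.Eventually.of_forall fun u => ?_)
    have hm := maxw_pos u
    rw [norm_mul, Real.norm_of_nonneg hm.le]
    have : ‖(Set.Iio ε).indicator (1 : ℝ → ℝ) (q ω u v)‖ ≤ 1 := by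
      rw [Set.indicator_apply]; split_ifs <;> simp
    calc _ ≤ 1 * maxw u := by gcongr
      _ = _ := by simp [maxw]

/-! ### Boundedness of the gain part on `L²` -/

/-- Schur test in symmetric form: `T` exchanges the two squares and fixes `κ`, so a single bound on
the sections over v controls both. -/
lemma schur_bound {κ : X → ℝ} (hc : Continuous κ) (h0 : ∀ p, 0 ≤ κ p) {A : ℝ}
    (hsec : ∀ v, Integrable (fun y => κ (v, y)) ((volume : Measure V).prod surf))
    (hA : ∀ v, ∫ y, κ (v, y) ∂((volume : Measure V).prod surf) ≤ A)
    {T : X → X} (hT : MeasurePreserving T volX volX) (hTT : ∀ p, T (T p) = p)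
    (hκ : ∀ p, κ (T p) = κ p) {f : V → ℝ} (hf : MemLp f 2 volume) :
    Integrable (fun p => κ p * (f p.1 ^ 2 + f (T p).1 ^ 2)) volX ∧
      ∫ p, κ p * (f p.1 ^ 2 + f (T p).1 ^ 2) ∂volX ≤ 2 * A * ∫ v, f v ^ 2 := by
  have hm : AEStronglyMeasurable (fun p : X => κ p * f p.1 ^ 2) volX :=
    hc.aestronglyMeasurable.mul ((hf.1.comp_fst (ν := (volume : Measure V).prod surf)).pow 2)
  have hsecf : ∀ v, ∫ y, κ (v, y) * f v ^ 2 ∂((volume : Measure V).prod surf) ≤ A * f v ^ 2 :=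
    fun v => by
      rw [integral_mul_const]
      exact mul_le_mul_of_nonneg_right (hA v) (sq_nonneg _)
  have h1 : Integrable (fun p : X => κ p * f p.1 ^ 2) volX := by
    refine (integrable_prod_iff hm).2 ⟨Filter.Eventually.of_forall fun v =>
      (hsec v).mul_const (f v ^ 2), ?_⟩
    refine (hf.integrable_sq.const_mul A).mono' hm.norm.integral_prod_right'
      (Filter.Eventually.of_forall fun v => ?_)
    rw [Real.norm_of_nonneg (integral_nonneg fun y => norm_nonneg _)]
    refine le_trans (le_of_eq ?_) (hsecf v)
    refine integral_congr_ae (Filter.Eventually.of_forall fun y => ?_)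
    simp only
    rw [Real.norm_of_nonneg (mul_nonneg (h0 _) (sq_nonneg _))]
  have h2 : Integrable (fun p : X => κ p * f (T p).1 ^ 2) volX := by
    refine (hT.integrable_comp_of_integrable h1).congr (Filter.Eventually.of_forall fun p => ?_)
    simp only [Function.comp_apply, hκ]
  have e2 : ∫ p, κ p * f (T p).1 ^ 2 ∂volX = ∫ p, κ p * f p.1 ^ 2 ∂volX := by
    rw [← involutive_integral_comp hT hTT fun p => κ p * f p.1 ^ 2]
    simp only [hκ]
  have e1 : ∫ p, κ p * f p.1 ^ 2 ∂volX ≤ A * ∫ v, f v ^ 2 := by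
    rw [integral_prod _ h1, ← integral_const_mul]
    exact integral_mono h1.integral_prod_left (hf.integrable_sq.const_mul A) hsecf
  simp only [mul_add]
  refine ⟨h1.add h2, ?_⟩
  rw [integral_add h1 h2, e2]
  linarith

/-- `(v, u, ω) ↦ (u', v', ω)`. -/
def collideExch (p : X) : X := collide (exch p)

lemma measurePreserving_collideExch : MeasurePreserving collideExch volX volX :=
  measurePreserving_collide.comp measurePreserving_exch

lemma collideExch_collideExch (p : X) : collideExch (collideExch p) = p := by
  rw [collideExch, collideExch, ← collide_exch, exch_exch, collide_collide]

lemma collideExch_eq (p : X) :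
    collideExch p = (uPost p.2.1 p.1 p.2.2, (vPost p.2.1 p.1 p.2.2, p.2.2)) := by
  rw [collideExch, collide_exch]; rfl

/-- The Schur kernel attached to the pair `(v, (T p).1)`. -/
def schurKer (T : X → X) (p : X) : ℝ :=
  q p.2.2 p.2.1 p.1 * Real.exp (-‖p.2.1‖ ^ 2 - ‖p.1‖ ^ 2 / 2 + ‖(T p).1‖ ^ 2 / 2)

lemma continuous_schurKer {T : X → X} (hT : Continuous T) : Continuous (schurKer T) := by
  have := continuous_q
  unfold schurKer; fun_prop

lemma schurKer_nonneg (T : X → X) (p : X) : 0 ≤ schurKer T p :=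
  mul_nonneg (q_nonneg _ _ _) (Real.exp_pos _).le

lemma schurKer_collide (p : X) : schurKer collide (collide p) = schurKer collide p := by
  have h := norm_sq_post p.2.1 p.1 p.2.2
  simp only [schurKer, collide_collide]
  simp only [collide, q_post]
  congr 2; linarith

lemma schurKer_exch (p : X) : schurKer exch (exch p) = schurKer exch p := by
  simp only [schurKer, exch]
  rw [q_swap]
  congr 2; ring

lemma schurKer_collideExch (p : X) :
    schurKer collideExch (collideExch p) = schurKer collideExch p := by
  have h := norm_sq_post p.2.1 p.1 p.2.2
  simp only [schurKer, collideExch_collideExch]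
  simp only [collideExch_eq]
  rw [q_swap, q_post]
  congr 2; linarith

lemma le_exp_half_sq (a : ℝ) : a ≤ Real.exp (a ^ 2 / 2) :=
  le_trans (by nlinarith [sq_nonneg (a - 1)]) (Real.add_one_le_exp _)

lemma mul_exp_neg_half_sq_le (a : ℝ) : a * Real.exp (-a ^ 2 / 2) ≤ 1 := by
  rw [neg_div, Real.exp_neg]
  exact mul_inv_le_one_of_le₀ (le_exp_half_sq a) (Real.exp_pos _).le

/-- Here |v'|² = |v|² - (ω·v)² + (ω·u)², so the factor e^{-(ω·v)²/2} absorbs the growth |ω·v| of q.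
-/
lemma schurKer_collide_le (p : X) :
    schurKer collide p ≤ (1 + ‖p.2.1‖) * Real.exp (-(1 / 2) * ‖p.2.1‖ ^ 2) := by
  obtain ⟨v, u, ω⟩ := p
  simp only [schurKer, collide, norm_sq_vPost]
  have h1 : q ω u v ≤ |inner ℝ (ω : V) v| + ‖u‖ := by
    rw [q, inner_sub_right]
    exact (abs_sub _ _).trans (by linarith [abs_inner_sphere_le ω u])
  set a := inner ℝ (ω : V) v
  set b := inner ℝ (ω : V) u
  have h2 : b ^ 2 ≤ ‖u‖ ^ 2 := inner_sphere_sq_le ω u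
  have h3 := mul_exp_neg_half_sq_le |a|
  rw [sq_abs] at h3
  have h4 : Real.exp (-a ^ 2 / 2) ≤ 1 := Real.exp_le_one_iff.2 (by nlinarith [sq_nonneg a])
  calc q ω u v * Real.exp (-‖u‖ ^ 2 - ‖v‖ ^ 2 / 2 + (‖v‖ ^ 2 - a ^ 2 + b ^ 2) / 2)
      ≤ (|a| + ‖u‖) * Real.exp (-a ^ 2 / 2 + -(1 / 2) * ‖u‖ ^ 2) := by
        refine mul_le_mul h1 (Real.exp_le_exp.2 (by linarith)) (Real.exp_pos _).le (by positivity)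
    _ = (|a| * Real.exp (-a ^ 2 / 2) + ‖u‖ * Real.exp (-a ^ 2 / 2)) *
          Real.exp (-(1 / 2) * ‖u‖ ^ 2) := by rw [Real.exp_add]; ring
    _ ≤ (1 + ‖u‖ * 1) * Real.exp (-(1 / 2) * ‖u‖ ^ 2) := by gcongr
    _ = _ := by rw [mul_one]

lemma schurKer_exch_le (p : X) :
    schurKer exch p ≤ (1 + ‖p.2.1‖) * Real.exp (-(1 / 2) * ‖p.2.1‖ ^ 2) := by
  obtain ⟨v, u, ω⟩ := p
  simp only [schurKer, exch]
  have h1 := q_le ω u v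
  have h3 := mul_exp_neg_half_sq_le ‖v‖
  have h4 : Real.exp (-‖v‖ ^ 2 / 2) ≤ 1 := Real.exp_le_one_iff.2 (by nlinarith [sq_nonneg ‖v‖])
  calc q ω u v * Real.exp (-‖u‖ ^ 2 - ‖v‖ ^ 2 / 2 + ‖u‖ ^ 2 / 2)
      ≤ (‖u‖ + ‖v‖) * Real.exp (-‖v‖ ^ 2 / 2 + -(1 / 2) * ‖u‖ ^ 2) := by
        refine mul_le_mul h1 (Real.exp_le_exp.2 (by linarith)) (Real.exp_pos _).le (by positivity)
    _ = (‖v‖ * Real.exp (-‖v‖ ^ 2 / 2) + ‖u‖ * Real.exp (-‖v‖ ^ 2 / 2)) *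
          Real.exp (-(1 / 2) * ‖u‖ ^ 2) := by rw [Real.exp_add]; ring
    _ ≤ (1 + ‖u‖ * 1) * Real.exp (-(1 / 2) * ‖u‖ ^ 2) := by gcongr
    _ = _ := by rw [mul_one]

/-- For u' the damping acts only on the part of v transverse to ω, so the growth |ω·v| survives
pointwise; it is tamed after integration over the sphere, which is the purpose of `sphW`. -/
lemma schurKer_collideExch_le (p : X) :
    schurKer collideExch p ≤
      ((1 + ‖p.2.1‖) * Real.exp (-(1 / 2) * ‖p.2.1‖ ^ 2)) * (1 + sphW p.1 p.2.2) := by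
  obtain ⟨v, u, ω⟩ := p
  simp only [schurKer, collideExch_eq, norm_sq_uPost, sphW]
  have h1 : q ω u v ≤ |inner ℝ (ω : V) v| + ‖u‖ := by
    rw [q, inner_sub_right]
    exact (abs_sub _ _).trans (by linarith [abs_inner_sphere_le ω u])
  set a := inner ℝ (ω : V) v
  set b := inner ℝ (ω : V) u
  have h2 : a ^ 2 ≤ ‖v‖ ^ 2 := inner_sphere_sq_le ω v
  set s := Real.exp (-(‖v‖ ^ 2 - a ^ 2) / 2) with hs
  have h4 : s ≤ 1 := Real.exp_le_one_iff.2 (by linarith)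
  have h5 : 0 < s := Real.exp_pos _
  have h6 := norm_nonneg u
  calc q ω u v * Real.exp (-‖u‖ ^ 2 - ‖v‖ ^ 2 / 2 + (‖u‖ ^ 2 - b ^ 2 + a ^ 2) / 2)
      ≤ (|a| + ‖u‖) * Real.exp (-(‖v‖ ^ 2 - a ^ 2) / 2 + -(1 / 2) * ‖u‖ ^ 2) := by
        refine mul_le_mul h1 (Real.exp_le_exp.2 (by linarith [sq_nonneg b])) (Real.exp_pos _).le (by positivity)
    _ = (|a| * s + ‖u‖ * s) * Real.exp (-(1 / 2) * ‖u‖ ^ 2) := by rw [Real.exp_add, ← hs]; ring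
    _ ≤ (((1 + ‖u‖) * (1 + |a| * s))) * Real.exp (-(1 / 2) * ‖u‖ ^ 2) := by
        gcongr
        have : 0 ≤ |a| * s := by positivity
        nlinarith
    _ = _ := by ring

lemma schurKer_section {T : X → X} (hT : Continuous T)
    (h : ∀ p, schurKer T p ≤
      ((1 + ‖p.2.1‖) * Real.exp (-(1 / 2) * ‖p.2.1‖ ^ 2)) * (1 + sphW p.1 p.2.2)) :
    ∃ A, 0 ≤ A ∧ ∀ v, Integrable (fun y => schurKer T (v, y)) ((volume : Measure V).prod surf) ∧
      ∫ y, schurKer T (v, y) ∂((volume : Measure V).prod surf) ≤ A := by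
  obtain ⟨B, hB0, hB⟩ := exists_integral_sphW_le
  have hi := integrable_pow_mul_gauss 1 (b := 1 / 2) (by norm_num)
  simp only [pow_one] at hi
  have hI0 : 0 ≤ ∫ u : V, (1 + ‖u‖) * Real.exp (-(1 / 2) * ‖u‖ ^ 2) :=
    integral_nonneg fun u => by positivity
  refine ⟨(∫ u : V, (1 + ‖u‖) * Real.exp (-(1 / 2) * ‖u‖ ^ 2)) * (surf.real Set.univ + B),
    mul_nonneg hI0 (add_nonneg measureReal_nonneg hB0), fun v => ?_⟩
  have hs : Integrable (fun ω : S2 => sphW v ω) surf :=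
    integrable_surf_of_continuous ((continuous_sphW v).comp continuous_subtype_val)
  have hd := hi.mul_prod ((integrable_const (1 : ℝ)).add hs)
  have h1 : Integrable (fun y => schurKer T (v, y)) ((volume : Measure V).prod surf) := by
    refine hd.mono' ((continuous_schurKer hT).comp (by fun_prop)).aestronglyMeasurable
      (Filter.Eventually.of_forall fun y => ?_)
    rw [Real.norm_of_nonneg (schurKer_nonneg _ _)]
    exact h (v, y)
  refine ⟨h1, (integral_mono h1 hd fun y => h (v, y)).trans ?_⟩
  rw [integral_prod_mul (fun u : V => (1 + ‖u‖) * Real.exp (-(1 / 2) * ‖u‖ ^ 2))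
    ((fun _ : S2 => (1 : ℝ)) + fun ω : S2 => sphW v ω)]
  refine mul_le_mul_of_nonneg_left ?_ hI0
  have := integral_add (integrable_const (1 : ℝ)) hs
  simp only [Pi.add_apply]
  rw [this, integral_const, smul_eq_mul, mul_one]
  linarith [hB v]

section

variable {θ ρ : ℝ}

lemma red_abs_le (hθ : |θ| ≤ 1) (hρ : 1 < ρ) (f : V → ℝ) (v : V) :
    |red θ ρ f v| ≤ (√(ρ * (ρ + 1)⁻¹ ^ 2))⁻¹ * (Real.exp (‖v‖ ^ 2 / 2) * |f v|) := by
  have hb : 0 < ρ * (ρ + 1)⁻¹ ^ 2 := by have : 0 < ρ := by linarith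
                                        positivity
  have h1 : √(ρ * (ρ + 1)⁻¹ ^ 2) * √(maxw v) ≤ √(M θ ρ v) := by
    rw [← Real.sqrt_mul hb.le]
    exact Real.sqrt_le_sqrt (M_ge hθ hρ v)
  have h2 : 0 < √(ρ * (ρ + 1)⁻¹ ^ 2) := Real.sqrt_pos.2 hb
  have h3 : 0 < √(maxw v) := Real.sqrt_pos.2 (maxw_pos v)
  have h4 : Real.exp (‖v‖ ^ 2 / 2) = (√(maxw v))⁻¹ := by
    rw [sqrt_maxw, ← Real.exp_neg]; congr 1; ring
  rw [red, abs_div, abs_of_nonneg (Real.sqrt_nonneg _), h4, ← mul_assoc, ← mul_inv, inv_mul_eq_div]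
  gcongr

/-- Dividing f by M^{1/2} costs e^{|·|²/2} at each of the two points; combined with the Gaussian
bound for `kern` this is exactly the exponential in `schurKer`. -/
lemma kern_mul_red_le (hθ : |θ| ≤ 1) (hρ : 1 < ρ) : ∃ C, 0 ≤ C ∧ ∀ (T : X → X) (f : V → ℝ) (p : X),
    |kern θ ρ p * (red θ ρ f (T p).1 * red θ ρ f p.1)| ≤
      C * (schurKer T p * (f p.1 ^ 2 + f (T p).1 ^ 2)) := by
  have hρ0 : 0 < ρ := by linarith
  set c := (ρ - 1)⁻¹ ^ 4 * ρ ^ 2 with hc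
  set b := (√(ρ * (ρ + 1)⁻¹ ^ 2))⁻¹ with hb
  have hc0 : 0 ≤ c := by positivity
  have hb0 : 0 ≤ b := by positivity
  refine ⟨c * b ^ 2, by positivity, fun T f p => ?_⟩
  have h1 := kern_le hθ hρ p
  have h2 := red_abs_le hθ hρ f (T p).1
  have h3 := red_abs_le hθ hρ f p.1
  have h5 : 0 ≤ c * (q p.2.2 p.2.1 p.1 * (maxw p.2.1 * maxw p.1)) :=
    (kern_nonneg hθ hρ p).trans h1
  rw [abs_mul, abs_mul, abs_of_nonneg (kern_nonneg hθ hρ p)]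
  have h4 : |f (T p).1| * |f p.1| ≤ f p.1 ^ 2 + f (T p).1 ^ 2 := by
    nlinarith [sq_nonneg (|f (T p).1| - |f p.1|), sq_abs (f (T p).1), sq_abs (f p.1),
      sq_nonneg (f (T p).1), sq_nonneg (f p.1)]
  have he : maxw p.2.1 * maxw p.1 * (Real.exp (‖(T p).1‖ ^ 2 / 2) * Real.exp (‖p.1‖ ^ 2 / 2)) =
      Real.exp (-‖p.2.1‖ ^ 2 - ‖p.1‖ ^ 2 / 2 + ‖(T p).1‖ ^ 2 / 2) := by
    simp only [maxw, ← Real.exp_add]; congr 1; ring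
  calc _ ≤ (c * (q p.2.2 p.2.1 p.1 * (maxw p.2.1 * maxw p.1))) *
        ((b * (Real.exp (‖(T p).1‖ ^ 2 / 2) * |f (T p).1|)) *
          (b * (Real.exp (‖p.1‖ ^ 2 / 2) * |f p.1|))) := by gcongr
    _ = c * b ^ 2 * (q p.2.2 p.2.1 p.1 * (maxw p.2.1 * maxw p.1 * (Real.exp (‖(T p).1‖ ^ 2 / 2) *
          Real.exp (‖p.1‖ ^ 2 / 2))) * (|f (T p).1| * |f p.1|)) := by ring
    _ ≤ c * b ^ 2 * (schurKer T p * (f p.1 ^ 2 + f (T p).1 ^ 2)) := by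
        rw [he]
        have := schurKer_nonneg T p
        unfold schurKer at this ⊢
        gcongr

lemma exists_schur_bound (hθ : |θ| ≤ 1) (hρ : 1 < ρ) {T : X → X} (hTc : Continuous T)
    (hT : MeasurePreserving T volX volX) (hTT : ∀ p, T (T p) = p)
    (hκ : ∀ p, schurKer T (T p) = schurKer T p)
    (h : ∀ p, schurKer T p ≤
      ((1 + ‖p.2.1‖) * Real.exp (-(1 / 2) * ‖p.2.1‖ ^ 2)) * (1 + sphW p.1 p.2.2)) :
    ∃ C, 0 ≤ C ∧ ∀ f : V → ℝ, MemLp f 2 volume →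
      Integrable (fun p => kern θ ρ p * (red θ ρ f (T p).1 * red θ ρ f p.1)) volX ∧
      |∫ p, kern θ ρ p * (red θ ρ f (T p).1 * red θ ρ f p.1) ∂volX| ≤ C * ∫ v, f v ^ 2 := by
  obtain ⟨A, hA0, hA⟩ := schurKer_section hTc h
  obtain ⟨C, hC0, hC⟩ := kern_mul_red_le hθ hρ
  refine ⟨C * (2 * A), by positivity, fun f hf => ?_⟩
  obtain ⟨h1, h2⟩ := schur_bound (continuous_schurKer hTc) (schurKer_nonneg T)
    (fun v => (hA v).1) (fun v => (hA v).2) hT hTT hκ hf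
  have hm := (aestronglyMeasurable_red hθ hρ hf.1).comp_fst (ν := (volume : Measure V).prod surf)
  have hmT := hm.comp_measurePreserving hT
  have hint : Integrable (fun p => kern θ ρ p * (red θ ρ f (T p).1 * red θ ρ f p.1)) volX :=
    (h1.const_mul C).mono' ((continuous_kern hθ hρ).aestronglyMeasurable.mul (hmT.mul hm))
      (Filter.Eventually.of_forall fun p => hC T f p)
  refine ⟨hint, ?_⟩
  calc _ ≤ ∫ p, C * (schurKer T p * (f p.1 ^ 2 + f (T p).1 ^ 2)) ∂volX :=
        (abs_integral_le_integral_abs).trans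
          (integral_mono hint.abs (h1.const_mul C) fun p => hC T f p)
    _ ≤ C * (2 * A * ∫ v, f v ^ 2) := by
        rw [integral_const_mul]; exact mul_le_mul_of_nonneg_left h2 hC0
    _ = _ := by ring

/-- The three terms h(v'), h(u'), h(u) correspond to the involutions `collide`, `collideExch`,
`exch`, each with its own Schur kernel. -/
theorem gainLoss_bound (hθ : |θ| ≤ 1) (hρ : 1 < ρ) :
    ∃ C, 0 ≤ C ∧ ∀ f : V → ℝ, MemLp f 2 volume →
      Integrable (fun p => kern θ ρ p * (gainLoss (red θ ρ f) p * red θ ρ f p.1)) volX ∧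
      ∫ p, kern θ ρ p * (gainLoss (red θ ρ f) p * red θ ρ f p.1) ∂volX ≤ C * ∫ v, f v ^ 2 := by
  have hw : ∀ p : X, ((1 + ‖p.2.1‖) * Real.exp (-(1 / 2) * ‖p.2.1‖ ^ 2)) ≤
      ((1 + ‖p.2.1‖) * Real.exp (-(1 / 2) * ‖p.2.1‖ ^ 2)) * (1 + sphW p.1 p.2.2) := fun p =>
    le_mul_of_one_le_right (by positivity) (by linarith [sphW_nonneg p.1 p.2.2])
  obtain ⟨C1, hC1, H1⟩ := exists_schur_bound hθ hρ continuous_collide measurePreserving_collide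
    collide_collide schurKer_collide fun p => (schurKer_collide_le p).trans (hw p)
  obtain ⟨C2, hC2, H2⟩ := exists_schur_bound hθ hρ continuous_exch measurePreserving_exch
    exch_exch schurKer_exch fun p => (schurKer_exch_le p).trans (hw p)
  obtain ⟨C3, hC3, H3⟩ := exists_schur_bound hθ hρ (continuous_collide.comp continuous_exch)
    measurePreserving_collideExch collideExch_collideExch schurKer_collideExch
    schurKer_collideExch_le
  refine ⟨C1 + C3 + C2, by positivity, fun f hf => ?_⟩
  obtain ⟨i1, b1⟩ := H1 f hf
  obtain ⟨i2, b2⟩ := H2 f hf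
  obtain ⟨i3, b3⟩ := H3 f hf
  have e : (fun p : X => kern θ ρ p * (gainLoss (red θ ρ f) p * red θ ρ f p.1)) = fun p =>
      (kern θ ρ p * (red θ ρ f (collide p).1 * red θ ρ f p.1) +
        kern θ ρ p * (red θ ρ f (collideExch p).1 * red θ ρ f p.1)) -
        kern θ ρ p * (red θ ρ f (exch p).1 * red θ ρ f p.1) := by
    funext p
    simp only [collideExch_eq, gainLoss, collide, exch]
    ring
  rw [e]
  refine ⟨(i1.add i3).sub i2, ?_⟩
  have e2 := integral_sub (i1.add i3) i2
  have e3 := integral_add i1 i3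
  simp only [Pi.add_apply] at e2
  simp only [Function.comp_def] at e2 e3 b3
  change ∫ p, (kern θ ρ p * (red θ ρ f (collide p).1 * red θ ρ f p.1) +
        kern θ ρ p * (red θ ρ f (collide (exch p)).1 * red θ ρ f p.1)) -
        kern θ ρ p * (red θ ρ f (exch p).1 * red θ ρ f p.1) ∂volX ≤ _
  rw [e2, e3]
  have := le_of_abs_le b1
  have := neg_le_of_abs_le b2
  have := le_of_abs_le b3
  linarith

end

/-! ### Moments of the uniform measure on the sphere -/

/-- The uniform probability measure on the sphere. -/
def nsurf : Measure S2 := (surf Set.univ)⁻¹ • surf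

lemma surf_univ_ne_zero : surf Set.univ ≠ 0 := by
  rw [ne_eq, Measure.measure_univ_eq_zero]
  exact Measure.toSphere_ne_zero _

instance isProbabilityMeasure_nsurf : IsProbabilityMeasure nsurf :=
  ⟨by rw [nsurf, Measure.smul_apply, smul_eq_mul,
    ENNReal.inv_mul_cancel surf_univ_ne_zero (measure_ne_top _ _)]⟩

lemma integrable_nsurf {φ : S2 → ℝ} (h : Continuous φ) : Integrable φ nsurf :=
  h.integrable_of_hasCompactSupport (HasCompactSupport.of_compactSpace φ)

lemma integral_nsurf_comp_isometry (R : V ≃ₗᵢ[ℝ] V) (φ : V → ℝ) :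
    ∫ ω, φ (R (ω : V)) ∂nsurf = ∫ ω, φ (ω : V) ∂nsurf := by
  rw [nsurf, integral_smul_measure, integral_smul_measure, integral_surf_comp_isometry]

lemma integral_nsurf_inner_pow (x : V) (k : ℕ) :
    ∫ ω, inner ℝ (ω : V) x ^ k ∂nsurf = ‖x‖ ^ k * ∫ ω, inner ℝ (ω : V) e0 ^ k ∂nsurf := by
  obtain ⟨R, hR⟩ := exists_isometry_map (x := x) (y := ‖x‖ • e0) (by simp [norm_smul, norm_e0])
  have h := integral_nsurf_comp_isometry R fun y => inner ℝ y (‖x‖ • e0) ^ k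
  rw [← hR] at h
  simp only [R.inner_map_map] at h
  rw [h, hR, ← integral_const_mul]
  simp only [real_inner_smul_right, mul_pow]

lemma continuous_inner_sphere (x : V) : Continuous fun ω : S2 => inner ℝ (ω : V) x := by
  fun_prop

/-- The standard basis of `V`. -/
abbrev stdB : OrthonormalBasis (Fin 3) ℝ V := EuclideanSpace.basisFun (Fin 3) ℝ

lemma sum_inner_sphere_sq (ω : S2) : ∑ i, inner ℝ (ω : V) (stdB i) ^ 2 = 1 := by
  have h := stdB.sum_sq_norm_inner_left (ω : V)
  simpa [norm_sphere] using h

lemma integral_nsurf_inner_sq (x : V) :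
    ∫ ω, inner ℝ (ω : V) x ^ 2 ∂nsurf = ‖x‖ ^ 2 / 3 := by
  have hi : ∀ i ∈ Finset.univ, Integrable (fun ω : S2 => inner ℝ (ω : V) (stdB i) ^ 2) nsurf :=
    fun i _ => integrable_nsurf ((continuous_inner_sphere _).pow 2)
  have h : ∑ i, ∫ ω, inner ℝ (ω : V) (stdB i) ^ 2 ∂nsurf = 1 := by
    rw [← integral_finsetSum _ hi]
    simp only [sum_inner_sphere_sq]
    simp
  simp only [integral_nsurf_inner_pow (stdB _), stdB.norm_eq_one, one_pow, one_mul,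
    Finset.sum_const, Finset.card_univ, Fintype.card_fin, nsmul_eq_mul] at h
  rw [integral_nsurf_inner_pow]
  push_cast at h
  linear_combination ‖x‖ ^ 2 / 3 * h

/-- Polarization: (p+q)⁴ + (p-q)⁴ - 2p⁴ - 2q⁴ = 12p²q², and fourth moments depend only on the length
by rotation invariance. -/
lemma integral_nsurf_inner_sq_mul_sq_aux (x y : V) :
    ∫ ω, inner ℝ (ω : V) x ^ 2 * inner ℝ (ω : V) y ^ 2 ∂nsurf =
      (‖x‖ ^ 2 * ‖y‖ ^ 2 + 2 * inner ℝ x y ^ 2) / 3 * ∫ ω, inner ℝ (ω : V) e0 ^ 4 ∂nsurf := by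
  set m := ∫ ω, inner ℝ (ω : V) e0 ^ 4 ∂nsurf with hm
  have i4 : ∀ z : V, Integrable (fun ω : S2 => inner ℝ (ω : V) z ^ 4) nsurf := fun z =>
    integrable_nsurf ((continuous_inner_sphere z).pow 4)
  have e4 : ∀ z : V, ∫ ω, inner ℝ (ω : V) z ^ 4 ∂nsurf = (‖z‖ ^ 2) ^ 2 * m := fun z => by
    rw [integral_nsurf_inner_pow, hm]; ring
  have h : ∀ ω : S2, inner ℝ (ω : V) x ^ 2 * inner ℝ (ω : V) y ^ 2 =
      1 / 12 * ((inner ℝ (ω : V) (x + y) ^ 4 + inner ℝ (ω : V) (x - y) ^ 4) -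
        (2 * inner ℝ (ω : V) x ^ 4 + 2 * inner ℝ (ω : V) y ^ 4)) := fun ω => by
    rw [inner_add_right, inner_sub_right]; ring
  have j1 : Integrable (fun ω : S2 => inner ℝ (ω : V) (x + y) ^ 4 + inner ℝ (ω : V) (x - y) ^ 4)
    nsurf := (i4 _).add (i4 _)
  have j2 : Integrable (fun ω : S2 => 2 * inner ℝ (ω : V) x ^ 4 + 2 * inner ℝ (ω : V) y ^ 4)
    nsurf := ((i4 _).const_mul 2).add ((i4 _).const_mul 2)
  simp only [h]
  rw [integral_const_mul, integral_sub j1 j2, integral_add (i4 _) (i4 _),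
    integral_add ((i4 _).const_mul 2) ((i4 _).const_mul 2), integral_const_mul,
    integral_const_mul, e4, e4, e4, e4, norm_add_sq_real, norm_sub_sq_real]
  ring

/-- Summing the mixed moments (ω·eᵢ)²(ω·e₀)² over an orthonormal basis gives 1/3 on one side and
(3+2)/3 times the unknown moment on the other. -/
lemma integral_nsurf_inner_e0_pow_four : ∫ ω, inner ℝ (ω : V) e0 ^ 4 ∂nsurf = 1 / 5 := by
  have hi : ∀ i ∈ Finset.univ,
      Integrable (fun ω : S2 => inner ℝ (ω : V) (stdB i) ^ 2 * inner ℝ (ω : V) e0 ^ 2) nsurf :=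
    fun i _ => integrable_nsurf
      (((continuous_inner_sphere _).pow 2).mul ((continuous_inner_sphere _).pow 2))
  have h : ∑ i, ∫ ω, inner ℝ (ω : V) (stdB i) ^ 2 * inner ℝ (ω : V) e0 ^ 2 ∂nsurf = 1 / 3 := by
    rw [← integral_finsetSum _ hi]
    simp only [← Finset.sum_mul, sum_inner_sphere_sq, one_mul]
    rw [integral_nsurf_inner_sq, norm_e0, one_pow]
  have h2 := stdB.sum_sq_norm_inner_right e0
  simp only [integral_nsurf_inner_sq_mul_sq_aux, stdB.norm_eq_one, norm_e0, one_pow, one_mul,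
    ← Finset.sum_mul, ← Finset.sum_div, Finset.sum_add_distrib, ← Finset.mul_sum] at h
  simp only [Real.norm_eq_abs, sq_abs, norm_e0, one_pow] at h2
  rw [h2] at h
  simp only [Finset.sum_const, Finset.card_univ, Fintype.card_fin, nsmul_eq_mul] at h
  push_cast at h
  linarith

lemma integral_nsurf_inner_sq_mul_sq (x y : V) :
    ∫ ω, inner ℝ (ω : V) x ^ 2 * inner ℝ (ω : V) y ^ 2 ∂nsurf =
      (‖x‖ ^ 2 * ‖y‖ ^ 2 + 2 * inner ℝ x y ^ 2) / 15 := by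
  rw [integral_nsurf_inner_sq_mul_sq_aux, integral_nsurf_inner_e0_pow_four]; ring

lemma integral_nsurf_inner_pow_four (x : V) :
    ∫ ω, inner ℝ (ω : V) x ^ 4 ∂nsurf = ‖x‖ ^ 4 / 5 := by
  rw [integral_nsurf_inner_pow, integral_nsurf_inner_e0_pow_four]; ring

lemma integral_nsurf_inner_mul (x y : V) :
    ∫ ω, inner ℝ (ω : V) x * inner ℝ (ω : V) y ∂nsurf = inner ℝ x y / 3 := by
  have i2 : ∀ z : V, Integrable (fun ω : S2 => inner ℝ (ω : V) z ^ 2) nsurf := fun z =>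
    integrable_nsurf ((continuous_inner_sphere z).pow 2)
  have h : ∀ ω : S2, inner ℝ (ω : V) x * inner ℝ (ω : V) y =
      1 / 4 * (inner ℝ (ω : V) (x + y) ^ 2 - inner ℝ (ω : V) (x - y) ^ 2) := fun ω => by
    rw [inner_add_right, inner_sub_right]; ring
  simp only [h]
  rw [integral_const_mul, integral_sub (i2 _) (i2 _), integral_nsurf_inner_sq,
    integral_nsurf_inner_sq, norm_add_sq_real, norm_sub_sq_real]
  ring

/-! ### Contraction properties of the averaging operator on generating functions. -/

/-- The component of `ξ` along `ω`. -/
def par (ω : S2) (ξ : V) : V := inner ℝ (ω : V) ξ • (ω : V)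

/-- The component of `ξ` orthogonal to `ω`. -/
def perp (ω : S2) (ξ : V) : V := ξ - inner ℝ (ω : V) ξ • (ω : V)

lemma continuous_par (ξ : V) : Continuous fun ω : S2 => par ω ξ := by unfold par; fun_prop

lemma continuous_perp (ξ : V) : Continuous fun ω : S2 => perp ω ξ := by unfold perp; fun_prop

lemma norm_sq_par (ω : S2) (ξ : V) : ‖par ω ξ‖ ^ 2 = inner ℝ (ω : V) ξ ^ 2 := by
  rw [par, norm_smul, norm_sphere, mul_one, Real.norm_eq_abs, sq_abs]

lemma norm_sq_perp (ω : S2) (ξ : V) : ‖perp ω ξ‖ ^ 2 = ‖ξ‖ ^ 2 - inner ℝ (ω : V) ξ ^ 2 := by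
  rw [perp, norm_sub_sq_real, norm_smul, norm_sphere, inner_smul_right, real_inner_comm, mul_one,
    Real.norm_eq_abs, sq_abs]
  ring

lemma norm_par_le (ω : S2) (ξ : V) : ‖par ω ξ‖ ≤ ‖ξ‖ :=
  (sq_le_sq₀ (norm_nonneg _) (norm_nonneg _)).1
    ((norm_sq_par ω ξ).trans_le (inner_sphere_sq_le ω ξ))

lemma norm_perp_le (ω : S2) (ξ : V) : ‖perp ω ξ‖ ≤ ‖ξ‖ :=
  (sq_le_sq₀ (norm_nonneg _) (norm_nonneg _)).1
    ((norm_sq_perp ω ξ).trans_le (sub_le_self _ (sq_nonneg _)))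

/-- The action of the Maxwellian gain operator on generating functions. -/
def gainGen (F : V → ℝ) (ξ : V) : ℝ := ∫ ω, (F (perp ω ξ) + F (par ω ξ)) ∂nsurf

/-- With s = |ξ| and t = ω·ξ, the inequality 2sa ≤ s² + a² bounds s(|ξ_⊥|³ + |ξ_∥|³) by s⁴ - s²t² +
t⁴, whose mean is (1 - 1/3 + 1/5)s⁴. The gain is that 13/15 < 1 at order three. -/
lemma integral_norm_cube_le (ξ : V) :
    ∫ ω, (‖perp ω ξ‖ ^ 3 + ‖par ω ξ‖ ^ 3) ∂nsurf ≤ 13 / 15 * ‖ξ‖ ^ 3 := by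
  rcases eq_or_ne ξ 0 with rfl | hξ
  · simp [perp, par]
  have hpos : 0 < ‖ξ‖ := norm_pos_iff.2 hξ
  set s := ‖ξ‖ with hs
  have i2 : Integrable (fun ω : S2 => inner ℝ (ω : V) ξ ^ 2) nsurf :=
    integrable_nsurf ((continuous_inner_sphere ξ).pow 2)
  have i4 : Integrable (fun ω : S2 => inner ℝ (ω : V) ξ ^ 4) nsurf :=
    integrable_nsurf ((continuous_inner_sphere ξ).pow 4)
  have h : ∫ ω, s * (‖perp ω ξ‖ ^ 3 + ‖par ω ξ‖ ^ 3) ∂nsurf ≤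
      ∫ ω : S2, (s ^ 4 - s ^ 2 * inner ℝ (ω : V) ξ ^ 2 + inner ℝ (ω : V) ξ ^ 4) ∂nsurf := by
    refine integral_mono (integrable_nsurf ?_) (((integrable_const _).sub (i2.const_mul _)).add i4)
      fun ω => ?_
    · have h1 := continuous_par ξ
      have h2 := continuous_perp ξ
      fun_prop
    · have h1 := norm_sq_par ω ξ
      have h2 := norm_sq_perp ω ξ
      rw [← hs] at h2
      simp only
      set a := ‖par ω ξ‖
      set b := ‖perp ω ξ‖
      have ha : s * a ≤ (s ^ 2 + a ^ 2) / 2 := by nlinarith [sq_nonneg (s - a)]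
      have hb : s * b ≤ (s ^ 2 + b ^ 2) / 2 := by nlinarith [sq_nonneg (s - b)]
      calc s * (b ^ 3 + a ^ 3) = b ^ 2 * (s * b) + a ^ 2 * (s * a) := by ring
        _ ≤ b ^ 2 * ((s ^ 2 + b ^ 2) / 2) + a ^ 2 * ((s ^ 2 + a ^ 2) / 2) := by gcongr
        _ = _ := by rw [h2, h1]; ring
  have i5 : Integrable (fun ω : S2 => s ^ 4 - s ^ 2 * inner ℝ (ω : V) ξ ^ 2) nsurf :=
    (integrable_const _).sub (i2.const_mul _)
  rw [integral_const_mul, integral_add i5 i4,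
    integral_sub (integrable_const _) (i2.const_mul _), integral_const_mul,
    integral_nsurf_inner_sq, integral_nsurf_inner_pow_four, integral_const, probReal_univ,
    one_smul, ← hs] at h
  refine le_of_mul_le_mul_left (h.trans_eq ?_) hpos
  ring

lemma gainGen_bound {F q : V → ℝ} (hF : Continuous F) (hq : Continuous q)
    (hΓq : ∀ ξ, gainGen q ξ = 3 / 5 * q ξ) {r R N : ℝ}
    (h : ∀ ξ, ‖ξ‖ ≤ R → |F ξ - r * q ξ| ≤ N * ‖ξ‖ ^ 3) {ξ : V} (hξ : ‖ξ‖ ≤ R) (hN : 0 ≤ N) :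
    |gainGen F ξ - 3 / 5 * r * q ξ| ≤ 13 / 15 * N * ‖ξ‖ ^ 3 := by
  have h1 := continuous_par ξ
  have h2 := continuous_perp ξ
  have iF : Integrable (fun ω => F (perp ω ξ) + F (par ω ξ)) nsurf :=
    integrable_nsurf (by fun_prop)
  have iq : Integrable (fun ω => q (perp ω ξ) + q (par ω ξ)) nsurf :=
    integrable_nsurf (by fun_prop)
  have ib : Integrable (fun ω => N * (‖perp ω ξ‖ ^ 3 + ‖par ω ξ‖ ^ 3)) nsurf :=
    integrable_nsurf (by fun_prop)
  have e : gainGen F ξ - 3 / 5 * r * q ξ = ∫ ω, ((F (perp ω ξ) + F (par ω ξ)) -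
      r * (q (perp ω ξ) + q (par ω ξ))) ∂nsurf := by
    rw [integral_sub iF (iq.const_mul r), integral_const_mul]
    have := hΓq ξ
    rw [gainGen] at this
    rw [this, gainGen]; ring
  rw [e]
  calc _ ≤ ∫ ω, N * (‖perp ω ξ‖ ^ 3 + ‖par ω ξ‖ ^ 3) ∂nsurf := by
        refine abs_integral_le_integral_abs.trans
          (integral_mono (iF.sub (iq.const_mul r)).abs ib fun ω => ?_)
        have a1 := h _ ((norm_perp_le ω ξ).trans hξ)
        have a2 := h _ ((norm_par_le ω ξ).trans hξ)
        simp only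
        calc _ = |(F (perp ω ξ) - r * q (perp ω ξ)) + (F (par ω ξ) - r * q (par ω ξ))| := by
              congr 1; ring
          _ ≤ _ := (abs_add_le _ _).trans (by linarith)
    _ ≤ N * (13 / 15 * ‖ξ‖ ^ 3) := by
        rw [integral_const_mul]
        exact mul_le_mul_of_nonneg_left (integral_norm_cube_le ξ) hN
    _ = _ := by ring

/-- Both components of ξ have norm at most |ξ|, so the estimate on a fixed ball reproduces itself,
the quadratic part and the cubic remainder contracting at their own rates. -/
lemma gainGen_iterate_bound {F : ℕ → V → ℝ} {q : V → ℝ} (hF : ∀ k, Continuous (F k))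
    (hq : Continuous q) (hΓF : ∀ k ξ, F (k + 1) ξ = gainGen (F k) ξ)
    (hΓq : ∀ ξ, gainGen q ξ = 3 / 5 * q ξ) {R N : ℝ} (hN : 0 ≤ N)
    (h : ∀ ξ, ‖ξ‖ ≤ R → |F 0 ξ - q ξ| ≤ N * ‖ξ‖ ^ 3) (k : ℕ) :
    ∀ ξ, ‖ξ‖ ≤ R → |F k ξ - (3 / 5) ^ k * q ξ| ≤ (13 / 15) ^ k * N * ‖ξ‖ ^ 3 := by
  induction k with
  | zero => simpa using h
  | succ k ih =>
    intro ξ hξ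
    rw [hΓF, pow_succ', pow_succ', mul_assoc (13 / 15 : ℝ)]
    exact gainGen_bound (hF k) hq hΓq ih hξ (by positivity)

/-! ### The Gaussian probability measure -/

/-- The normalization constant of the Gaussian. -/
def gamZ : ℝ := ∫ v : V, maxw v

lemma integrable_maxw : Integrable maxw := by simpa using integrable_pow_mul_maxw 0

lemma gamZ_pos : 0 < gamZ := by
  rw [gamZ, integral_pos_iff_support_of_nonneg (fun v => (maxw_pos v).le) integrable_maxw]
  have : Function.support maxw = Set.univ := by
    ext v; simp [(maxw_pos v).ne']
  rw [this]
  exact isOpen_univ.measure_pos _ Set.univ_nonempty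

/-- The density of the Gaussian. -/
def gamD (v : V) : ENNReal := ENNReal.ofReal (gamZ⁻¹ * maxw v)

lemma measurable_gamD : Measurable gamD :=
  (continuous_maxw.measurable.const_mul _).ennreal_ofReal

/-- The Gaussian probability measure with density proportional to `exp (-|v|²)`. -/
def gam : Measure V := volume.withDensity gamD

lemma gamD_toReal (v : V) : (gamD v).toReal = gamZ⁻¹ * maxw v :=
  ENNReal.toReal_ofReal (mul_nonneg (inv_nonneg.2 gamZ_pos.le) (maxw_pos v).le)

lemma integral_gam (φ : V → ℝ) : ∫ v, φ v ∂gam = gamZ⁻¹ * ∫ v, φ v * maxw v := by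
  rw [gam, integral_withDensity_eq_integral_toReal_smul measurable_gamD
    (Filter.Eventually.of_forall fun v => ENNReal.ofReal_lt_top), ← integral_const_mul]
  refine integral_congr_ae (Filter.Eventually.of_forall fun v => ?_)
  simp only [gamD_toReal, smul_eq_mul]; ring

lemma integrable_gam_iff {φ : V → ℝ} :
    Integrable φ gam ↔ Integrable (fun v => φ v * maxw v) := by
  rw [gam, integrable_withDensity_iff_integrable_smul' measurable_gamD
    (Filter.Eventually.of_forall fun v => ENNReal.ofReal_lt_top)]
  have hz := gamZ_pos
  have e : (fun v => (gamD v).toReal • φ v) = fun v => gamZ⁻¹ * (φ v * maxw v) := by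
    funext v; simp only [gamD_toReal, smul_eq_mul]; ring
  rw [e, integrable_const_mul_iff (IsUnit.mk0 _ (by positivity))]

instance isProbabilityMeasure_gam : IsProbabilityMeasure gam := by
  constructor
  rw [gam, withDensity_apply _ MeasurableSet.univ, Measure.restrict_univ]
  simp only [gamD]
  rw [← ofReal_integral_eq_lintegral_ofReal (integrable_maxw.const_mul _)
    (Filter.Eventually.of_forall fun v =>
      mul_nonneg (inv_nonneg.2 gamZ_pos.le) (maxw_pos v).le), integral_const_mul]
  change ENNReal.ofReal (gamZ⁻¹ * gamZ) = 1
  rw [inv_mul_cancel₀ gamZ_pos.ne', ENNReal.ofReal_one]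

lemma gam_absolutelyContinuous : gam ≪ volume := withDensity_absolutelyContinuous _ _

/-- The product Gaussian density is a function of |u|² + |v|², which collisions conserve. -/
lemma measurePreserving_collideLin_gam (ω : S2) :
    MeasurePreserving (collideLin ω) (gam.prod gam) (gam.prod gam) := by
  have : SFinite gam := inferInstance
  have e : gam.prod gam = ((volume : Measure V).prod (volume : Measure V)).withDensity
      fun z => gamD z.1 * gamD z.2 := prod_withDensity measurable_gamD measurable_gamD
  rw [e]
  refine measurePreserving_withDensity (measurePreserving_collideLin ω)
    ((measurable_gamD.comp measurable_fst).mul (measurable_gamD.comp measurable_snd)) fun z => ?_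
  have hz := inv_nonneg.2 gamZ_pos.le
  simp only [gamD, collideLin, LinearMap.coe_mk, AddHom.coe_mk]
  rw [← ENNReal.ofReal_mul (mul_nonneg hz (maxw_pos _).le),
    ← ENNReal.ofReal_mul (mul_nonneg hz (maxw_pos _).le)]
  congr 1
  have := maxw_post z.2 z.1 ω
  linear_combination gamZ⁻¹ ^ 2 * this

/-- The probability measure `γ ⊗ γ ⊗ ω̄` on `X`. -/
abbrev gamX : Measure X := gam.prod (gam.prod nsurf)

lemma measurePreserving_collide_gam : MeasurePreserving collide gamX gamX :=
  measurePreserving_collide_of measurePreserving_collideLin_gam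

lemma measurePreserving_exch_gam : MeasurePreserving exch gamX gamX := measurePreserving_exch_of

lemma measurePreserving_fst_gam : MeasurePreserving (Prod.fst : X → V) gamX gam :=
  measurePreserving_fst

/-- Placing ω outermost leaves, for fixed ω, a product measure in (v, u), on which products of
functions of v and of u factor. -/
lemma integral_gamX {H : X → ℝ} (hH : Integrable H gamX) :
    ∫ p, H p ∂gamX = ∫ ω, ∫ z : V × V, H (z.1, (z.2, ω)) ∂(gam.prod gam) ∂nsurf := by
  have e1 : MeasurePreserving (MeasurableEquiv.prodAssoc : (V × V) × S2 ≃ᵐ X)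
      ((gam.prod gam).prod nsurf) gamX := measurePreserving_prodAssoc gam gam nsurf
  have h1 := e1.integral_comp (MeasurableEquiv.measurableEmbedding _) H
  have h2 := e1.integrable_comp_of_integrable hH
  rw [← h1]
  exact integral_prod_symm _ h2

lemma integrable_exp_mul_norm (a : ℝ) : Integrable (fun v : V => Real.exp (a * ‖v‖)) gam := by
  rw [integrable_gam_iff]
  refine ((integrable_gauss (b := 1 / 2) (by norm_num)).const_mul (Real.exp (a ^ 2 / 2))).mono'
    ((by fun_prop : Continuous fun v : V => Real.exp (a * ‖v‖)).mul
      continuous_maxw).aestronglyMeasurable (Filter.Eventually.of_forall fun v => ?_)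
  have := maxw_pos v
  rw [Real.norm_of_nonneg (by positivity), maxw, ← Real.exp_add, ← Real.exp_add]
  refine Real.exp_le_exp.2 ?_
  nlinarith [sq_nonneg (a - ‖v‖)]

lemma memLp_gam_of_le {g : V → ℝ} (hg : AEStronglyMeasurable g gam) {C a : ℝ}
    (h : ∀ v, |g v| ≤ C * Real.exp (a * ‖v‖)) : MemLp g 2 gam := by
  rw [memLp_two_iff_integrable_sq hg]
  refine ((integrable_exp_mul_norm (2 * a)).const_mul (C ^ 2)).mono' (hg.pow 2)
    (Filter.Eventually.of_forall fun v => ?_)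
  rw [Real.norm_of_nonneg (sq_nonneg _)]
  calc g v ^ 2 = |g v| ^ 2 := (sq_abs _).symm
    _ ≤ (C * Real.exp (a * ‖v‖)) ^ 2 := pow_le_pow_left₀ (abs_nonneg _) (h v) 2
    _ = _ := by rw [mul_pow, ← Real.exp_nat_mul]; congr 2; push_cast; ring

/-- The normalized exponential `exp (2 ξ·v - |ξ|²)`. -/
def expF (ξ v : V) : ℝ := Real.exp (2 * inner ℝ ξ v - ‖ξ‖ ^ 2)

lemma continuous_expF (ξ : V) : Continuous (expF ξ) := by unfold expF; fun_prop

lemma memLp_expF (ξ : V) : MemLp (expF ξ) 2 gam := by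
  refine memLp_gam_of_le (continuous_expF ξ).aestronglyMeasurable (C := 1) (a := 2 * ‖ξ‖)
    fun v => ?_
  rw [expF, abs_of_pos (Real.exp_pos _), one_mul]
  refine Real.exp_le_exp.2 ?_
  nlinarith [real_inner_le_norm ξ v, sq_nonneg ‖ξ‖]

lemma integral_expF_mul_expF (ξ ζ : V) :
    ∫ v, expF ξ v * expF ζ v ∂gam = Real.exp (2 * inner ℝ ξ ζ) := by
  have e : ∀ v, expF ξ v * expF ζ v * maxw v =
      Real.exp (2 * inner ℝ ξ ζ) * maxw (v - (ξ + ζ)) := fun v => by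
    simp only [expF, maxw, ← Real.exp_add]
    congr 1
    rw [norm_sub_sq_real, norm_add_sq_real, inner_add_right, real_inner_comm v ξ,
      real_inner_comm v ζ]
    ring
  rw [integral_gam]
  simp only [e]
  rw [integral_const_mul, integral_sub_right_eq_self maxw]
  change gamZ⁻¹ * (_ * gamZ) = _
  have := gamZ_pos.ne'
  field_simp

lemma integral_expF (ξ : V) : ∫ v, expF ξ v ∂gam = 1 := by
  have := integral_expF_mul_expF ξ 0
  simpa [expF] using this

/-- Since ξ·v' = ξ_⊥·v + ξ_∥·u and |ξ|² = |ξ_⊥|² + |ξ_∥|², exponentials factor under a collision.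
This is why generating functions linearize the gain operator. -/
lemma expF_vPost (ξ u v : V) (ω : S2) :
    expF ξ (vPost u v ω) = expF (perp ω ξ) v * expF (par ω ξ) u := by
  simp only [expF, ← Real.exp_add]
  rw [norm_sq_par, norm_sq_perp]
  congr 1
  simp only [vPost, perp, par, inner_sub_right, inner_sub_left, inner_smul_right,
    real_inner_smul_left, real_inner_comm ξ (ω : V)]
  ring

lemma expF_uPost (ξ u v : V) (ω : S2) :
    expF ξ (uPost u v ω) = expF (perp ω ξ) u * expF (par ω ξ) v := by
  rw [← vPost_swap, expF_vPost]

/-! ### Collision operators on `L²` of the Gaussian -/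

/-- `L²(γ)`. -/
abbrev L2g : Type := Lp ℝ 2 gam

/-- `L²` of `γ ⊗ γ ⊗ ω̄`. -/
abbrev L2X : Type := Lp ℝ 2 gamX

lemma inner_toLp {α : Type*} [MeasurableSpace α] {κ : Measure α} {f g : α → ℝ}
    (hf : MemLp f 2 κ) (hg : MemLp g 2 κ) :
    inner ℝ (hf.toLp f) (hg.toLp g) = ∫ x, f x * g x ∂κ := by
  rw [L2.inner_def]
  refine integral_congr_ae ?_
  filter_upwards [hf.coeFn_toLp, hg.coeFn_toLp] with x h1 h2
  rw [h1, h2]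
  simp [mul_comm]

/-- Evaluation at the first component after the measure preserving map `T`. -/
def ev {T : X → X} (hT : MeasurePreserving T gamX gamX) : L2g →L[ℝ] L2X :=
  (Lp.compMeasurePreservingₗᵢ ℝ (fun p => (T p).1)
    (measurePreserving_fst_gam.comp hT)).toContinuousLinearMap

lemma ev_coeFn {T : X → X} (hT : MeasurePreserving T gamX gamX) (f : L2g) :
    ev hT f =ᵐ[gamX] fun p => f (T p).1 :=
  Lp.coeFn_compMeasurePreserving f (measurePreserving_fst_gam.comp hT)

lemma norm_ev {T : X → X} (hT : MeasurePreserving T gamX gamX) (f : L2g) : ‖ev hT f‖ = ‖f‖ :=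
  Lp.norm_compMeasurePreserving f (measurePreserving_fst_gam.comp hT)

lemma inner_ev {T S : X → X} (hT : MeasurePreserving T gamX gamX)
    (hS : MeasurePreserving S gamX gamX) (f g : L2g) :
    inner ℝ (ev hT f) (ev hS g) = ∫ p, f (T p).1 * g (S p).1 ∂gamX := by
  rw [L2.inner_def]
  refine integral_congr_ae ?_
  filter_upwards [ev_coeFn hT f, ev_coeFn hS g] with x h1 h2
  rw [h1, h2]
  simp [mul_comm]

lemma measurePreserving_id_gam : MeasurePreserving (id : X → X) gamX gamX := MeasurePreserving.id _

lemma measurePreserving_collideExch_gam : MeasurePreserving collideExch gamX gamX :=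
  measurePreserving_collide_gam.comp measurePreserving_exch_gam

/-- Change of variables by the involution `T`; this is the source of the symmetry of `gainOp`. -/
lemma inner_ev_swap {T : X → X} (hT : MeasurePreserving T gamX gamX) (hTT : ∀ p, T (T p) = p)
    (f g : L2g) :
    inner ℝ (ev hT f) (ev measurePreserving_id_gam g) =
      inner ℝ (ev measurePreserving_id_gam f) (ev hT g) := by
  rw [inner_ev, inner_ev,
    ← involutive_integral_comp hT hTT fun p => f (T p).1 * g (id p).1]
  simp only [hTT, id]

/-- The two gain terms `f(v') + f(u')`. -/
def gainEv : L2g →L[ℝ] L2X :=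
  ev measurePreserving_collide_gam + ev measurePreserving_collideExch_gam

/-- The Maxwellian gain operator. -/
def gainOp : L2g →L[ℝ] L2g :=
  (ContinuousLinearMap.adjoint (ev measurePreserving_id_gam)).comp gainEv

lemma inner_gainOp (f g : L2g) :
    inner ℝ (gainOp f) g = inner ℝ (gainEv f) (ev measurePreserving_id_gam g) := by
  rw [gainOp, ContinuousLinearMap.comp_apply, ContinuousLinearMap.adjoint_inner_left]

lemma inner_gainOp' (f g : L2g) :
    inner ℝ (gainOp f) g = inner ℝ (ev measurePreserving_id_gam f) (gainEv g) := by
  rw [inner_gainOp, gainEv, add_apply, add_apply,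
    inner_add_left, inner_add_right, inner_ev_swap _ collide_collide,
    inner_ev_swap _ collideExch_collideExch]

lemma gainOp_symm (f g : L2g) : inner ℝ (gainOp f) g = inner ℝ f (gainOp g) := by
  rw [inner_gainOp', real_inner_comm (gainOp g) f, inner_gainOp, real_inner_comm]

/-- The class of the exponential `exp (2 ξ·v - |ξ|²)`. -/
def expL (ξ : V) : L2g := (memLp_expF ξ).toLp (expF ξ)

/-- The generating function of `f`. -/
def gen (f : L2g) (ξ : V) : ℝ := inner ℝ f (expL ξ)

lemma gen_eq (f : L2g) (ξ : V) : gen f ξ = ∫ v, f v * expF ξ v ∂gam := by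
  have h := inner_toLp (Lp.memLp f) (memLp_expF ξ)
  rwa [Lp.toLp_coeFn] at h

lemma inner_expL (ξ ζ : V) : inner ℝ (expL ξ) (expL ζ) = Real.exp (2 * inner ℝ ξ ζ) := by
  rw [expL, expL, inner_toLp, integral_expF_mul_expF]

lemma continuous_expL : Continuous expL := by
  rw [continuous_iff_continuousAt]
  intro ξ
  rw [ContinuousAt, tendsto_iff_norm_sub_tendsto_zero]
  have h : ∀ ζ, ‖expL ζ - expL ξ‖ = √(Real.exp (2 * inner ℝ ζ ζ) -
      2 * Real.exp (2 * inner ℝ ζ ξ) + Real.exp (2 * inner ℝ ξ ξ)) := fun ζ => by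
    rw [← inner_expL, ← inner_expL, ← inner_expL, real_inner_self_eq_norm_sq,
      real_inner_self_eq_norm_sq, ← norm_sub_sq_real, Real.sqrt_sq (norm_nonneg _)]
  simp only [h]
  have hc : Continuous fun ζ : V => √(Real.exp (2 * inner ℝ ζ ζ) -
      2 * Real.exp (2 * inner ℝ ζ ξ) + Real.exp (2 * inner ℝ ξ ξ)) := by fun_prop
  have := hc.tendsto ξ
  convert this using 2
  rw [eq_comm, Real.sqrt_eq_zero']
  linarith

lemma continuous_gen (f : L2g) : Continuous (gen f) := continuous_const.inner continuous_expL

lemma memLp_comp_gamX {T : X → X} (hT : MeasurePreserving T gamX gamX) {g : V → ℝ}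
    (hg : MemLp g 2 gam) : MemLp (fun p => g (T p).1) 2 gamX :=
  hg.comp_measurePreserving (measurePreserving_fst_gam.comp hT)

lemma inner_gainOp_toLp (f : L2g) {g : V → ℝ} (hg : MemLp g 2 gam) :
    inner ℝ (gainOp f) (hg.toLp g) =
      ∫ p : X, f p.1 * (g (collide p).1 + g (collideExch p).1) ∂gamX := by
  have h1 := memLp_comp_gamX measurePreserving_collide_gam hg
  have h2 := memLp_comp_gamX measurePreserving_collideExch_gam hg
  rw [inner_gainOp', L2.inner_def]
  have hE : gainEv (hg.toLp g) = h1.toLp _ + h2.toLp _ := rfl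
  refine integral_congr_ae ?_
  rw [hE]
  filter_upwards [ev_coeFn measurePreserving_id_gam f, Lp.coeFn_add (h1.toLp _) (h2.toLp _),
    h1.coeFn_toLp, h2.coeFn_toLp] with p a1 a2 a3 a4
  rw [a1, a2, Pi.add_apply, a3, a4]
  simp [mul_comm]

/-- By symmetry the operator is moved onto the exponential, which factors; the factor in u has
Gaussian mean 1. -/
lemma gen_gainOp (f : L2g) (ξ : V) : gen (gainOp f) ξ = gainGen (gen f) ξ := by
  have hf := Lp.memLp f
  have i1 : ∀ ζ, Integrable (fun v => f v * expF ζ v) gam := fun ζ =>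
    hf.integrable_mul (memLp_expF ζ)
  have i2 : ∀ ζ, Integrable (expF ζ) gam := fun ζ => (memLp_expF ζ).integrable one_le_two
  have hfX := memLp_comp_gamX measurePreserving_id_gam hf
  have h1 := memLp_comp_gamX measurePreserving_collide_gam (memLp_expF ξ)
  have h2 := memLp_comp_gamX measurePreserving_collideExch_gam (memLp_expF ξ)
  have key : gen (gainOp f) ξ = ∫ p : X, f p.1 * (expF ξ (collide p).1 +
      expF ξ (collideExch p).1) ∂gamX := inner_gainOp_toLp f (memLp_expF ξ)
  have hint : Integrable (fun p : X => f p.1 * (expF ξ (collide p).1 +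
      expF ξ (collideExch p).1)) gamX := hfX.integrable_mul (h1.add h2)
  rw [key, integral_gamX hint, gainGen]
  refine integral_congr_ae (Filter.Eventually.of_forall fun ω => ?_)
  simp only [collideExch_eq, collide, expF_vPost, expF_uPost]
  have e1 : ∀ z : V × V, f z.1 * (expF (perp ω ξ) z.1 * expF (par ω ξ) z.2 +
      expF (perp ω ξ) z.2 * expF (par ω ξ) z.1) =
      (f z.1 * expF (perp ω ξ) z.1) * expF (par ω ξ) z.2 +
        (f z.1 * expF (par ω ξ) z.1) * expF (perp ω ξ) z.2 := fun z => by ring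
  simp only [e1]
  have e2 := integral_add ((i1 (perp ω ξ)).mul_prod (i2 (par ω ξ)))
    ((i1 (par ω ξ)).mul_prod (i2 (perp ω ξ)))
  rw [e2, integral_prod_mul (fun v => f v * expF (perp ω ξ) v) (expF (par ω ξ)),
    integral_prod_mul (fun v => f v * expF (par ω ξ) v) (expF (perp ω ξ)), integral_expF,
    integral_expF, mul_one, mul_one, gen_eq, gen_eq]

/-! ### Totality of the exponentials -/

/-- The positive and negative parts of f define finite measures with equal Laplace transforms
everywhere. Analytic continuation to the imaginary axis equates their characteristic functions, so
the measures coincide and f⁺ = f⁻. -/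
lemma ae_zero_of_integral_exp_eq_zero {f : V → ℝ} (hf : MemLp f 2 gam)
    (h : ∀ ξ : V, ∫ v, f v * Real.exp (inner ℝ v ξ) ∂gam = 0) : f =ᵐ[gam] 0 := by
  have hexp : ∀ ξ : V, MemLp (fun v => Real.exp (inner ℝ v ξ)) 2 gam := fun ξ =>
    memLp_gam_of_le (by fun_prop : Continuous fun v : V => Real.exp (inner ℝ v ξ)).aestronglyMeasurable
      (C := 1) (a := ‖ξ‖) fun v => by
        rw [abs_of_pos (Real.exp_pos _), one_mul]
        exact Real.exp_le_exp.2 ((real_inner_le_norm v ξ).trans_eq (mul_comm _ _))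
  have hfi : Integrable f gam := hf.integrable one_le_two
  have hm1 : AEMeasurable (fun v => ENNReal.ofReal (f v)) gam := hf.1.aemeasurable.ennreal_ofReal
  have hm2 : AEMeasurable (fun v => ENNReal.ofReal (-f v)) gam :=
    hf.1.aemeasurable.neg.ennreal_ofReal
  set μ₁ := gam.withDensity fun v => ENNReal.ofReal (f v) with hμ₁
  set μ₂ := gam.withDensity fun v => ENNReal.ofReal (-f v) with hμ₂
  have f1 : IsFiniteMeasure μ₁ := isFiniteMeasure_withDensity_ofReal hfi.2
  have f2 : IsFiniteMeasure μ₂ := isFiniteMeasure_withDensity_ofReal hfi.neg.2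
  have hfin1 : ∀ᵐ v ∂gam, ENNReal.ofReal (f v) < ⊤ := Filter.Eventually.of_forall fun v =>
    ENNReal.ofReal_lt_top
  have hfin2 : ∀ᵐ v ∂gam, ENNReal.ofReal (-f v) < ⊤ := Filter.Eventually.of_forall fun v =>
    ENNReal.ofReal_lt_top
  have ip : ∀ ξ : V, Integrable (fun v => f v * Real.exp (inner ℝ v ξ)) gam := fun ξ =>
    hf.integrable_mul (hexp ξ)
  have ie1 : ∀ ξ : V, Integrable (fun v => Real.exp (inner ℝ v ξ)) μ₁ := fun ξ => by
    rw [hμ₁, integrable_withDensity_iff_integrable_smul₀' hm1 hfin1]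
    refine (ip ξ).mono (hm1.ennreal_toReal.aestronglyMeasurable.smul (hexp ξ).1)
      (Filter.Eventually.of_forall fun v => ?_)
    rw [ENNReal.toReal_ofReal', smul_eq_mul, norm_mul, norm_mul]
    gcongr
    rw [Real.norm_of_nonneg (le_max_right _ _)]
    exact max_le (le_abs_self _) (abs_nonneg _)
  have ie2 : ∀ ξ : V, Integrable (fun v => Real.exp (inner ℝ v ξ)) μ₂ := fun ξ => by
    rw [hμ₂, integrable_withDensity_iff_integrable_smul₀' hm2 hfin2]
    refine (ip ξ).mono (hm2.ennreal_toReal.aestronglyMeasurable.smul (hexp ξ).1)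
      (Filter.Eventually.of_forall fun v => ?_)
    rw [ENNReal.toReal_ofReal', smul_eq_mul, norm_mul, norm_mul]
    gcongr
    rw [Real.norm_of_nonneg (le_max_right _ _)]
    exact max_le (neg_le_abs _) (abs_nonneg _)
  have heq : ∀ ξ : V, ∫ v, Real.exp (inner ℝ v ξ) ∂μ₁ = ∫ v, Real.exp (inner ℝ v ξ) ∂μ₂ :=
    fun ξ => by
      have j1 := (integrable_withDensity_iff_integrable_smul₀' hm1 hfin1).1 (ie1 ξ)
      have j2 := (integrable_withDensity_iff_integrable_smul₀' hm2 hfin2).1 (ie2 ξ)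
      rw [← sub_eq_zero, hμ₁, hμ₂, integral_withDensity_eq_integral_toReal_smul₀ hm1 hfin1,
        integral_withDensity_eq_integral_toReal_smul₀ hm2 hfin2, ← integral_sub j1 j2, ← h ξ]
      refine integral_congr_ae (Filter.Eventually.of_forall fun v => ?_)
      simp only [ENNReal.toReal_ofReal', smul_eq_mul, ← sub_mul]
      rcases le_total 0 (f v) with hv | hv
      · rw [max_eq_left hv, max_eq_right (by linarith), sub_zero]
      · rw [max_eq_right hv, max_eq_left (by linarith), zero_sub, neg_neg]
  have hzero : μ₁ = 0 ↔ μ₂ = 0 := by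
    have h0 := heq 0
    simp only [inner_zero_right, Real.exp_zero, integral_const, smul_eq_mul, mul_one] at h0
    rw [← Measure.measure_univ_eq_zero, ← Measure.measure_univ_eq_zero,
      ← measureReal_eq_zero_iff, ← measureReal_eq_zero_iff, h0]
  have hμ : μ₁ = μ₂ := by
    refine Measure.ext_of_charFun (funext fun ξ => ?_)
    have hmgf : ProbabilityTheory.mgf (fun v : V => inner ℝ v ξ) μ₁ =
        ProbabilityTheory.mgf (fun v : V => inner ℝ v ξ) μ₂ := by
      funext t
      have := heq (t • ξ)
      simpa only [ProbabilityTheory.mgf, inner_smul_right] using this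
    have hset : ProbabilityTheory.integrableExpSet (fun v : V => inner ℝ v ξ) μ₁ = Set.univ := by
      ext t
      simp only [ProbabilityTheory.integrableExpSet, Set.mem_ofPred_eq, Set.mem_univ, iff_true]
      simpa only [inner_smul_right] using ie1 (t • ξ)
    have := ProbabilityTheory.eqOn_complexMGF_of_mgf' hmgf hzero (x := Complex.I)
      (by simp [hset])
    simp only [charFun_apply]
    simp only [ProbabilityTheory.complexMGF, mul_comm Complex.I] at this
    exact this
  rw [hμ₁, hμ₂, withDensity_eq_iff hm1 hm2 hfi.lintegral_lt_top.ne] at hμ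
  filter_upwards [hμ] with v hv
  have hv' := congrArg ENNReal.toReal hv
  rw [ENNReal.toReal_ofReal', ENNReal.toReal_ofReal'] at hv'
  rcases le_total 0 (f v) with h0 | h0
  · rw [max_eq_left h0, max_eq_right (by linarith)] at hv'; exact hv'
  · rw [max_eq_right h0, max_eq_left (by linarith)] at hv'
    simp only [Pi.zero_apply]; linarith

lemma topologicalClosure_span_expL :
    (Submodule.span ℝ (Set.range expL)).topologicalClosure = ⊤ := by
  rw [Submodule.topologicalClosure_eq_top_iff, Submodule.eq_bot_iff]
  intro f hf
  have h : ∀ ξ : V, ∫ v, f v * Real.exp (inner ℝ v ξ) ∂gam = 0 := fun ξ => by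
    have h1 := (Submodule.mem_orthogonal' _ _).1 hf (expL ((1 / 2 : ℝ) • ξ))
      (Submodule.subset_span ⟨_, rfl⟩)
    change gen f _ = 0 at h1
    rw [gen_eq] at h1
    have e : ∀ v, f v * expF ((1 / 2 : ℝ) • ξ) v =
        (f v * Real.exp (inner ℝ v ξ)) * Real.exp (-‖(1 / 2 : ℝ) • ξ‖ ^ 2) := fun v => by
      rw [expF, mul_assoc, ← Real.exp_add, real_inner_smul_left, real_inner_comm]
      congr 2; ring
    simp only [e] at h1
    rw [integral_mul_const] at h1
    exact (mul_eq_zero.1 h1).resolve_right (Real.exp_pos _).ne'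
  exact (Lp.eq_zero_iff_ae_eq_zero).2 (ae_zero_of_integral_exp_eq_zero (Lp.memLp f) h)

/-! ### Spectral gap of the Maxwellian gain operator -/

/-- The collision invariant `a + b·v + c |v|²`. -/
def invF (x : ℝ × V × ℝ) (v : V) : ℝ := x.1 + inner ℝ x.2.1 v + x.2.2 * ‖v‖ ^ 2

lemma continuous_invF (x : ℝ × V × ℝ) : Continuous (invF x) := by unfold invF; fun_prop

lemma abs_invF_le (x : ℝ × V × ℝ) (v : V) :
    |invF x v| ≤ (|x.1| + ‖x.2.1‖ + |x.2.2|) * (1 + ‖v‖) ^ 2 := by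
  have h1 := abs_real_inner_le_norm x.2.1 v
  have h2 := norm_nonneg v
  have h3 := norm_nonneg x.2.1
  have h4 := abs_nonneg x.1
  have h5 := abs_nonneg x.2.2
  calc |invF x v| ≤ |x.1| + ‖x.2.1‖ * ‖v‖ + |x.2.2| * ‖v‖ ^ 2 := by
        refine (abs_add_le _ _).trans (add_le_add ((abs_add_le _ _).trans
          (add_le_add le_rfl h1)) ?_)
        rw [abs_mul, abs_of_nonneg (sq_nonneg ‖v‖)]
    _ ≤ |x.1| * (1 + ‖v‖) ^ 2 + ‖x.2.1‖ * (1 + ‖v‖) ^ 2 + |x.2.2| * (1 + ‖v‖) ^ 2 := by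
        have e1 : 1 ≤ (1 + ‖v‖) ^ 2 := by nlinarith
        have e2 : ‖v‖ ≤ (1 + ‖v‖) ^ 2 := by nlinarith
        have e3 : ‖v‖ ^ 2 ≤ (1 + ‖v‖) ^ 2 := by nlinarith
        exact add_le_add (add_le_add (le_mul_of_one_le_right h4 e1)
          (mul_le_mul_of_nonneg_left e2 h3)) (mul_le_mul_of_nonneg_left e3 h5)
    _ = _ := by ring

lemma one_add_norm_sq_le (v : V) : (1 + ‖v‖) ^ 2 ≤ 2 * Real.exp (2 * ‖v‖) := by
  have h1 : 1 + ‖v‖ ≤ Real.exp ‖v‖ := by linarith [Real.add_one_le_exp ‖v‖]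
  have h2 : Real.exp (2 * ‖v‖) = Real.exp ‖v‖ ^ 2 := by rw [← Real.exp_nat_mul]; norm_num
  rw [h2]
  have := pow_le_pow_left₀ (by positivity : 0 ≤ 1 + ‖v‖) h1 2
  nlinarith [sq_nonneg (Real.exp ‖v‖)]

lemma memLp_invF (x : ℝ × V × ℝ) : MemLp (invF x) 2 gam := by
  refine memLp_gam_of_le (continuous_invF x).aestronglyMeasurable
    (C := (|x.1| + ‖x.2.1‖ + |x.2.2|) * 2) (a := 2) fun v => (abs_invF_le x v).trans ?_
  rw [mul_assoc]
  exact mul_le_mul_of_nonneg_left (one_add_norm_sq_le v) (by positivity)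

/-- The class in `L²(γ)` of a collision invariant. -/
def invL : (ℝ × V × ℝ) →ₗ[ℝ] L2g where
  toFun x := (memLp_invF x).toLp (invF x)
  map_add' x y := by
    rw [← MemLp.toLp_add]
    refine MemLp.toLp_congr _ _ (Filter.Eventually.of_forall fun v => ?_)
    simp only [invF, Pi.add_apply, Prod.fst_add, Prod.snd_add, inner_add_left]; ring
  map_smul' r x := by
    rw [RingHom.id_apply, ← MemLp.toLp_const_smul]
    refine MemLp.toLp_congr _ _ (Filter.Eventually.of_forall fun v => ?_)
    simp only [invF, Pi.smul_apply, Prod.smul_fst, Prod.smul_snd, real_inner_smul_left,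
      smul_eq_mul]
    ring

/-- The space of collision invariants in `L²(γ)`. -/
abbrev invS : Submodule ℝ L2g := LinearMap.range invL

lemma integral_mul_invF {f : L2g} (hf : f ∈ invSᗮ) (x : ℝ × V × ℝ) :
    ∫ v, f v * invF x v ∂gam = 0 := by
  have h1 := (Submodule.mem_orthogonal' _ _).1 hf (invL x) ⟨x, rfl⟩
  have h := inner_toLp (Lp.memLp f) (memLp_invF x)
  rw [Lp.toLp_coeFn] at h
  exact h.symm.trans h1

lemma integral_eq_zero_of_mem {f : L2g} (hf : f ∈ invSᗮ) : ∫ v, f v ∂gam = 0 := by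
  have := integral_mul_invF hf (1, 0, 0)
  simpa [invF] using this

lemma integral_mul_inner_of_mem {f : L2g} (hf : f ∈ invSᗮ) (ξ : V) :
    ∫ v, f v * inner ℝ ξ v ∂gam = 0 := by
  have := integral_mul_invF hf (0, ξ, 0)
  simpa [invF] using this

lemma integral_mul_norm_sq_of_mem {f : L2g} (hf : f ∈ invSᗮ) :
    ∫ v, f v * ‖v‖ ^ 2 ∂gam = 0 := by
  have := integral_mul_invF hf (0, 0, 1)
  simpa [invF] using this

lemma invF_post (x : ℝ × V × ℝ) (u v : V) (ω : S2) :
    invF x (vPost u v ω) + invF x (uPost u v ω) = invF x v + invF x u := by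
  have h1 := norm_sq_post u v ω
  have h2 : inner ℝ x.2.1 (uPost u v ω) + inner ℝ x.2.1 (vPost u v ω) =
      inner ℝ x.2.1 u + inner ℝ x.2.1 v := by
    rw [← inner_add_right, post_add, inner_add_right]
  simp only [invF]
  linear_combination x.2.2 * h1 + h2

/-- For an invariant φ, φ(v') + φ(u') = φ(v) + φ(u); pairing with f(v) gives ⟨f, φ⟩ plus the product
of the means of f and φ, both zero. -/
lemma gainOp_mem {f : L2g} (hf : f ∈ invSᗮ) : gainOp f ∈ invSᗮ := by
  rw [Submodule.mem_orthogonal']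
  rintro _ ⟨x, rfl⟩
  have hg := memLp_invF x
  have hfL := Lp.memLp f
  have i1 : Integrable (fun p : X => f p.1 * invF x p.1) gamX :=
    (memLp_comp_gamX measurePreserving_id_gam hfL).integrable_mul
      (memLp_comp_gamX measurePreserving_id_gam hg)
  have i2 : Integrable (fun p : X => f p.1 * invF x p.2.1) gamX :=
    (memLp_comp_gamX measurePreserving_id_gam hfL).integrable_mul
      (memLp_comp_gamX measurePreserving_exch_gam hg)
  have e1 : ∫ p : X, f p.1 * invF x p.1 ∂gamX = 0 := by
    rw [integral_fun_fst (fun v => f v * invF x v), integral_mul_invF hf, smul_zero]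
  have e2 : ∫ p : X, f p.1 * invF x p.2.1 ∂gamX = 0 := by
    rw [integral_prod_mul (fun v => f v) (fun y : V × S2 => invF x y.1),
      integral_eq_zero_of_mem hf, zero_mul]
  have h := inner_gainOp_toLp f hg
  rw [show invL x = hg.toLp (invF x) from rfl, h, ← add_zero (0 : ℝ)]
  nth_rewrite 1 [← e1]
  nth_rewrite 1 [← e2]
  rw [← integral_add i1 i2]
  refine integral_congr_ae (Filter.Eventually.of_forall fun p => ?_)
  simp only [collideExch_eq, collide, invF_post, mul_add]

/-! #### Second order expansion of the generating function -/

/-- The second order part of the generating function of `f ⟂ 1, v`. -/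
def genQ (f : V → ℝ) (ξ : V) : ℝ := 2 * ∫ v, f v * inner ℝ ξ v ^ 2 ∂gam

lemma integrable_mul_of_le {f : V → ℝ} (hf : MemLp f 2 gam) {g : V → ℝ}
    (hg : Continuous g) {C a : ℝ} (h : ∀ v, |g v| ≤ C * Real.exp (a * ‖v‖)) :
    Integrable (fun v => f v * g v) gam :=
  hf.integrable_mul (memLp_gam_of_le hg.aestronglyMeasurable h)

lemma norm_sq_le_exp (v : V) : ‖v‖ ^ 2 ≤ 2 * Real.exp (1 * ‖v‖) := by
  have := Real.pow_div_factorial_le_exp ‖v‖ (norm_nonneg v) 2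
  rw [div_le_iff₀ (by positivity)] at this
  simpa [Nat.factorial, mul_comm] using this

lemma abs_inner_sq_le (ξ v : V) : |inner ℝ ξ v ^ 2| ≤ ‖ξ‖ ^ 2 * ‖v‖ ^ 2 := by
  rw [abs_pow, ← mul_pow]
  exact pow_le_pow_left₀ (abs_nonneg _) (abs_real_inner_le_norm ξ v) 2

lemma integrable_mul_inner_mul {f : V → ℝ} (hf : MemLp f 2 gam) (ξ ζ : V) :
    Integrable (fun v => f v * (inner ℝ ξ v * inner ℝ ζ v)) gam := by
  refine integrable_mul_of_le hf (by fun_prop) (C := ‖ξ‖ * ‖ζ‖ * 2) (a := 1) fun v => ?_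
  rw [abs_mul]
  calc _ ≤ (‖ξ‖ * ‖v‖) * (‖ζ‖ * ‖v‖) :=
        mul_le_mul (abs_real_inner_le_norm _ _) (abs_real_inner_le_norm _ _) (abs_nonneg _)
          (by positivity)
    _ = ‖ξ‖ * ‖ζ‖ * ‖v‖ ^ 2 := by ring
    _ ≤ ‖ξ‖ * ‖ζ‖ * (2 * Real.exp (1 * ‖v‖)) := by gcongr; exact norm_sq_le_exp v
    _ = _ := by ring

lemma integrable_mul_inner_sq {f : V → ℝ} (hf : MemLp f 2 gam) (ξ : V) :
    Integrable (fun v => f v * inner ℝ ξ v ^ 2) gam := by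
  simpa only [sq] using integrable_mul_inner_mul hf ξ ξ

lemma integrable_mul_norm_sq {f : V → ℝ} (hf : MemLp f 2 gam) :
    Integrable (fun v => f v * ‖v‖ ^ 2) gam :=
  integrable_mul_of_le hf (by fun_prop) (C := 2) (a := 1) fun v => by
    rw [abs_of_nonneg (sq_nonneg _)]; exact norm_sq_le_exp v

/-- Expanding in a basis exhibits it as a quadratic polynomial in the coordinates of ξ. -/
lemma continuous_genQ {f : V → ℝ} (hf : MemLp f 2 gam) : Continuous (genQ f) := by
  have e : genQ f = fun ξ => 2 * ∑ i, ∑ j, inner ℝ (stdB i) ξ * inner ℝ (stdB j) ξ *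
      ∫ v, f v * (inner ℝ (stdB i) v * inner ℝ (stdB j) v) ∂gam := by
    funext ξ
    rw [genQ]
    congr 1
    simp only [← integral_const_mul]
    have hi : ∀ i j, Integrable (fun v => inner ℝ (stdB i) ξ * inner ℝ (stdB j) ξ *
        (f v * (inner ℝ (stdB i) v * inner ℝ (stdB j) v))) gam := fun i j =>
      (integrable_mul_inner_mul hf _ _).const_mul _
    have hs : ∀ i, ∑ j, ∫ v, inner ℝ (stdB i) ξ * inner ℝ (stdB j) ξ *
        (f v * (inner ℝ (stdB i) v * inner ℝ (stdB j) v)) ∂gam =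
        ∫ v, ∑ j, inner ℝ (stdB i) ξ * inner ℝ (stdB j) ξ *
        (f v * (inner ℝ (stdB i) v * inner ℝ (stdB j) v)) ∂gam := fun i =>
      (integral_finsetSum _ fun j _ => hi i j).symm
    simp only [hs]
    rw [← integral_finsetSum _ fun i _ => integrable_finsetSum _ fun j _ => hi i j]
    refine integral_congr_ae (Filter.Eventually.of_forall fun v => ?_)
    simp only
    rw [← stdB.sum_inner_mul_inner ξ v, sq, Finset.sum_mul_sum, Finset.mul_sum]
    refine Finset.sum_congr rfl fun i _ => ?_
    rw [Finset.mul_sum]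
    refine Finset.sum_congr rfl fun j _ => ?_
    rw [real_inner_comm ξ (stdB i), real_inner_comm ξ (stdB j)]
    ring
  rw [e]
  fun_prop

lemma integral_nsurf_sq_perp_add_par (ξ v : V) :
    ∫ ω, (inner ℝ (perp ω ξ) v ^ 2 + inner ℝ (par ω ξ) v ^ 2) ∂nsurf =
      3 / 5 * inner ℝ ξ v ^ 2 + 2 / 15 * ‖ξ‖ ^ 2 * ‖v‖ ^ 2 := by
  have e : ∀ ω : S2, inner ℝ (perp ω ξ) v ^ 2 + inner ℝ (par ω ξ) v ^ 2 =
      inner ℝ ξ v ^ 2 - 2 * inner ℝ ξ v * (inner ℝ (ω : V) ξ * inner ℝ (ω : V) v) +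
        2 * (inner ℝ (ω : V) ξ ^ 2 * inner ℝ (ω : V) v ^ 2) := fun ω => by
    simp only [perp, par, inner_sub_left, real_inner_smul_left]; ring
  have i1 : Integrable (fun ω : S2 => inner ℝ ξ v ^ 2 -
      2 * inner ℝ ξ v * (inner ℝ (ω : V) ξ * inner ℝ (ω : V) v)) nsurf :=
    integrable_nsurf (by fun_prop)
  have i2 : Integrable (fun ω : S2 =>
      2 * inner ℝ ξ v * (inner ℝ (ω : V) ξ * inner ℝ (ω : V) v)) nsurf :=
    integrable_nsurf (by fun_prop)
  have i3 : Integrable (fun ω : S2 => 2 * (inner ℝ (ω : V) ξ ^ 2 * inner ℝ (ω : V) v ^ 2)) nsurf :=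
    integrable_nsurf (by fun_prop)
  simp only [e]
  rw [integral_add i1 i3, integral_sub (integrable_const _) i2, integral_const_mul,
    integral_const_mul, integral_nsurf_inner_mul, integral_nsurf_inner_sq_mul_sq, integral_const,
    probReal_univ, one_smul]
  ring

/-- The spherical average of the squares is (3/5)(ξ·v)² + (2/15)|ξ|²|v|², and the second term
vanishes because f is orthogonal to |v|². -/
lemma gainGen_genQ {f : V → ℝ} (hf : MemLp f 2 gam) (h0 : ∫ v, f v * ‖v‖ ^ 2 ∂gam = 0) (ξ : V) :
    gainGen (genQ f) ξ = 3 / 5 * genQ f ξ := by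
  have hsw : Integrable (Function.uncurry fun (ω : S2) (v : V) =>
      f v * (inner ℝ (perp ω ξ) v ^ 2 + inner ℝ (par ω ξ) v ^ 2)) (nsurf.prod gam) := by
    have hc : Continuous fun z : S2 × V =>
        inner ℝ (perp z.1 ξ) z.2 ^ 2 + inner ℝ (par z.1 ξ) z.2 ^ 2 := by
      unfold perp par; fun_prop
    have hd := ((integrable_mul_norm_sq hf).norm.const_mul (2 * ‖ξ‖ ^ 2)).comp_snd nsurf
    refine hd.mono' ((hf.1.comp_snd (μ := nsurf)).mul hc.aestronglyMeasurable)
      (Filter.Eventually.of_forall fun z => ?_)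
    simp only [Function.uncurry, norm_mul, Real.norm_eq_abs]
    have h1 := abs_inner_sq_le (perp z.1 ξ) z.2
    have h2 := abs_inner_sq_le (par z.1 ξ) z.2
    have h3 := pow_le_pow_left₀ (norm_nonneg _) (norm_perp_le z.1 ξ) 2
    have h4 := pow_le_pow_left₀ (norm_nonneg _) (norm_par_le z.1 ξ) 2
    rw [abs_of_nonneg (sq_nonneg ‖z.2‖)]
    calc _ ≤ |f z.2| * (‖ξ‖ ^ 2 * ‖z.2‖ ^ 2 + ‖ξ‖ ^ 2 * ‖z.2‖ ^ 2) := by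
          gcongr
          refine (abs_add_le _ _).trans (add_le_add (h1.trans ?_) (h2.trans ?_)) <;> gcongr
      _ = _ := by ring
  have e1 : gainGen (genQ f) ξ = 2 * ∫ ω, ∫ v, f v * (inner ℝ (perp ω ξ) v ^ 2 +
      inner ℝ (par ω ξ) v ^ 2) ∂gam ∂nsurf := by
    rw [gainGen, ← integral_const_mul]
    refine integral_congr_ae (Filter.Eventually.of_forall fun ω => ?_)
    simp only [genQ, mul_add]
    rw [integral_add (integrable_mul_inner_sq hf _) (integrable_mul_inner_sq hf _)]
    ring
  rw [e1, integral_integral_swap hsw]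
  simp only [integral_const_mul, integral_nsurf_sq_perp_add_par]
  have e2 : ∀ v, f v * (3 / 5 * inner ℝ ξ v ^ 2 + 2 / 15 * ‖ξ‖ ^ 2 * ‖v‖ ^ 2) =
      3 / 5 * (f v * inner ℝ ξ v ^ 2) + 2 / 15 * ‖ξ‖ ^ 2 * (f v * ‖v‖ ^ 2) := fun v => by ring
  simp only [e2]
  rw [integral_add ((integrable_mul_inner_sq hf ξ).const_mul _)
    ((integrable_mul_norm_sq hf).const_mul _), integral_const_mul, integral_const_mul, h0, genQ]
  ring

lemma abs_exp_sub_le (x : ℝ) : |Real.exp x - 1 - x - x ^ 2 / 2| ≤ |x| ^ 3 * Real.exp |x| := by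
  have h := Complex.norm_exp_sub_sum_le_norm_mul_exp (x : ℂ) 3
  simp only [Finset.sum_range_succ, Finset.sum_range_zero, pow_zero, pow_one, Nat.factorial,
    Complex.norm_real, Real.norm_eq_abs] at h
  have e : (Complex.exp x - (0 + 1 / (1 : ℕ) + (x : ℂ) / ((0 + 1) * 1 : ℕ) +
      (x : ℂ) ^ 2 / ((1 + 1) * ((0 + 1) * 1) : ℕ)) : ℂ) =
      ((Real.exp x - 1 - x - x ^ 2 / 2 : ℝ) : ℂ) := by
    push_cast; ring
  rw [e, Complex.norm_real, Real.norm_eq_abs] at h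
  exact h

/-- Orthogonality to 1 and v removes the orders 0 and 1, so the expansion begins with `genQ`; the
normalization e^{-|ξ|²} alters it only at order four. -/
lemma gen_taylor {f : L2g} (hf : f ∈ invSᗮ) (R : ℝ) :
    ∃ N, 0 ≤ N ∧ ∀ ξ : V, ‖ξ‖ ≤ R → |gen f ξ - genQ f ξ| ≤ N * ‖ξ‖ ^ 3 := by
  have hfL := Lp.memLp f
  have hcube : Integrable (fun v => f v * (‖v‖ ^ 3 * Real.exp (2 * R * ‖v‖))) gam := by
    refine integrable_mul_of_le hfL (by fun_prop) (C := 6) (a := 1 + 2 * R) fun v => ?_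
    rw [abs_of_nonneg (by positivity), add_mul, Real.exp_add, ← mul_assoc, one_mul]
    gcongr
    have := Real.pow_div_factorial_le_exp ‖v‖ (norm_nonneg v) 3
    rw [div_le_iff₀ (by positivity)] at this
    simpa [Nat.factorial, mul_comm] using this
  set A := ∫ v, |f v * (‖v‖ ^ 3 * Real.exp (2 * R * ‖v‖))| ∂gam with hA
  set B := ∫ v, |f v * ‖v‖ ^ 2| ∂gam with hB
  have hA0 : 0 ≤ A := integral_nonneg fun v => abs_nonneg _
  have hB0 : 0 ≤ B := integral_nonneg fun v => abs_nonneg _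
  -- The 8 comes from the cube of 2ξ·v in the exponential remainder; the second summand bounds the
  -- fourth-order term by cubic growth on the ball.
  refine ⟨8 * A + 2 * B * |R|, by positivity, fun ξ hξ => ?_⟩
  have hn := norm_nonneg ξ
  have i0 := hfL.integrable one_le_two
  have i1 : Integrable (fun v => f v * inner ℝ ξ v) gam :=
    integrable_mul_of_le hfL (by fun_prop) (C := ‖ξ‖) (a := 1) fun v =>
      (abs_real_inner_le_norm ξ v).trans (by
        gcongr; rw [one_mul]; linarith [Real.add_one_le_exp ‖v‖])
  have i2 := integrable_mul_inner_sq hfL ξ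
  have ie : Integrable (fun v => f v * Real.exp (2 * inner ℝ ξ v)) gam :=
    integrable_mul_of_le hfL (by fun_prop) (C := 1) (a := 2 * ‖ξ‖) fun v => by
      rw [abs_of_pos (Real.exp_pos _), one_mul]
      exact Real.exp_le_exp.2 (by nlinarith [real_inner_le_norm ξ v])
  set E := ∫ v, f v * Real.exp (2 * inner ℝ ξ v) ∂gam with hE
  have hgen : gen f ξ = Real.exp (-‖ξ‖ ^ 2) * E := by
    rw [gen_eq, hE, ← integral_const_mul]
    refine integral_congr_ae (Filter.Eventually.of_forall fun v => ?_)
    simp only [expF, sub_eq_add_neg, Real.exp_add]; ring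
  have hD : E - genQ f ξ = ∫ v, f v * (Real.exp (2 * inner ℝ ξ v) - 1 - 2 * inner ℝ ξ v -
      (2 * inner ℝ ξ v) ^ 2 / 2) ∂gam := by
    have e : ∀ v, f v * (Real.exp (2 * inner ℝ ξ v) - 1 - 2 * inner ℝ ξ v -
        (2 * inner ℝ ξ v) ^ 2 / 2) = f v * Real.exp (2 * inner ℝ ξ v) -
        ((f v + 2 * (f v * inner ℝ ξ v)) + 2 * (f v * inner ℝ ξ v ^ 2)) := fun v => by ring
    have j : Integrable (fun v => f v + 2 * (f v * inner ℝ ξ v)) gam := i0.add (i1.const_mul 2)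
    have j2 : Integrable (fun v => (f v + 2 * (f v * inner ℝ ξ v)) +
      2 * (f v * inner ℝ ξ v ^ 2)) gam := j.add (i2.const_mul 2)
    simp only [e]
    rw [integral_sub ie j2, integral_add j (i2.const_mul 2), integral_add i0 (i1.const_mul 2),
      integral_const_mul, integral_const_mul, integral_eq_zero_of_mem hf,
      integral_mul_inner_of_mem hf, genQ]
    ring
  have hD2 : |E - genQ f ξ| ≤ 8 * A * ‖ξ‖ ^ 3 := by
    rw [hD, ← Real.norm_eq_abs]
    calc _ ≤ ∫ v, 8 * ‖ξ‖ ^ 3 * |f v * (‖v‖ ^ 3 * Real.exp (2 * R * ‖v‖))| ∂gam := by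
          refine norm_integral_le_of_norm_le (hcube.abs.const_mul _)
            (Filter.Eventually.of_forall fun v => ?_)
          have h1 := abs_exp_sub_le (2 * inner ℝ ξ v)
          have h2 : |2 * inner ℝ ξ v| ≤ 2 * (‖ξ‖ * ‖v‖) := by
            rw [abs_mul, abs_two]
            have := abs_real_inner_le_norm ξ v
            gcongr
          have h3 : 2 * (‖ξ‖ * ‖v‖) ≤ 2 * R * ‖v‖ := by
            rw [← mul_assoc]; gcongr
          rw [Real.norm_eq_abs, abs_mul, abs_mul (f v), abs_of_nonneg (a := ‖v‖ ^ 3 * _)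
            (by positivity)]
          calc _ ≤ |f v| * ((2 * (‖ξ‖ * ‖v‖)) ^ 3 * Real.exp (2 * R * ‖v‖)) := by
                gcongr
                refine h1.trans ?_
                gcongr
                exact h2.trans h3
            _ = _ := by ring
      _ = _ := by rw [integral_const_mul, ← hA]; ring
  have hq : |genQ f ξ| ≤ 2 * (‖ξ‖ ^ 2 * B) := by
    rw [genQ, abs_mul, abs_two]
    gcongr
    rw [hB, ← integral_const_mul, ← Real.norm_eq_abs]
    refine norm_integral_le_of_norm_le ((integrable_mul_norm_sq hfL).abs.const_mul _)
      (Filter.Eventually.of_forall fun v => ?_)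
    have := abs_inner_sq_le ξ v
    rw [Real.norm_eq_abs, abs_mul, abs_mul, abs_of_nonneg (sq_nonneg ‖v‖)]
    calc _ ≤ |f v| * (‖ξ‖ ^ 2 * ‖v‖ ^ 2) := by gcongr
      _ = _ := by ring
  have hs1 : Real.exp (-‖ξ‖ ^ 2) ≤ 1 := Real.exp_le_one_iff.2 (by nlinarith)
  have hs2 : 1 - ‖ξ‖ ^ 2 ≤ Real.exp (-‖ξ‖ ^ 2) := by linarith [Real.add_one_le_exp (-‖ξ‖ ^ 2)]
  have hs0 := Real.exp_pos (-‖ξ‖ ^ 2)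
  calc |gen f ξ - genQ f ξ|
      = |Real.exp (-‖ξ‖ ^ 2) * (E - genQ f ξ) + (Real.exp (-‖ξ‖ ^ 2) - 1) * genQ f ξ| := by
        rw [hgen]; congr 1; ring
    _ ≤ 1 * |E - genQ f ξ| + ‖ξ‖ ^ 2 * |genQ f ξ| := by
        refine (abs_add_le _ _).trans ?_
        rw [abs_mul, abs_mul, abs_of_pos hs0]
        gcongr
        rw [abs_le]; constructor <;> nlinarith
    _ ≤ 1 * (8 * A * ‖ξ‖ ^ 3) + ‖ξ‖ ^ 2 * (2 * (‖ξ‖ ^ 2 * B)) := by gcongr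
    _ = 8 * A * ‖ξ‖ ^ 3 + 2 * B * ‖ξ‖ * ‖ξ‖ ^ 3 := by ring
    _ ≤ 8 * A * ‖ξ‖ ^ 3 + 2 * B * |R| * ‖ξ‖ ^ 3 := by
        gcongr; exact hξ.trans (le_abs_self R)
    _ = _ := by ring

section LogConvexity

variable {E : Type*} [NormedAddCommGroup E] [InnerProductSpace ℝ E] {G : E →L[ℝ] E}

/-- The successive images `Gᵏ f`. -/
def iter (G : E →L[ℝ] E) (f : E) : ℕ → E
  | 0 => f
  | k + 1 => G (iter G f k)

lemma inner_iter (hG : ∀ f g, inner ℝ (G f) g = inner ℝ f (G g)) (f : E) (k j : ℕ) :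
    inner ℝ (iter G f k) (iter G f j) = inner ℝ (iter G f (k + j)) f := by
  induction j generalizing k with
  | zero => rfl
  | succ j ih =>
    rw [show iter G f (j + 1) = G (iter G f j) from rfl, ← hG]
    have := ih (k + 1)
    rw [show k + 1 + j = k + (j + 1) by ring] at this
    exact this

/-- Symmetry and Cauchy–Schwarz: k ↦ ‖Gᵏf‖ is log-convex. -/
lemma norm_iter_succ_sq_le (hG : ∀ f g, inner ℝ (G f) g = inner ℝ f (G g)) (f : E) (k : ℕ) :
    ‖iter G f (k + 1)‖ ^ 2 ≤ ‖iter G f k‖ * ‖iter G f (k + 2)‖ := by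
  rw [← real_inner_self_eq_norm_sq]
  refine le_trans (le_of_eq ?_) (real_inner_le_norm (iter G f k) (iter G f (k + 2)))
  exact hG (iter G f k) (iter G f (k + 1))

/-- A symmetric operator whose moments at `f` decay like `κᵏ` contracts `f` by `κ`. -/
lemma norm_apply_le_of_inner_iter_le (hG : ∀ f g, inner ℝ (G f) g = inner ℝ f (G g)) {f : E}
    {C κ : ℝ} (hκ : 0 < κ) (h : ∀ k, |inner ℝ (iter G f k) f| ≤ C * κ ^ k) :
    ‖G f‖ ≤ κ * ‖f‖ := by
  -- Ratios of successive norms do not decrease, so a first ratio r > κ gives ‖Gᵏf‖ ≥ rᵏ‖f‖. This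
  -- contradicts ‖Gᵏf‖² = ⟨G²ᵏf, f⟩ ≤ C κ²ᵏ for large k.
  by_contra! hlt
  have h0 : 0 < ‖f‖ := by
    rcases (norm_nonneg f).eq_or_lt with h0 | h0
    · rw [norm_eq_zero.1 h0.symm] at hlt; simp at hlt
    · exact h0
  set r := ‖G f‖ / ‖f‖ with hr
  have hrκ : κ < r := (lt_div_iff₀ h0).2 hlt
  have hr0 : 0 < r := hκ.trans hrκ
  have hstep : ∀ k, 0 < ‖iter G f k‖ ∧ r * ‖iter G f k‖ ≤ ‖iter G f (k + 1)‖ := by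
    intro k
    induction k with
    | zero => exact ⟨h0, (div_mul_cancel₀ _ h0.ne').le⟩
    | succ k ih =>
      have hp : 0 < ‖iter G f (k + 1)‖ := lt_of_lt_of_le (mul_pos hr0 ih.1) ih.2
      refine ⟨hp, ?_⟩
      have h1 := norm_iter_succ_sq_le hG f k
      have h2 : ‖iter G f k‖ * (r * ‖iter G f (k + 1)‖) ≤
          ‖iter G f k‖ * ‖iter G f (k + 1 + 1)‖ := by
        refine le_trans ?_ h1
        calc _ = (r * ‖iter G f k‖) * ‖iter G f (k + 1)‖ := by ring
          _ ≤ ‖iter G f (k + 1)‖ * ‖iter G f (k + 1)‖ := by gcongr; exact ih.2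
          _ = _ := by ring
      exact le_of_mul_le_mul_left h2 ih.1
  have hpow : ∀ k, r ^ k * ‖f‖ ≤ ‖iter G f k‖ := by
    intro k
    induction k with
    | zero => simp [iter]
    | succ k ih =>
      refine le_trans ?_ (hstep k).2
      calc _ = r * (r ^ k * ‖f‖) := by ring
        _ ≤ _ := by gcongr
  have hbd : ∀ k, ((r / κ) ^ 2) ^ k * ‖f‖ ^ 2 ≤ C := by
    intro k
    have h1 := h (k + k)
    rw [← inner_iter hG, real_inner_self_eq_norm_sq, abs_of_nonneg (sq_nonneg _)] at h1
    have h2 := (pow_le_pow_left₀ (by positivity) (hpow k) 2).trans h1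
    have h3 : ((r / κ) ^ 2) ^ k * ‖f‖ ^ 2 = (r ^ k * ‖f‖) ^ 2 / κ ^ (k + k) := by
      rw [← pow_mul, div_pow]; field_simp; ring
    rw [h3, div_le_iff₀ (by positivity)]
    exact h2
  have h1 : 1 < (r / κ) ^ 2 := one_lt_pow₀ ((one_lt_div hκ).2 hrκ) two_ne_zero
  obtain ⟨n, hn⟩ := pow_unbounded_of_one_lt (C / ‖f‖ ^ 2) h1
  rw [div_lt_iff₀ (by positivity)] at hn
  exact absurd (hbd n) (not_le.2 hn)

end LogConvexity

lemma iter_gainOp_mem {f : L2g} (hf : f ∈ invSᗮ) (k : ℕ) : iter gainOp f k ∈ invSᗮ := by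
  induction k with
  | zero => exact hf
  | succ k ih => exact gainOp_mem ih

lemma abs_gen_iter_le {f : L2g} (hf : f ∈ invSᗮ) (ξ : V) :
    ∃ C, ∀ k, |gen (iter gainOp f k) ξ| ≤ C * (13 / 15) ^ k := by
  obtain ⟨N, hN, hT⟩ := gen_taylor hf ‖ξ‖
  have h := fun k => gainGen_iterate_bound (F := fun k => gen (iter gainOp f k))
    (fun k => continuous_gen _) (continuous_genQ (Lp.memLp f)) (fun k ζ => gen_gainOp _ ζ)
    (gainGen_genQ (Lp.memLp f) (integral_mul_norm_sq_of_mem hf)) hN hT k ξ le_rfl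
  refine ⟨|genQ f ξ| + N * ‖ξ‖ ^ 3, fun k => ?_⟩
  have h1 : |(3 / 5 : ℝ) ^ k * genQ f ξ| ≤ (13 / 15) ^ k * |genQ f ξ| := by
    rw [abs_mul, abs_of_pos (by positivity : (0 : ℝ) < (3 / 5) ^ k)]
    gcongr ?_ ^ k * _; norm_num
  have h2 := abs_sub_abs_le_abs_sub (gen (iter gainOp f k) ξ) ((3 / 5) ^ k * genQ f ξ)
  have h3 := h k
  linarith

lemma abs_inner_iter_le {f : L2g} (hf : f ∈ invSᗮ) {g : L2g}
    (hg : g ∈ Submodule.span ℝ (Set.range expL)) :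
    ∃ C, ∀ k, |inner ℝ (iter gainOp f k) g| ≤ C * (13 / 15) ^ k := by
  induction hg using Submodule.span_induction with
  | mem g hg =>
    obtain ⟨ξ, rfl⟩ := hg
    exact abs_gen_iter_le hf ξ
  | zero => exact ⟨0, fun k => by simp⟩
  | add g g' _ _ h h' =>
    obtain ⟨C, h⟩ := h
    obtain ⟨C', h'⟩ := h'
    refine ⟨C + C', fun k => ?_⟩
    rw [inner_add_right, add_mul]
    exact (abs_add_le _ _).trans (add_le_add (h k) (h' k))
  | smul c g _ h =>
    obtain ⟨C, h⟩ := h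
    refine ⟨|c| * C, fun k => ?_⟩
    rw [inner_smul_right, abs_mul, mul_assoc]
    exact mul_le_mul_of_nonneg_left (h k) (abs_nonneg c)

/-- The moment criterion needs decay of ⟨Gᵏf, f⟩, while decay is known only against combinations g
of exponentials. Taking f to be the projection of g resolves this, and such f are dense in the
complement of the invariants. -/
lemma norm_gainOp_le {f : L2g} (hf : f ∈ invSᗮ) : ‖gainOp f‖ ≤ 13 / 15 * ‖f‖ := by
  have hcl : IsClosed {g : L2g | ‖gainOp (invSᗮ.starProjection g)‖ ≤
      13 / 15 * ‖invSᗮ.starProjection g‖} := isClosed_le (by fun_prop) (by fun_prop)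
  have hsub : (Submodule.span ℝ (Set.range expL) : Set L2g) ⊆
      {g : L2g | ‖gainOp (invSᗮ.starProjection g)‖ ≤ 13 / 15 * ‖invSᗮ.starProjection g‖} := by
    intro g hg
    set f₀ := invSᗮ.starProjection g with hf₀
    have hm : f₀ ∈ invSᗮ := Submodule.starProjection_apply_mem _ g
    obtain ⟨C, hC⟩ := abs_inner_iter_le hm hg
    refine norm_apply_le_of_inner_iter_le gainOp_symm (C := C) (by norm_num) fun k => ?_
    have h1 := Submodule.sub_starProjection_mem_orthogonal (K := invSᗮ) g
    -- The iterates stay orthogonal to the invariants, so they pair equally with g and with its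
    -- projection.
    have h2 := (Submodule.mem_orthogonal _ _).1 h1 _ (iter_gainOp_mem hm k)
    rw [inner_sub_right, sub_eq_zero] at h2
    rw [← h2]
    exact hC k
  have hall := closure_minimal hsub hcl
  have hf' : f ∈ (Submodule.span ℝ (Set.range expL)).topologicalClosure := by
    rw [topologicalClosure_span_expL]; trivial
  have := hall hf'
  rwa [Set.mem_ofPred_eq, Submodule.starProjection_eq_self_iff.2 hf] at this

/-! ### The Maxwellian Dirichlet form -/

lemma integral_gamX_inner_exch {f : L2g} (hf : f ∈ invSᗮ) :
    ∫ p : X, f p.1 * f (exch p).1 ∂gamX = 0 := by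
  have h := Lp.memLp f
  have i : Integrable (fun p : X => f p.1 * f (exch p).1) gamX :=
    (memLp_comp_gamX measurePreserving_id_gam h).integrable_mul
      (memLp_comp_gamX measurePreserving_exch_gam h)
  rw [integral_gamX i]
  have e : ∀ ω : S2, ∫ z : V × V, f z.1 * f z.2 ∂gam.prod gam = 0 := fun ω => by
    rw [integral_prod_mul, integral_eq_zero_of_mem hf, zero_mul]
  simp only [exch]
  rw [integral_congr_ae (Filter.Eventually.of_forall e), integral_zero]

/-- The defect is A + B - C - D with four vectors of norm ‖f‖. The products ⟨A,B⟩ and ⟨C,D⟩ vanish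
by independence and zero mean, so its squared norm is 4‖f‖² - 4⟨Gf, f⟩ ≥ (4 - 52/15)‖f‖². -/
lemma defect_sq_gap {f : L2g} (hf : f ∈ invSᗮ) :
    8 / 15 * ‖f‖ ^ 2 ≤ ∫ p, defect f p ^ 2 ∂gamX := by
  set A := ev measurePreserving_collide_gam f with hA
  set B := ev measurePreserving_collideExch_gam f with hB
  set C := ev measurePreserving_id_gam f with hC
  set D := ev measurePreserving_exch_gam f with hD
  have hAA : ‖A‖ = ‖f‖ := norm_ev _ f
  have hBB : ‖B‖ = ‖f‖ := norm_ev _ f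
  have hCC : ‖C‖ = ‖f‖ := norm_ev _ f
  have hDD : ‖D‖ = ‖f‖ := norm_ev _ f
  have hCD : inner ℝ C D = 0 := by
    rw [hC, hD, inner_ev]; exact integral_gamX_inner_exch hf
  have hAB : inner ℝ A B = 0 := by
    rw [hA, hB, inner_ev, ← integral_gamX_inner_exch hf,
      ← involutive_integral_comp measurePreserving_collide_gam collide_collide]
    refine integral_congr_ae (Filter.Eventually.of_forall fun p => ?_)
    simp only [collideExch, collide_exch, collide_collide]
  have hG : inner ℝ A C + inner ℝ B C = inner ℝ (gainOp f) f := by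
    rw [inner_gainOp, gainEv, add_apply, inner_add_left]
  have hAD : inner ℝ A D = inner ℝ B C := by
    rw [hA, hB, hC, hD, inner_ev, inner_ev,
      ← involutive_integral_comp measurePreserving_exch_gam exch_exch]
    refine integral_congr_ae (Filter.Eventually.of_forall fun p => ?_)
    simp only [collideExch, exch_exch, id]
  have hBD : inner ℝ B D = inner ℝ A C := by
    rw [hA, hB, hC, hD, inner_ev, inner_ev,
      ← involutive_integral_comp measurePreserving_exch_gam exch_exch]
    refine integral_congr_ae (Filter.Eventually.of_forall fun p => ?_)
    simp only [collideExch, exch_exch, id]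
  have hJ : ∫ p, defect f p ^ 2 ∂gamX = inner ℝ (A + B - C - D) (A + B - C - D) := by
    rw [L2.inner_def]
    refine integral_congr_ae ?_
    filter_upwards [ev_coeFn measurePreserving_collide_gam f,
      ev_coeFn measurePreserving_collideExch_gam f, ev_coeFn measurePreserving_id_gam f,
      ev_coeFn measurePreserving_exch_gam f, Lp.coeFn_add A B, Lp.coeFn_sub (A + B) C,
      Lp.coeFn_sub (A + B - C) D] with p h1 h2 h3 h4 h5 h6 h7
    rw [h7, Pi.sub_apply, h6, Pi.sub_apply, h5, Pi.add_apply, h1, h2, h3, h4]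
    simp only [collideExch_eq, collide, exch, id, defect]
    simp [sq]
  have key : inner ℝ (gainOp f) f ≤ 13 / 15 * ‖f‖ ^ 2 := by
    calc _ ≤ ‖gainOp f‖ * ‖f‖ := real_inner_le_norm _ _
      _ ≤ 13 / 15 * ‖f‖ * ‖f‖ := by gcongr; exact norm_gainOp_le hf
      _ = _ := by ring
  rw [hJ]
  simp only [inner_sub_left, inner_sub_right, inner_add_left, inner_add_right,
    real_inner_self_eq_norm_sq, hAA, hBB, hCC, hDD]
  have s1 := real_inner_comm A B
  have s2 := real_inner_comm A C
  have s3 := real_inner_comm A D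
  have s4 := real_inner_comm B C
  have s5 := real_inner_comm B D
  have s6 := real_inner_comm C D
  linarith

/-! ### From the Maxwellian to the hard-sphere Dirichlet form -/

lemma memLp_defect (f : L2g) : MemLp (defect f) 2 gamX := by
  have h := Lp.memLp f
  refine (((memLp_comp_gamX measurePreserving_collide_gam h).add
    (memLp_comp_gamX measurePreserving_collideExch_gam h)).sub
    (memLp_comp_gamX measurePreserving_id_gam h) |>.sub
    (memLp_comp_gamX measurePreserving_exch_gam h)).ae_eq
    (Filter.Eventually.of_forall fun p => ?_)
  simp only [Pi.sub_apply, Pi.add_apply, collideExch_eq, collide, exch, id, defect]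

/-- Indicator of the grazing collisions `q < ε`. -/
def graz (ε : ℝ) (p : X) : ℝ := (Set.Iio ε).indicator 1 (q p.2.2 p.2.1 p.1)

lemma graz_nonneg (ε : ℝ) (p : X) : 0 ≤ graz ε p := Set.indicator_nonneg (fun _ _ => zero_le_one) _

lemma graz_le_one (ε : ℝ) (p : X) : graz ε p ≤ 1 :=
  Set.indicator_le_self' (fun _ _ => zero_le_one) _

lemma measurable_graz (ε : ℝ) : Measurable (graz ε) :=
  (measurable_one.indicator measurableSet_Iio).comp continuous_q.measurable

lemma graz_collide (ε : ℝ) (p : X) : graz ε (collide p) = graz ε p := by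
  simp only [graz, collide, q_post]

lemma graz_exch (ε : ℝ) (p : X) : graz ε (exch p) = graz ε p := by
  simp only [graz, exch]; rw [q_swap]

lemma mul_one_sub_graz_le (ε : ℝ) (p : X) :
    ε * (1 - graz ε p) ≤ q p.2.2 p.2.1 p.1 := by
  rw [graz]
  by_cases h : q p.2.2 p.2.1 p.1 ∈ Set.Iio ε
  · rw [Set.indicator_of_mem h]; simpa using q_nonneg _ _ _
  · rw [Set.indicator_of_notMem h]; simpa using h

lemma integrable_graz_mul (ε : ℝ) {φ : X → ℝ} (h : Integrable φ gamX) :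
    Integrable (fun p => graz ε p * φ p) gamX :=
  h.bdd_mul (measurable_graz ε).aestronglyMeasurable (c := 1) (Filter.Eventually.of_forall fun p => by
    rw [Real.norm_of_nonneg (graz_nonneg ε p)]; exact graz_le_one ε p)

lemma integral_graz_section_le {ε : ℝ} (hε : 0 ≤ ε) (v : V) :
    ∫ y, graz ε (v, y) ∂(gam.prod nsurf) ≤ gamZ⁻¹ * (2 * Real.pi * ε) := by
  have hi : Integrable (fun y : V × S2 => graz ε (v, y)) (gam.prod nsurf) :=
    Integrable.of_bound ((measurable_graz ε).comp measurable_prodMk_left).aestronglyMeasurable 1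
      (Filter.Eventually.of_forall fun y => by
        rw [Real.norm_of_nonneg (graz_nonneg ε _)]; exact graz_le_one ε _)
  rw [integral_prod_symm _ hi]
  have hω : ∀ ω, ∫ u, graz ε (v, (u, ω)) ∂gam ≤ gamZ⁻¹ * (2 * Real.pi * ε) := fun ω => by
    rw [integral_gam]
    exact mul_le_mul_of_nonneg_left (integral_slab_le ω v hε).1 (inv_nonneg.2 gamZ_pos.le)
  calc _ ≤ ∫ _ : S2, gamZ⁻¹ * (2 * Real.pi * ε) ∂nsurf :=
        integral_mono hi.integral_prod_right (integrable_const _) hω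
    _ = _ := by simp

lemma integral_graz_mul_sq_le {ε : ℝ} (hε : 0 ≤ ε) (f : L2g) :
    ∫ p : X, graz ε p * f p.1 ^ 2 ∂gamX ≤ gamZ⁻¹ * (2 * Real.pi * ε) * ‖f‖ ^ 2 := by
  have hf := (Lp.memLp f).integrable_sq
  have hi : Integrable (fun p : X => graz ε p * f p.1 ^ 2) gamX :=
    integrable_graz_mul ε (hf.comp_fst _)
  have hn : ‖f‖ ^ 2 = ∫ v, f v ^ 2 ∂gam := by
    rw [← real_inner_self_eq_norm_sq, L2.inner_def]
    refine integral_congr_ae (Filter.Eventually.of_forall fun v => ?_)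
    simp [sq]
  rw [integral_prod _ hi, hn, ← integral_const_mul]
  refine integral_mono hi.integral_prod_left (hf.const_mul _) fun v => ?_
  simp only [integral_mul_const]
  exact mul_le_mul_of_nonneg_right (integral_graz_section_le hε v) (sq_nonneg _)

/-- The grazing set is invariant under every collision symmetry, so all four terms of the defect
contribute alike; (a+b-c-d)² ≤ 4(a²+b²+c²+d²) gives 16 = 4 · 4. -/
lemma integral_graz_mul_defect_sq_le {ε : ℝ} (hε : 0 ≤ ε) (f : L2g) :
    ∫ p, graz ε p * defect f p ^ 2 ∂gamX ≤ 16 * (gamZ⁻¹ * (2 * Real.pi * ε) * ‖f‖ ^ 2) := by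
  have hf : Integrable (fun p : X => graz ε p * f p.1 ^ 2) gamX :=
    integrable_graz_mul ε ((Lp.memLp f).integrable_sq.comp_fst _)
  have key : ∀ T : X → X, MeasurePreserving T gamX gamX → (∀ p, T (T p) = p) →
      (∀ p, graz ε (T p) = graz ε p) →
      Integrable (fun p => graz ε p * f (T p).1 ^ 2) gamX ∧
      ∫ p, graz ε p * f (T p).1 ^ 2 ∂gamX = ∫ p : X, graz ε p * f p.1 ^ 2 ∂gamX := by
    intro T hT hTT hg
    have h1 := hT.integrable_comp_of_integrable hf
    have h2 := involutive_integral_comp hT hTT fun p => graz ε p * f p.1 ^ 2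
    simp only [Function.comp_def, hg] at h1 h2
    exact ⟨h1, h2⟩
  obtain ⟨a1, a2⟩ := key _ measurePreserving_collide_gam collide_collide (graz_collide ε)
  obtain ⟨b1, b2⟩ := key _ measurePreserving_exch_gam exch_exch (graz_exch ε)
  obtain ⟨c1, c2⟩ := key _ measurePreserving_collideExch_gam collideExch_collideExch fun p => by
    rw [collideExch, graz_collide, graz_exch]
  have hs : Integrable (fun p : X => 4 * (graz ε p * f (collide p).1 ^ 2 +
      graz ε p * f (collideExch p).1 ^ 2 + graz ε p * f p.1 ^ 2 + graz ε p * f (exch p).1 ^ 2))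
      gamX := (((a1.add c1).add hf).add b1).const_mul 4
  calc _ ≤ ∫ p : X, 4 * (graz ε p * f (collide p).1 ^ 2 + graz ε p * f (collideExch p).1 ^ 2 +
          graz ε p * f p.1 ^ 2 + graz ε p * f (exch p).1 ^ 2) ∂gamX := by
        refine integral_mono (integrable_graz_mul ε (memLp_defect f).integrable_sq) hs fun p => ?_
        simp only [collideExch_eq, collide, exch, defect]
        rw [← mul_add, ← mul_add, ← mul_add, mul_left_comm]
        refine mul_le_mul_of_nonneg_left ?_ (graz_nonneg ε p)
        generalize f (vPost p.2.1 p.1 p.2.2) = a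
        generalize f (uPost p.2.1 p.1 p.2.2) = b
        generalize f p.1 = c
        generalize f p.2.1 = d
        nlinarith [sq_nonneg (a - b), sq_nonneg (a + c), sq_nonneg (a + d), sq_nonneg (b + c),
          sq_nonneg (b + d), sq_nonneg (c - d)]
    _ = 16 * ∫ p : X, graz ε p * f p.1 ^ 2 ∂gamX := by
        have e1 : Integrable (fun p : X => graz ε p * f (collide p).1 ^ 2 +
          graz ε p * f (collideExch p).1 ^ 2) gamX := a1.add c1
        have e2 : Integrable (fun p : X => graz ε p * f (collide p).1 ^ 2 +
          graz ε p * f (collideExch p).1 ^ 2 + graz ε p * f p.1 ^ 2) gamX := e1.add hf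
        rw [integral_const_mul, integral_add e2 b1, integral_add e1 hf, integral_add a1 c1, a2, b2,
          c2]
        ring
    _ ≤ _ := by gcongr; exact integral_graz_mul_sq_le hε f

lemma exists_hardSphere_gap_gam : ∃ δ, 0 < δ ∧ ∀ f ∈ invSᗮ,
    Integrable (fun p => q p.2.2 p.2.1 p.1 * defect f p ^ 2) gamX →
    δ * ‖f‖ ^ 2 ≤ ∫ p, q p.2.2 p.2.1 p.1 * defect f p ^ 2 ∂gamX := by
  have hZ := gamZ_pos
  set c := gamZ⁻¹ * (32 * Real.pi) with hc
  have hc0 : 0 < c := by positivity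
  -- Chosen so that grazing collisions cost exactly half of the gap 8/15.
  set ε := 4 / 15 / c with hε
  have hε0 : 0 < ε := by positivity
  refine ⟨ε * (4 / 15), by positivity, fun f hf hi => ?_⟩
  have h1 := defect_sq_gap hf
  have h2 := integral_graz_mul_defect_sq_le hε0.le f
  have e : 16 * (gamZ⁻¹ * (2 * Real.pi * ε) * ‖f‖ ^ 2) = 4 / 15 * ‖f‖ ^ 2 := by
    have : c * ε = 4 / 15 := by rw [hε]; field_simp
    rw [← this, hc]; ring
  rw [e] at h2
  have i1 := (memLp_defect f).integrable_sq
  have i2 := integrable_graz_mul ε i1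
  calc ε * (4 / 15) * ‖f‖ ^ 2 ≤ ε * (∫ p, defect f p ^ 2 ∂gamX) -
        ε * ∫ p, graz ε p * defect f p ^ 2 ∂gamX := by nlinarith
    _ = ∫ p, (ε * defect f p ^ 2 - ε * (graz ε p * defect f p ^ 2)) ∂gamX := by
        rw [integral_sub (i1.const_mul ε) (i2.const_mul ε), integral_const_mul, integral_const_mul]
    _ ≤ _ := by
        refine integral_mono ((i1.const_mul ε).sub (i2.const_mul ε)) hi fun p => ?_
        have := mul_le_mul_of_nonneg_right (mul_one_sub_graz_le ε p) (sq_nonneg (defect f p))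
        simp only
        linarith

/-! ### Return to Lebesgue measure. -/

/-- The density of `gamX` with respect to the Lebesgue and surface measures. -/
lemma gamX_eq : gamX = volX.withDensity fun p =>
    gamD p.1 * (gamD p.2.1 * (surf Set.univ)⁻¹) := by
  have h1 : nsurf = surf.withDensity fun _ => (surf Set.univ)⁻¹ := (withDensity_const _).symm
  rw [gamX, h1, gam, prod_withDensity measurable_gamD measurable_const,
    prod_withDensity measurable_gamD (by have := measurable_gamD; fun_prop)]

/-- The total mass of `maxw u * maxw v` on the collision space. -/
def massX : ℝ := gamZ ^ 2 * (surf Set.univ).toReal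

lemma massX_pos : 0 < massX := by
  have : 0 < (surf Set.univ).toReal :=
    ENNReal.toReal_pos surf_univ_ne_zero (measure_ne_top _ _)
  have := gamZ_pos
  unfold massX; positivity

lemma gamX_density_toReal (p : X) : (gamD p.1 * (gamD p.2.1 * (surf Set.univ)⁻¹)).toReal =
    massX⁻¹ * (maxw p.2.1 * maxw p.1) := by
  rw [ENNReal.toReal_mul, ENNReal.toReal_mul, gamD_toReal, gamD_toReal, ENNReal.toReal_inv, massX,
    mul_inv, ← inv_pow]
  ring

lemma gamX_density_lt_top (p : X) : gamD p.1 * (gamD p.2.1 * (surf Set.univ)⁻¹) < ⊤ :=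
  ENNReal.mul_lt_top ENNReal.ofReal_lt_top (ENNReal.mul_lt_top ENNReal.ofReal_lt_top
    (ENNReal.inv_lt_top.2 (pos_iff_ne_zero.2 surf_univ_ne_zero)))

lemma measurable_gamX_density :
    Measurable fun p : X => gamD p.1 * (gamD p.2.1 * (surf Set.univ)⁻¹) := by
  have := measurable_gamD; fun_prop

lemma integral_maxw_mul (φ : X → ℝ) :
    ∫ p, maxw p.2.1 * maxw p.1 * φ p ∂volX = massX * ∫ p, φ p ∂gamX := by
  rw [gamX_eq, integral_withDensity_eq_integral_toReal_smul measurable_gamX_density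
    (Filter.Eventually.of_forall gamX_density_lt_top), ← integral_const_mul]
  refine integral_congr_ae (Filter.Eventually.of_forall fun p => ?_)
  simp only [gamX_density_toReal, smul_eq_mul]
  have := massX_pos
  field_simp

lemma integrable_gamX_of_maxw_mul {φ : X → ℝ}
    (h : Integrable (fun p => maxw p.2.1 * maxw p.1 * φ p) volX) : Integrable φ gamX := by
  rw [gamX_eq, integrable_withDensity_iff_integrable_smul' measurable_gamX_density
    (Filter.Eventually.of_forall gamX_density_lt_top)]
  refine (h.const_mul massX⁻¹).congr (Filter.Eventually.of_forall fun p => ?_)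
  simp only [gamX_density_toReal, smul_eq_mul, mul_assoc]

lemma defect_ae_eq {h k : V → ℝ} (hk : h =ᵐ[gam] k) : defect h =ᵐ[gamX] defect k := by
  have key : ∀ {T : X → X}, MeasurePreserving T gamX gamX →
      (fun p => h (T p).1) =ᵐ[gamX] fun p => k (T p).1 := fun hT =>
    (measurePreserving_fst_gam.comp hT).quasiMeasurePreserving.ae_eq_comp hk
  filter_upwards [key measurePreserving_collide_gam, key measurePreserving_collideExch_gam,
    key measurePreserving_id_gam, key measurePreserving_exch_gam] with p h1 h2 h3 h4
  simp only [collideExch_eq, collide, exch, id] at h1 h2 h3 h4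
  simp only [defect, h1, h2, h3, h4]

lemma defect_sub_invF (h : V → ℝ) (x : ℝ × V × ℝ) (p : X) :
    defect (fun v => h v - invF x v) p = defect h p := by
  have := invF_post x p.2.1 p.1 p.2.2
  simp only [defect]; linarith

/-- Coercivity of the hard-sphere Dirichlet form, modulo collision invariants. -/
lemma exists_hardSphere_gap : ∃ δ, 0 < δ ∧ ∀ h : V → ℝ, MemLp h 2 gam →
    Integrable (fun p : X => q p.2.2 p.2.1 p.1 * (maxw p.2.1 * maxw p.1) * defect h p ^ 2) volX →
    ∃ x : ℝ × V × ℝ, δ * ∫ v, maxw v * (h v - invF x v) ^ 2 ≤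
      ∫ p : X, q p.2.2 p.2.1 p.1 * (maxw p.2.1 * maxw p.1) * defect h p ^ 2 ∂volX := by
  obtain ⟨δ, hδ, H⟩ := exists_hardSphere_gap_gam
  have hZ := gamZ_pos
  have hm := massX_pos
  refine ⟨massX * (δ * gamZ⁻¹), by positivity, fun h hh hi => ?_⟩
  -- The invariant is the projection in L²(γ); subtracting it leaves the defect unchanged.
  obtain ⟨x, hx⟩ : invS.starProjection (hh.toLp h) ∈ invS := Submodule.starProjection_apply_mem _ _
  set f : L2g := hh.toLp h - invL x with hf
  have hfm : f ∈ invSᗮ := by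
    rw [hf, hx]; exact Submodule.sub_starProjection_mem_orthogonal _
  have hae : f =ᵐ[gam] fun v => h v - invF x v := by
    filter_upwards [Lp.coeFn_sub (hh.toLp h) (invL x), hh.coeFn_toLp,
      (memLp_invF x).coeFn_toLp] with v h1 h2 h3
    rw [h1, Pi.sub_apply, h2]
    exact congrArg _ h3
  have hd : (fun p : X => q p.2.2 p.2.1 p.1 * defect f p ^ 2) =ᵐ[gamX]
      fun p => q p.2.2 p.2.1 p.1 * defect h p ^ 2 := by
    filter_upwards [defect_ae_eq hae] with p hp
    rw [hp, defect_sub_invF]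
  have e : ∀ p : X, q p.2.2 p.2.1 p.1 * (maxw p.2.1 * maxw p.1) * defect h p ^ 2 =
      maxw p.2.1 * maxw p.1 * (q p.2.2 p.2.1 p.1 * defect h p ^ 2) := fun p => by ring
  simp only [e] at hi ⊢
  have hn : ‖f‖ ^ 2 = gamZ⁻¹ * ∫ v, maxw v * (h v - invF x v) ^ 2 := by
    rw [← real_inner_self_eq_norm_sq, L2.inner_def, integral_congr_ae
      (g := fun v => (h v - invF x v) ^ 2) (by
        filter_upwards [hae] with v hv; rw [hv]; simp [sq]), integral_gam]
    simp only [mul_comm]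
  refine ⟨x, ?_⟩
  have := H f hfm ((integrable_gamX_of_maxw_mul hi).congr hd.symm)
  rw [integral_congr_ae hd, hn] at this
  rw [integral_maxw_mul]
  calc _ = massX * (δ * (gamZ⁻¹ * ∫ v, maxw v * (h v - invF x v) ^ 2)) := by ring
    _ ≤ _ := by gcongr

section

variable {θ ρ : ℝ}

/-! ### Coercivity in the `ν`-norm -/

lemma memNu_iff (hθ : |θ| ≤ 1) (hρ : 1 < ρ) {f : V → ℝ} (hf : AEStronglyMeasurable f volume) :
    MemNu θ ρ f ↔ MemLp (fun v => √(nu θ ρ v) * f v) 2 volume := by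
  have hm : AEStronglyMeasurable (fun v => √(nu θ ρ v) * f v) volume :=
    (measurable_nu hθ hρ).sqrt.aestronglyMeasurable.mul hf
  rw [memLp_two_iff_integrable_sq hm, MemNu]
  simp only [mul_pow, Real.sq_sqrt (nu_nonneg hθ hρ _), hf, true_and]

lemma MemNu.sub (hθ : |θ| ≤ 1) (hρ : 1 < ρ) {f g : V → ℝ} (hf : MemNu θ ρ f)
    (hg : MemNu θ ρ g) : MemNu θ ρ (f - g) := by
  rw [memNu_iff hθ hρ (hf.1.sub hg.1)]
  refine (((memNu_iff hθ hρ hf.1).1 hf).sub ((memNu_iff hθ hρ hg.1).1 hg)).ae_eq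
    (Filter.Eventually.of_forall fun v => ?_)
  simp only [Pi.sub_apply]; ring

lemma MemNu.congr {f g : V → ℝ} (hf : MemNu θ ρ f) (h : f =ᵐ[volume] g) : MemNu θ ρ g :=
  ⟨hf.1.congr h, hf.2.congr (by filter_upwards [h] with v hv; rw [hv])⟩

lemma integral_nu_sub_sq_le (hθ : |θ| ≤ 1) (hρ : 1 < ρ) {f g : V → ℝ} (hf : MemNu θ ρ f)
    (hg : MemNu θ ρ g) : ∫ v, nu θ ρ v * (f - g) v ^ 2 ≤
      2 * (∫ v, nu θ ρ v * f v ^ 2) + 2 * ∫ v, nu θ ρ v * g v ^ 2 := by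
  rw [← integral_const_mul, ← integral_const_mul,
    ← integral_add (hf.2.const_mul 2) (hg.2.const_mul 2)]
  refine integral_mono (hf.sub hθ hρ hg).2 ((hf.2.const_mul 2).add (hg.2.const_mul 2)) fun v => ?_
  have := mul_nonneg (nu_nonneg hθ hρ v) (sq_nonneg (f v + g v))
  simp only [Pi.sub_apply]
  nlinarith

lemma invariantFun_eq (x : ℝ × V × ℝ) :
    invariantFun θ ρ x.1 x.2.1 x.2.2 = fun v => √(M θ ρ v) * invF x v := rfl

lemma memNu_invariantFun (hθ : |θ| ≤ 1) (hρ : 1 < ρ) (a : ℝ) (b : V) (c : ℝ) :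
    MemNu θ ρ (invariantFun θ ρ a b c) := by
  have hm := (measurable_invariantFun θ ρ a b c).aestronglyMeasurable (μ := volume)
  obtain ⟨C, hC, hν⟩ := nu_le hθ hρ
  rw [memNu_iff hθ hρ hm]
  set K := |a| + ‖b‖ + |c| with hK
  refine ((memLp_one_add_mul_sqrt_M hθ hρ 3).const_mul (√C * K)).mono
    ((measurable_nu hθ hρ).sqrt.aestronglyMeasurable.mul hm)
    (Filter.Eventually.of_forall fun v => ?_)
  have h1 : √(nu θ ρ v) ≤ √C * (1 + ‖v‖) := by
    rw [Real.sqrt_le_left (by positivity), mul_pow, Real.sq_sqrt hC]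
    refine (hν v).trans (mul_le_mul_of_nonneg_left ?_ hC)
    nlinarith [norm_nonneg v]
  have h2 : |invF (a, b, c) v| ≤ K * (1 + ‖v‖) ^ 2 := abs_invF_le (a, b, c) v
  rw [invariantFun_eq (a, b, c), Real.norm_eq_abs, Real.norm_eq_abs,
    abs_of_nonneg (a := √C * K * _) (by positivity), abs_mul, abs_mul,
    abs_of_nonneg (Real.sqrt_nonneg _), abs_of_nonneg (Real.sqrt_nonneg _)]
  calc _ ≤ (√C * (1 + ‖v‖)) * (√(M θ ρ v) * (K * (1 + ‖v‖) ^ 2)) := by gcongr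
    _ = _ := by ring

lemma red_sub_invariantFun (hθ : |θ| ≤ 1) (hρ : 1 < ρ) (g : V → ℝ) (x : ℝ × V × ℝ) :
    red θ ρ (g - invariantFun θ ρ x.1 x.2.1 x.2.2) = fun v => red θ ρ g v - invF x v := by
  funext v
  have := (Real.sqrt_pos.2 (M_pos hθ hρ v)).ne'
  simp only [red, Pi.sub_apply, invariantFun_eq]
  field_simp

lemma memLp_red (hθ : |θ| ≤ 1) (hρ : 1 < ρ) {g : V → ℝ} (hg : MemLp g 2 volume) :
    MemLp (red θ ρ g) 2 gam := by
  have hm := aestronglyMeasurable_red hθ hρ hg.1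
  rw [memLp_two_iff_integrable_sq (hm.mono_ac gam_absolutelyContinuous), integrable_gam_iff]
  have hρ0 : 0 < ρ := by linarith
  set b := ρ * (ρ + 1)⁻¹ ^ 2 with hb
  have hb0 : 0 < b := by positivity
  refine (hg.integrable_sq.const_mul b⁻¹).mono'
    ((hm.pow 2).mul continuous_maxw.aestronglyMeasurable) (Filter.Eventually.of_forall fun v => ?_)
  rw [Real.norm_of_nonneg (mul_nonneg (sq_nonneg _) (maxw_pos v).le), ← red_sq_mul_M hθ hρ g v,
    inv_mul_eq_div, le_div_iff₀ hb0]
  have := mul_le_mul_of_nonneg_left (M_ge hθ hρ v) (sq_nonneg (red θ ρ g v))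
  rw [← hb] at this
  linarith

/-- The squared ν-norm of φ = g - M^{1/2}(invariant) is a quarter of the form plus the gain part of
φ. The latter is at most C‖φ‖², and the hard-sphere gap bounds ‖φ‖² by the form. The invariant is
optimal for the Gaussian weight, not for L²(dv), so φ need not be (I - P)g. -/
lemma exists_coercive (hθ : |θ| ≤ 1) (hρ : 1 < ρ) : ∃ K, 0 < K ∧ ∀ g : V → ℝ, MemNu θ ρ g →
    ∃ x : ℝ × V × ℝ, ∫ v, nu θ ρ v * (g - invariantFun θ ρ x.1 x.2.1 x.2.2) v ^ 2 ≤
      K * pairing (L θ ρ g) g := by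
  obtain ⟨δ, hδ, H⟩ := exists_hardSphere_gap
  obtain ⟨C, hC, HC⟩ := gainLoss_bound hθ hρ
  have hρ0 : 0 < ρ := by linarith
  have hρ1 : 0 < ρ - 1 := by linarith
  set a := (ρ + 1)⁻¹ ^ 4 * ρ ^ 2 with ha
  have ha0 : 0 < a := by positivity
  set b := ρ * (ρ - 1)⁻¹ ^ 2 with hb
  have hb0 : 0 < b := by positivity
  -- The pairing is J/4 and ‖φ‖_ν² ≤ J/4 + C b δ⁻¹ a⁻¹ J, with J the integral of `kern` times the
  -- squared defect.
  refine ⟨1 + 4 * (C * (b * (δ⁻¹ * a⁻¹))), by positivity, fun g hg => ?_⟩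
  set J := ∫ p, kern θ ρ p * defect (red θ ρ g) p ^ 2 ∂volX with hJ
  have hJi := integrable_kern_mul_defect_sq hθ hρ hg
  have hdm : AEStronglyMeasurable (fun p : X => q p.2.2 p.2.1 p.1 * (maxw p.2.1 * maxw p.1) *
      defect (red θ ρ g) p ^ 2) volX := by
    have hr := aestronglyMeasurable_red (θ := θ) (ρ := ρ) hθ hρ hg.1
    have h1 : AEStronglyMeasurable (fun p : X => red θ ρ g p.1) volX :=
      hr.comp_fst (ν := (volume : Measure V).prod surf)
    have h2 := h1.comp_measurePreserving measurePreserving_exch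
    have h3 := h1.comp_measurePreserving measurePreserving_collide
    have h4 := h2.comp_measurePreserving measurePreserving_collide
    have hc := continuous_maxw
    have hq := continuous_q
    exact (hq.mul (by fun_prop : Continuous fun p : X =>
      maxw p.2.1 * maxw p.1)).aestronglyMeasurable.mul ((((h3.add h4).sub h1).sub h2).pow 2)
  have hle : ∀ p : X, q p.2.2 p.2.1 p.1 * (maxw p.2.1 * maxw p.1) * defect (red θ ρ g) p ^ 2 ≤
      a⁻¹ * (kern θ ρ p * defect (red θ ρ g) p ^ 2) := fun p => by
    rw [inv_mul_eq_div, le_div_iff₀ ha0]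
    have := mul_le_mul_of_nonneg_right (kern_ge hθ hρ p) (sq_nonneg (defect (red θ ρ g) p))
    rw [← ha] at this
    linarith
  have hmi : Integrable (fun p : X => q p.2.2 p.2.1 p.1 * (maxw p.2.1 * maxw p.1) *
      defect (red θ ρ g) p ^ 2) volX := by
    refine (hJi.const_mul a⁻¹).mono' hdm (Filter.Eventually.of_forall fun p => ?_)
    rw [Real.norm_of_nonneg]
    · exact hle p
    · have := q_nonneg p.2.2 p.2.1 p.1
      have := maxw_pos p.1
      have := maxw_pos p.2.1
      positivity
  have hL := hg.memLp hθ hρ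
  obtain ⟨x, hx⟩ := H _ (memLp_red hθ hρ hL) hmi
  refine ⟨x, ?_⟩
  set φ := g - invariantFun θ ρ x.1 x.2.1 x.2.2 with hφ
  have hφν : MemNu θ ρ φ := hg.sub hθ hρ (memNu_invariantFun hθ hρ _ _ _)
  have hφL := hφν.memLp hθ hρ
  have hred := red_sub_invariantFun hθ hρ g x
  rw [← hφ] at hred
  have hmJ : ∫ p : X, q p.2.2 p.2.1 p.1 * (maxw p.2.1 * maxw p.1) *
      defect (red θ ρ g) p ^ 2 ∂volX ≤ a⁻¹ * J := by
    rw [hJ, ← integral_const_mul]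
    exact integral_mono hmi (hJi.const_mul a⁻¹) hle
  have hi := integrable_gam_iff.1 (memLp_red hθ hρ hφL).integrable_sq
  have hsq : ∫ v, φ v ^ 2 ≤ b * ∫ v, maxw v * (red θ ρ g v - invF x v) ^ 2 := by
    rw [← integral_const_mul]
    have e : ∀ v, red θ ρ φ v ^ 2 * maxw v = maxw v * (red θ ρ g v - invF x v) ^ 2 := fun v => by
      rw [hred]; ring
    simp only [e] at hi
    refine integral_mono hφL.integrable_sq (hi.const_mul b) fun v => ?_
    simp only
    rw [← red_sq_mul_M hθ hρ φ v, ← e]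
    have := mul_le_mul_of_nonneg_left (M_le hθ hρ v) (sq_nonneg (red θ ρ φ v))
    rw [← hb] at this
    linarith
  have hsqJ : ∫ v, φ v ^ 2 ≤ b * (δ⁻¹ * a⁻¹) * J := by
    have h1 : ∫ v, maxw v * (red θ ρ g v - invF x v) ^ 2 ≤ δ⁻¹ * (a⁻¹ * J) := by
      rw [inv_mul_eq_div δ, le_div_iff₀ hδ]
      linarith
    calc _ ≤ b * (δ⁻¹ * (a⁻¹ * J)) := hsq.trans (mul_le_mul_of_nonneg_left h1 hb0.le)
      _ = _ := by ring
  have hJφ : J = 4 * (∫ v, nu θ ρ v * φ v ^ 2) -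
      4 * ∫ p, kern θ ρ p * (gainLoss (red θ ρ φ) p * red θ ρ φ p.1) ∂volX := by
    rw [← integral_kern_mul_defect_sq_eq hθ hρ hφν, hJ, hred]
    simp only [defect_sub_invF]
  have hgain := (HC φ hφL).2
  have hp : pairing (L θ ρ g) g = 1 / 4 * J := pairing_L_self hθ hρ hg
  have := mul_le_mul_of_nonneg_left hsqJ hC
  rw [hp]
  linarith

lemma exists_integral_sq_le (hθ : |θ| ≤ 1) (hρ : 1 < ρ) : ∃ c, 0 < c ∧ ∀ f : V → ℝ,
    MemNu θ ρ f → c * ∫ v, f v ^ 2 ≤ ∫ v, nu θ ρ v * f v ^ 2 := by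
  obtain ⟨c, hc, h⟩ := nu_ge hθ hρ
  refine ⟨c, hc, fun f hf => ?_⟩
  rw [← integral_const_mul]
  exact integral_mono ((hf.memLp hθ hρ).integrable_sq.const_mul c) hf.2 fun v =>
    mul_le_mul_of_nonneg_right (h v) (sq_nonneg _)

/-! ### The null space -/

lemma MemNu.of_mem_nullSpace (hθ : |θ| ≤ 1) (hρ : 1 < ρ) {p : Lp ℝ 2 (volume : Measure V)}
    (hp : p ∈ nullSpace θ ρ) : MemNu θ ρ p := by
  obtain ⟨a, b, c, h⟩ := hp
  exact (memNu_invariantFun hθ hρ a b c).congr h.symm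

lemma defect_ae_eq_volX {h k : V → ℝ} (hk : h =ᵐ[volume] k) : defect h =ᵐ[volX] defect k := by
  have key : ∀ {T : X → X}, MeasurePreserving T volX volX →
      (fun p => h (T p).1) =ᵐ[volX] fun p => k (T p).1 := fun hT =>
    (Measure.quasiMeasurePreserving_fst.comp hT.quasiMeasurePreserving).ae_eq_comp hk
  filter_upwards [key measurePreserving_collide, key measurePreserving_collideExch,
    key (MeasurePreserving.id volX), key measurePreserving_exch] with p h1 h2 h3 h4
  simp only [collideExch_eq, collide, exch, id] at h1 h2 h3 h4
  simp only [defect, h1, h2, h3, h4]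

lemma L_eq_zero_of_ae_eq_invariantFun (hθ : |θ| ≤ 1) (hρ : 1 < ρ) {f : V → ℝ} {a : ℝ} {b : V}
    {c : ℝ} (hf : f =ᵐ[volume] invariantFun θ ρ a b c) : L θ ρ f =ᵐ[volume] 0 := by
  have hL : MemLp f 2 volume :=
    ((memNu_invariantFun hθ hρ a b c).congr hf.symm).memLp hθ hρ
  have hr : red θ ρ f =ᵐ[volume] invF (a, b, c) := by
    filter_upwards [hf] with v hv
    have := (Real.sqrt_pos.2 (M_pos hθ hρ v)).ne'
    rw [red, hv, invariantFun_eq (a, b, c)]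
    field_simp
  have hd : ∀ᵐ p ∂volX, linIntegrand θ ρ (red θ ρ f) p = 0 := by
    filter_upwards [defect_ae_eq_volX hr] with p hp
    have h0 := invF_post (a, b, c) p.2.1 p.1 p.2.2
    rw [linIntegrand_eq, hp, defect, h0]; ring
  filter_upwards [ae_LConverges hθ hρ hL, Measure.ae_ae_of_ae_prod hd] with v hv hdv
  rw [L_eq_of_converges hθ hρ hv, integral_congr_ae hdv]
  simp

/-- Coercivity requires finite ν-norm, which L f = 0 itself supplies through `memNu_of_L_eq_zero`;
the vanishing pairing then forces f to equal an invariant. -/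
lemma mem_nullSpace_of_L_eq_zero (hθ : |θ| ≤ 1) (hρ : 1 < ρ)
    {f : Lp ℝ 2 (volume : Measure V)} (hL : L θ ρ f =ᵐ[volume] 0) : f ∈ nullSpace θ ρ := by
  obtain ⟨C, -, HC⟩ := gainLoss_bound hθ hρ
  obtain ⟨K, -, HK⟩ := exists_coercive hθ hρ
  obtain ⟨c, hc, Hc⟩ := exists_integral_sq_le hθ hρ
  have hf := Lp.memLp f
  have hν : MemNu θ ρ f := memNu_of_L_eq_zero hθ hρ hf hL (HC f hf).1
  obtain ⟨x, hx⟩ := HK f hν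
  have hφ := hν.sub hθ hρ (memNu_invariantFun hθ hρ x.1 x.2.1 x.2.2)
  have h0 : pairing (L θ ρ f) f = 0 := by
    rw [pairing, integral_congr_ae (g := fun _ => 0) (by filter_upwards [hL] with v hv; simp [hv]),
      integral_zero]
  rw [h0, mul_zero] at hx
  have h1 : ∫ v, (f - invariantFun θ ρ x.1 x.2.1 x.2.2) v ^ 2 = 0 := by
    refine le_antisymm ?_ (integral_nonneg fun v => sq_nonneg _)
    have := Hc _ hφ
    exact nonpos_of_mul_nonpos_right (this.trans hx) hc
  rw [integral_eq_zero_iff_of_nonneg (fun v => sq_nonneg _)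
    (hφ.memLp hθ hρ).integrable_sq] at h1
  refine ⟨x.1, x.2.1, x.2.2, ?_⟩
  filter_upwards [h1] with v hv
  simpa [sub_eq_zero] using hv

lemma invF_injective {x : ℝ × V × ℝ} (h : ∀ v, invF x v = 0) : x = 0 := by
  obtain ⟨a, b, c⟩ := x
  simp only [invF] at h
  have ha : a = 0 := by simpa using h 0
  subst ha
  have h1 := h b
  have h2 := h (-b)
  rw [real_inner_self_eq_norm_sq] at h1
  rw [inner_neg_right, real_inner_self_eq_norm_sq, norm_neg] at h2
  have hb : b = 0 := by
    have : ‖b‖ ^ 2 = 0 := by linarith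
    simpa using this
  subst hb
  have h3 := h e0
  rw [norm_e0] at h3
  have hc : c = 0 := by simpa using h3
  rw [hc]; rfl

lemma memLp_invariantFun (hθ : |θ| ≤ 1) (hρ : 1 < ρ) (x : ℝ × V × ℝ) :
    MemLp (invariantFun θ ρ x.1 x.2.1 x.2.2) 2 volume :=
  (memNu_invariantFun hθ hρ x.1 x.2.1 x.2.2).memLp hθ hρ

/-- Coefficients to elements of the null space. -/
def invariantMap (hθ : |θ| ≤ 1) (hρ : 1 < ρ) : (ℝ × V × ℝ) →ₗ[ℝ] nullSpace θ ρ where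
  toFun x := ⟨(memLp_invariantFun hθ hρ x).toLp _, x.1, x.2.1, x.2.2, MemLp.coeFn_toLp _⟩
  map_add' x y := by
    refine Subtype.ext (Eq.trans ?_
      (MemLp.toLp_add (memLp_invariantFun hθ hρ x) (memLp_invariantFun hθ hρ y)))
    refine MemLp.toLp_congr (memLp_invariantFun hθ hρ (x + y)) _ (Filter.Eventually.of_forall fun v => ?_)
    simp only [invariantFun, Pi.add_apply, Prod.fst_add, Prod.snd_add, inner_add_left]; ring
  map_smul' r x := by
    refine Subtype.ext (Eq.trans ?_ (MemLp.toLp_const_smul r (memLp_invariantFun hθ hρ x)))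
    refine MemLp.toLp_congr (memLp_invariantFun hθ hρ (r • x)) _ (Filter.Eventually.of_forall fun v => ?_)
    simp only [invariantFun, Pi.smul_apply, Prod.smul_fst, Prod.smul_snd, real_inner_smul_left,
      smul_eq_mul]
    ring

lemma invariantMap_bijective (hθ : |θ| ≤ 1) (hρ : 1 < ρ) :
    Function.Bijective (invariantMap hθ hρ) := by
  refine ⟨(injective_iff_map_eq_zero _).2 fun x hx => ?_, fun p => ?_⟩
  · have h1 : invariantFun θ ρ x.1 x.2.1 x.2.2 =ᵐ[volume] 0 :=
      (MemLp.toLp_eq_toLp_iff (memLp_invariantFun hθ hρ x) MemLp.zero').1 (congrArg Subtype.val hx)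
    have h2 : invF x =ᵐ[volume] fun _ => 0 := by
      filter_upwards [h1] with v hv
      have := (Real.sqrt_pos.2 (M_pos hθ hρ v)).ne'
      rw [invariantFun_eq] at hv
      simpa [this] using hv
    rw [Continuous.ae_eq_iff_eq _ (continuous_invF x) continuous_const] at h2
    exact invF_injective fun v => congrFun h2 v
  · obtain ⟨p, a, b, c, h⟩ := p
    refine ⟨(a, b, c), Subtype.ext (Lp.ext ?_)⟩
    exact (memLp_invariantFun hθ hρ (a, b, c)).coeFn_toLp.trans h.symm

lemma finrank_nullSpace (hθ : |θ| ≤ 1) (hρ : 1 < ρ) :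
    Module.finrank ℝ (nullSpace θ ρ) = 5 := by
  rw [← (LinearEquiv.ofBijective _ (invariantMap_bijective hθ hρ)).finrank_eq]
  simp

/-! ### The orthogonal projection in the `ν`-norm -/

lemma memLp_sqrt_nu_mul (hθ : |θ| ≤ 1) (hρ : 1 < ρ) (p : nullSpace θ ρ) :
    MemLp (fun v => √(nu θ ρ v) * p.1 v) 2 volume :=
  (memNu_iff hθ hρ (Lp.aestronglyMeasurable p.1)).1 (MemNu.of_mem_nullSpace hθ hρ p.2)

/-- `p ↦ ν^{1/2} p` on the null space. -/
def sqrtNuMul (hθ : |θ| ≤ 1) (hρ : 1 < ρ) :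
    nullSpace θ ρ →ₗ[ℝ] Lp ℝ 2 (volume : Measure V) where
  toFun p := (memLp_sqrt_nu_mul hθ hρ p).toLp _
  map_add' p p' := by
    refine Eq.trans (MemLp.toLp_congr _ _ ?_)
      (MemLp.toLp_add (memLp_sqrt_nu_mul hθ hρ p) (memLp_sqrt_nu_mul hθ hρ p'))
    filter_upwards [Lp.coeFn_add p.1 p'.1] with v hv
    rw [Submodule.coe_add, hv, Pi.add_apply, Pi.add_apply, mul_add]
  map_smul' r p := by
    refine Eq.trans (MemLp.toLp_congr _ _ ?_)
      (MemLp.toLp_const_smul r (memLp_sqrt_nu_mul hθ hρ p))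
    filter_upwards [Lp.coeFn_smul r p.1] with v hv
    rw [Submodule.coe_smul, hv, Pi.smul_apply, Pi.smul_apply, smul_eq_mul, smul_eq_mul,
      mul_left_comm]

lemma norm_toLp_sq {f : V → ℝ} (hf : MemLp f 2 volume) : ‖hf.toLp f‖ ^ 2 = ∫ v, f v ^ 2 := by
  rw [← real_inner_self_eq_norm_sq, inner_toLp]
  simp only [sq]

lemma P_eq {f : V → ℝ} (hf : MemLp f 2 volume) :
    P θ ρ f = ((nullSpace θ ρ).starProjection (hf.toLp f) : Lp ℝ 2 (volume : Measure V)) := by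
  rw [P, dif_pos hf]

lemma memNu_P (hθ : |θ| ≤ 1) (hρ : 1 < ρ) {f : V → ℝ} (hf : MemLp f 2 volume) :
    MemNu θ ρ (P θ ρ f) := by
  rw [P_eq hf]
  exact MemNu.of_mem_nullSpace hθ hρ (Submodule.starProjection_apply_mem _ _)

/-- The null space is finite-dimensional, so multiplication by ν^{1/2} is automatically bounded on
it, although ν itself is not shown to be bounded. -/
lemma exists_integral_nu_P_sq_le (hθ : |θ| ≤ 1) (hρ : 1 < ρ) : ∃ C, 0 ≤ C ∧ ∀ f : V → ℝ,
    MemLp f 2 volume → ∫ v, nu θ ρ v * P θ ρ f v ^ 2 ≤ C * ∫ v, f v ^ 2 := by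
  set A := LinearMap.toContinuousLinearMap (sqrtNuMul hθ hρ) with hA
  refine ⟨‖A‖ ^ 2, by positivity, fun f hf => ?_⟩
  set p : nullSpace θ ρ := ⟨(nullSpace θ ρ).starProjection (hf.toLp f),
    Submodule.starProjection_apply_mem _ _⟩ with hp
  have h1 : ‖A p‖ ^ 2 = ∫ v, nu θ ρ v * P θ ρ f v ^ 2 := by
    refine (norm_toLp_sq (memLp_sqrt_nu_mul hθ hρ p)).trans ?_
    rw [P_eq hf]
    simp only [mul_pow, Real.sq_sqrt (nu_nonneg hθ hρ _)]
    rfl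
  have h0 : ‖p‖ ≤ ‖hf.toLp f‖ := (nullSpace θ ρ).norm_starProjection_apply_le (hf.toLp f)
  have h2 : ‖A p‖ ≤ ‖A‖ * ‖hf.toLp f‖ :=
    (A.le_opNorm p).trans (mul_le_mul_of_nonneg_left h0 A.opNorm_nonneg)
  rw [← h1, ← norm_toLp_sq hf, ← mul_pow]
  exact pow_le_pow_left₀ (norm_nonneg _) h2 2

/-- I - P annihilates the invariants. Any invariant may therefore be subtracted beforehand, in
particular the one from `exists_coercive`. -/
lemma sub_P_ae_eq (hθ : |θ| ≤ 1) (hρ : 1 < ρ) {g : V → ℝ} (hg : MemLp g 2 volume)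
    (x : ℝ × V × ℝ) :
    g - P θ ρ g =ᵐ[volume] (g - invariantFun θ ρ x.1 x.2.1 x.2.2) -
      P θ ρ (g - invariantFun θ ρ x.1 x.2.1 x.2.2) := by
  have hi := memLp_invariantFun hθ hρ x
  have hmem : hi.toLp _ ∈ nullSpace θ ρ := ⟨x.1, x.2.1, x.2.2, hi.coeFn_toLp⟩
  rw [P_eq hg, P_eq (hg.sub hi), MemLp.toLp_sub hg hi, map_sub,
    Submodule.starProjection_eq_self_iff.2 hmem]
  filter_upwards [Lp.coeFn_sub ((nullSpace θ ρ).starProjection (hg.toLp g)) (hi.toLp _),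
    hi.coeFn_toLp] with v h1 h2
  simp only [Pi.sub_apply, h1, h2]
  ring

lemma exists_coercive_sub_P (hθ : |θ| ≤ 1) (hρ : 1 < ρ) : ∃ δ, 0 < δ ∧ ∀ g : V → ℝ,
    MemNu θ ρ g → δ * nuNorm θ ρ (g - P θ ρ g) ^ 2 ≤ pairing (L θ ρ g) g := by
  obtain ⟨K, hK, HK⟩ := exists_coercive hθ hρ
  obtain ⟨c, hc, Hc⟩ := exists_integral_sq_le hθ hρ
  obtain ⟨C, hC, HC⟩ := exists_integral_nu_P_sq_le hθ hρ
  -- From ‖φ - Pφ‖_ν² ≤ 2‖φ‖_ν² + 2‖Pφ‖_ν², with ‖Pφ‖_ν² ≤ C‖φ‖² ≤ C c⁻¹‖φ‖_ν².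
  refine ⟨((2 + 2 * (C * c⁻¹)) * K)⁻¹, by positivity, fun g hg => ?_⟩
  obtain ⟨x, hx⟩ := HK g hg
  have hgL := hg.memLp hθ hρ
  have hφ := hg.sub hθ hρ (memNu_invariantFun hθ hρ x.1 x.2.1 x.2.2)
  set φ := g - invariantFun θ ρ x.1 x.2.1 x.2.2 with hφdef
  have hφL := hφ.memLp hθ hρ
  have h1 : nuNorm θ ρ (g - P θ ρ g) ^ 2 = ∫ v, nu θ ρ v * (φ - P θ ρ φ) v ^ 2 := by
    rw [nuNorm, Real.sq_sqrt (integral_nonneg fun v =>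
      mul_nonneg (nu_nonneg hθ hρ v) (sq_nonneg _))]
    refine integral_congr_ae ?_
    filter_upwards [sub_P_ae_eq hθ hρ hgL x] with v hv
    rw [hv]
  have h2 := integral_nu_sub_sq_le hθ hρ hφ (memNu_P hθ hρ hφL)
  have h3 := HC φ hφL
  have h4 : ∫ v, φ v ^ 2 ≤ c⁻¹ * ∫ v, nu θ ρ v * φ v ^ 2 := by
    rw [inv_mul_eq_div, le_div_iff₀ hc, mul_comm]; exact Hc φ hφ
  have h5 := mul_le_mul_of_nonneg_left h4 hC
  have h6 : nuNorm θ ρ (g - P θ ρ g) ^ 2 ≤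
      (2 + 2 * (C * c⁻¹)) * ∫ v, nu θ ρ v * φ v ^ 2 := by
    rw [h1]; linarith
  rw [inv_mul_eq_div, div_le_iff₀ (by positivity)]
  calc _ ≤ _ := h6
    _ ≤ (2 + 2 * (C * c⁻¹)) * (K * pairing (L θ ρ g) g) := by gcongr
    _ = _ := by ring

end

end QBoltzmann

end

theorem mainTheorem7 (θ ρ : ℝ) (hθ : θ = -1 ∨ θ = 0 ∨ θ = 1) (hρ : 1 < ρ) :
    (∀ f : QBoltzmann.V → ℝ, MemLp f 2 volume →
      ∀ᵐ v : QBoltzmann.V, QBoltzmann.LConverges θ ρ f v) ∧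
    (∀ f : Lp ℝ 2 (volume : Measure QBoltzmann.V),
      f ∈ QBoltzmann.nullSpace θ ρ ↔ QBoltzmann.L θ ρ f =ᵐ[volume] 0) ∧
    Module.finrank ℝ (QBoltzmann.nullSpace θ ρ) = 5 ∧
    ∃ δ : ℝ, 0 < δ ∧ ∀ g : QBoltzmann.V → ℝ, QBoltzmann.MemNu θ ρ g →
      MemLp g 2 volume ∧
      QBoltzmann.MemNu θ ρ (g - QBoltzmann.P θ ρ g) ∧
      Integrable (fun v => QBoltzmann.L θ ρ g v * g v) volume ∧
      δ * QBoltzmann.nuNorm θ ρ (g - QBoltzmann.P θ ρ g) ^ 2 ≤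
        QBoltzmann.pairing (QBoltzmann.L θ ρ g) g := by
  have h : |θ| ≤ 1 := by rcases hθ with rfl | rfl | rfl <;> simp
  refine ⟨fun f hf => QBoltzmann.ae_LConverges h hρ hf, fun f => ⟨?_, ?_⟩,
    QBoltzmann.finrank_nullSpace h hρ, ?_⟩
  · rintro ⟨a, b, c, hf⟩
    exact QBoltzmann.L_eq_zero_of_ae_eq_invariantFun h hρ hf
  · exact QBoltzmann.mem_nullSpace_of_L_eq_zero h hρ
  · obtain ⟨δ, hδ, H⟩ := QBoltzmann.exists_coercive_sub_P h hρ
    exact ⟨δ, hδ, fun g hg => ⟨hg.memLp h hρ,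
      hg.sub h hρ (QBoltzmann.memNu_P h hρ (hg.memLp h hρ)),
      QBoltzmann.integrable_L_mul_self h hρ hg, H g hg⟩⟩
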